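/- Let $k,\ell\ge 1$ be integers. For a finite set $\mathcal H=\{h_1,\dots,h_k\}$ of $k$ distinct positive integers and a prime $p$, let $\Omega(p)$ be the set of different residue classes among $-h \pmod p$, $h\in\mathcal H$; call $\mathcal H$ admissible if $|\Omega(p)|<p$ for all primes $p$. Put $P(n;\mathcal H)=\prod_{h\in\mathcal H}(n+h)$, $$\mathfrak S(\mathcal H)=\prod_p\Bigl(1-\frac{|\Omega(p)|}{p}\Bigr)\Bigl(1-\frac1p\Bigr)^{-k},\qquad \Lambda_R(n;\mathcal H,a)=\frac1{a!}\sum_{\substack{d\mid P(n;\mathcal H)\\ d\le R}}\mu(d)\Bigl(\log\frac Rd\Bigr)^a .$$ There are constants $C,c,K>0$, depending only on $k$ and $\ell$, such that for all $A,B>0$ there is an $N_0$ with the following property. For all real $N\ge N_0$, $H$ and $R>0$ with $$H\le A\log N,\qquad \log N\le B\log R,\qquad \log R\le\log N,\qquad R\le \frac{N^{1/2}}{(\log N)^{C}},$$ and for every admissible set $\mathcal H\subseteq[1,H]\cap\mathbb Z$ with $|\mathcal H|=k$, we have $$\Bigl|\sum_{N<n\le 2N}\Lambda_R(n;\mathcal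 H,k+\ell)^2-\frac{\mathfrak S(\mathcal H)}{(k+2\ell)!}\binom{2\ell}{\ell}N(\log R)^{k+2\ell}\Bigr|\le K\,N(\log N)^{k+2\ell-1}(\log\log N)^{c}.$$ -/

import Mathlib

open scoped BigOperators

namespace SmallGaps

/-- The set `Ω(p)` of the different residue classes among `-h (mod p)`, `h ∈ 𝓗`. -/
def Omega (𝓗 : Finset ℕ) (p : ℕ) : Finset (ZMod p) :=
  𝓗.image fun h : ℕ => -(h : ZMod p)

/-- `𝓗` is admissible if `|Ω(p)| < p` for every prime `p`. -/
def Admissible (𝓗 : Finset ℕ) : Prop :=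
  ∀ p : ℕ, p.Prime → (Omega 𝓗 p).card < p

/-- `P(n; 𝓗) = ∏_{h ∈ 𝓗} (n + h)`. -/
def tuplePoly (𝓗 : Finset ℕ) (n : ℕ) : ℕ :=
  ∏ h ∈ 𝓗, (n + h)

/-- `λ_R(d; a) = μ(d) (log (R/d))^a / a!` for `d ≤ R`, and `0` for `d > R`. -/
noncomputable def lambdaR (R : ℝ) (d a : ℕ) : ℝ :=
  if (d : ℝ) ≤ R then
    1 / (a.factorial : ℝ) * (ArithmeticFunction.moebius d : ℝ) * Real.log (R / d) ^ a
  else 0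

/-- `Λ_R(n; 𝓗, a) = ∑_{d ∣ P(n; 𝓗)} λ_R(d; a)`. Here `P(n; 𝓗) ≠ 0` whenever `n ≥ 1`, so
`Nat.divisors` is the set of all its positive divisors. -/
noncomputable def LambdaR (R : ℝ) (n : ℕ) (𝓗 : Finset ℕ) (a : ℕ) : ℝ :=
  ∑ d ∈ (tuplePoly 𝓗 n).divisors, lambdaR R d a

/-- The Euler factor `(1 - |Ω(p)|/p) (1 - 1/p)^{-k}`, `k = |𝓗|`. -/
noncomputable def singularFactor (𝓗 : Finset ℕ) (p : ℕ) : ℝ :=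
  (1 - ((Omega 𝓗 p).card : ℝ) / p) * ((1 - 1 / (p : ℝ)) ^ 𝓗.card)⁻¹

/-- The singular series `𝔖(𝓗) = ∏_p (1 - |Ω(p)|/p) (1 - 1/p)^{-k}`. -/
noncomputable def singularSeries (𝓗 : Finset ℕ) : ℝ :=
  ∏' p : Nat.Primes, singularFactor 𝓗 p

theorem card_Omega_of_lt {𝓗 : Finset ℕ} {p : ℕ} (hp : ∀ h ∈ 𝓗, h < p) :
    (Omega 𝓗 p).card = 𝓗.card := by
  refine Finset.card_image_of_injOn ?_
  intro a ha b hb hab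
  have h1 : (a : ZMod p) = (b : ZMod p) := neg_injective hab
  rw [ZMod.natCast_eq_natCast_iff] at h1
  exact Nat.ModEq.eq_of_lt_of_lt h1 (hp a ha) (hp b hb)

theorem one_sub_pow_le (k : ℕ) (x : ℝ) (h0 : 0 ≤ x) (h1 : x ≤ 1) :
    (1 - x) ^ k ≤ 1 - k * x + (k : ℝ) ^ 2 * x ^ 2 := by
  induction k with
  | zero => simp
  | succ k ih =>
    have h2 := mul_le_mul_of_nonneg_right ih (sub_nonneg.2 h1)
    rw [pow_succ]
    push_cast
    have hk : (0 : ℝ) ≤ k := Nat.cast_nonneg k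
    have hx2 : 0 ≤ x ^ 2 := sq_nonneg x
    have : 0 ≤ (k : ℝ) ^ 2 * x ^ 2 * x := by positivity
    have : 0 ≤ (k : ℝ) * x ^ 2 := by positivity
    nlinarith

/-- The infinite product defining the singular series converges unconditionally. -/
theorem multipliable_singularFactor (𝓗 : Finset ℕ) :
    Multipliable fun p : Nat.Primes => singularFactor 𝓗 p := by
  set k := 𝓗.card with hk
  have hs : Summable fun p : Nat.Primes => ‖singularFactor 𝓗 p - 1‖ := by
    have hinj : Function.Injective (fun p : Nat.Primes => (p : ℕ)) := Subtype.val_injective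
    have h0 : Summable fun p : Nat.Primes => 2 ^ k * (k : ℝ) ^ 2 * (1 / ((p : ℕ) : ℝ) ^ 2) :=
      ((Real.summable_one_div_nat_pow.2 (by norm_num)).comp_injective hinj).mul_left _
    refine Summable.of_norm_bounded_eventually h0 ?_
    have hfin : {p : Nat.Primes | (p : ℕ) ≤ 𝓗.sup id}.Finite :=
      (Set.finite_Iic (𝓗.sup id)).preimage hinj.injOn
    refine hfin.subset ?_
    intro p hp
    by_contra hlt
    apply hp
    have hlt' : 𝓗.sup id < (p : ℕ) := not_le.1 hlt
    have hc : (Omega 𝓗 p).card = k :=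
      card_Omega_of_lt fun h hh => lt_of_le_of_lt (Finset.le_sup (f := id) hh) hlt'
    have hp2 : (2 : ℝ) ≤ ((p : ℕ) : ℝ) := by exact_mod_cast p.2.two_le
    have hx0 : 0 ≤ 1 / ((p : ℕ) : ℝ) := by positivity
    have hx2 : 1 / ((p : ℕ) : ℝ) ≤ 1 / 2 := one_div_le_one_div_of_le (by norm_num) hp2
    set x : ℝ := 1 / ((p : ℕ) : ℝ) with hx
    have hb := one_add_mul_le_pow (a := -x) (by linarith) k
    have hu := one_sub_pow_le k x hx0 (by linarith)
    have hpos : (1 / 2 : ℝ) ^ k ≤ (1 - x) ^ k :=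
      pow_le_pow_left₀ (by norm_num) (by linarith) k
    have hpos' : 0 < (1 - x) ^ k := pow_pos (by linarith) k
    have he : singularFactor 𝓗 p - 1 = (1 - k * x - (1 - x) ^ k) * ((1 - x) ^ k)⁻¹ := by
      unfold singularFactor
      rw [hc, ← hk, ← hx, sub_mul _ ((1 - x) ^ k), mul_inv_cancel₀ hpos'.ne', hx]
      ring
    have hinv : ((1 - x) ^ k)⁻¹ ≤ 2 ^ k := by
      have := inv_anti₀ (by positivity) hpos
      simpa using this
    have hab : |1 - k * x - (1 - x) ^ k| ≤ (k : ℝ) ^ 2 * x ^ 2 := by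
      have : 1 + -x = 1 - x := by ring
      rw [this] at hb
      rw [abs_le]
      have : 0 ≤ (k : ℝ) ^ 2 * x ^ 2 := by positivity
      constructor <;> nlinarith
    have hx' : 1 / ((p : ℕ) : ℝ) ^ 2 = x ^ 2 := by rw [hx]; ring
    change ‖‖singularFactor 𝓗 p - 1‖‖ ≤ 2 ^ k * (k : ℝ) ^ 2 * (1 / ((p : ℕ) : ℝ) ^ 2)
    rw [norm_norm, he, Real.norm_eq_abs, abs_mul, abs_of_pos (inv_pos.2 hpos'), hx']
    calc _ ≤ ((k : ℝ) ^ 2 * x ^ 2) * 2 ^ k :=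
          mul_le_mul hab hinv (inv_pos.2 hpos').le (by positivity)
      _ = _ := by ring
  have := multipliable_one_add_of_summable hs
  simpa using this

end SmallGaps

/-!
Opening the square and counting the `n` with `d ∣ P(n; 𝓗)` and `e ∣ P(n; 𝓗)` by the Chinese
remainder theorem turns the sum over `n` into `N` times
`∑ μ(d) μ(e) ∏_{p ∣ [d, e]} |Ω(p)| / p * (log R/d)_+ ^ a / a! * (log R/e)_+ ^ a / a!`, where
`a = k + ℓ`, with an error `O(R ^ 2 (log R) ^ (2 (2 k + ℓ)))` (`abs_sum_LambdaR_sq_sub_le`).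
The Euler product of this double sum is
`∏_p (1 - |Ω(p)| (p ^ (-1-s) + p ^ (-1-t) - p ^ (-1-s-t)))`, which is
`ζ(1 + s + t) ^ k / (ζ(1 + s) ^ k ζ(1 + t) ^ k)` times a product converging near `s = t = 0`, equal
to the singular series at that point.

Instead of a double contour integral, the proof lets Dirichlet polynomials in two variables act by
translation on functions on the box `[0, L] ^ 2`, `L = log R`. Translations by `log m > L` act as
zero there, so the factorisation of the Euler product becomes an exact identity between operators
(`act_prod_sieveFactor`), with all series finite. The double sum is the value at the corner
`(L, L)` of the operator applied to the product of the two truncated powers.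

* The operator `ζ(1 + s + t) ^ k / (ζ(1 + s) ^ k ζ(1 + t) ^ k)` is computed directly
  (`exists_abs_act_modelPoly_sub_le`). Applying `ζ(1 + s) ^ (-k)` to a truncated power lowers its
  degree by `k` (`exists_sum_moebius_pow_sub_le`): this is Perron's formula on the line
  `Re s = 1 / (1 + u)`, and it requires `1 / ζ(1 + s) = O(|s|)` to the right of the line
  `Re s = 0`, which follows from the `3-4-1` inequality and `ζ, ζ' = O(|t| ^ (1/4))`. Applying
  `ζ(1 + s + t) ^ k` is an elementary comparison of sums with integrals. The result is
  `binom(2ℓ, ℓ) L ^ (k + 2ℓ) / (k + 2ℓ)!`, with an error smaller by a factor `L / log L` which grows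
  linearly with the distance to the corner.
* The remaining Euler product has bounded `ℓ¹`-norm, with weight `exp (δ * distance)`, up to the
  primes with `|Ω(p)| < k` (`exists_wnorm_prod_localQuot_le`). These divide a difference of two
  elements of `𝓗`, so there are at most `w = O(log log N)` of them (`card_defect_le`). With
  `δ = 1 / log w` they contribute a power of `w`, which is the power of `log log N` in the error
  term. The weighted norm pays for the linear growth of the error, so this product may be replaced
  by the sum of its coefficients (`abs_act_sub_le`), which is a partial product of the singular series.
-/

/-! ### Upper bounds for the zeta function near the line `Re s = 1` -/

namespace SmallGaps

/-- The difference between `(n + 1) ^ (-s)` and `∫ x in n..n+1, x ^ (-s)`. -/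
noncomputable def zetaTerm (n : ℕ) (s : ℂ) : ℂ :=
  ((n : ℂ) + 1) ^ (-s) - ((n : ℂ) ^ (1 - s) - ((n : ℂ) + 1) ^ (1 - s)) / (s - 1)

theorem norm_cpow_sub_cpow_le {a x b : ℝ} (ha : 0 < a) (hax : a ≤ x) (hxb : x ≤ b) {s : ℂ}
    (hs : 0 < s.re) :
    ‖(b : ℂ) ^ (-s) - (x : ℂ) ^ (-s)‖ ≤ ‖s‖ * a ^ (-s.re - 1) * (b - x) := by
  have hs0 : s ≠ 0 := by rintro rfl; simp at hs
  refine norm_image_sub_le_of_norm_deriv_le_segment' (f := fun y : ℝ => (y : ℂ) ^ (-s))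
    (f' := fun y : ℝ => -s * (y : ℂ) ^ (-s - 1)) (a := x) (b := b) ?_ ?_ b ⟨hxb, le_rfl⟩
  · intro y hy
    have hy0 : y ≠ 0 := by have := hy.1; linarith
    exact (hasDerivAt_ofReal_cpow_const (r := -s) hy0 (neg_ne_zero.2 hs0)).hasDerivWithinAt
  · intro y hy
    have hy0 : 0 < y := by have := hy.1; linarith
    rw [norm_mul, norm_neg, Complex.norm_cpow_eq_rpow_re_of_pos hy0]
    refine mul_le_mul_of_nonneg_left ?_ (norm_nonneg _)
    have : (-s - 1).re = -s.re - 1 := by simp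
    rw [this]
    exact Real.rpow_le_rpow_of_nonpos ha (by have := hy.1; linarith) (by linarith)

theorem norm_zetaTerm_le {n : ℕ} (hn : 0 < n) {s : ℂ} (hs : 0 < s.re) (hs1 : s ≠ 1) :
    ‖zetaTerm n s‖ ≤ ‖s‖ * (n : ℝ) ^ (-s.re - 1) := by
  have hn0 : (0 : ℝ) < n := by exact_mod_cast hn
  have hs1' : 1 - s ≠ 0 := sub_ne_zero.2 (Ne.symm hs1)
  have key := norm_image_sub_le_of_norm_deriv_le_segment'
    (f := fun y : ℝ => (y : ℂ) * ((n : ℂ) + 1) ^ (-s) - (y : ℂ) ^ (-s + 1) / (-s + 1))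
    (f' := fun y : ℝ => ((n : ℂ) + 1) ^ (-s) - (y : ℂ) ^ (-s)) (a := n) (b := n + 1)
    (C := ‖s‖ * (n : ℝ) ^ (-s.re - 1)) ?_ ?_ (n + 1) ⟨by linarith, le_rfl⟩
  · have e : (((n : ℝ) + 1 : ℝ) : ℂ) = (n : ℂ) + 1 := by push_cast; ring
    have e2 : -s + 1 = 1 - s := by ring
    have hs2 : s - 1 ≠ 0 := sub_ne_zero.2 hs1
    rw [show (n : ℝ) + 1 - n = 1 by ring, mul_one] at key
    refine le_of_eq_of_le (congrArg norm ?_) key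
    simp only [e, e2, zetaTerm, Complex.ofReal_natCast]
    rw [show s - 1 = -(1 - s) by ring, div_neg]
    ring
  · intro y hy
    have hy0 : y ≠ 0 := by have := hy.1; linarith
    have h := (hasDerivAt_ofReal_cpow_const (r := -s + 1) hy0 (by
      intro h; apply hs1; linear_combination -h)).div_const (-s + 1)
    rw [show -s + 1 - 1 = -s by ring, mul_div_cancel_left₀ _ (by
      intro h; apply hs1; linear_combination -h)] at h
    have h1 : HasDerivAt (fun y : ℝ => (y : ℂ) * ((n : ℂ) + 1) ^ (-s))
        (((n : ℂ) + 1) ^ (-s)) y := by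
      simpa using (Complex.ofRealCLM.hasDerivAt (x := y)).mul_const (((n : ℂ) + 1) ^ (-s))
    exact (h1.sub h).hasDerivWithinAt
  · intro y hy
    have := norm_cpow_sub_cpow_le hn0 hy.1 hy.2.le hs
    have e : (((n : ℝ) + 1 : ℝ) : ℂ) = (n : ℂ) + 1 := by push_cast; ring
    rw [e] at this
    refine this.trans ?_
    have h1 : (n : ℝ) + 1 - y ≤ 1 := by have := hy.1; linarith
    have h2 : 0 ≤ ‖s‖ * (n : ℝ) ^ (-s.re - 1) := by positivity
    nlinarith

/-- `∑ (n + 1) ^ (-9/8)`, the constant in the truncation bounds for `ζ` near `Re s = 1`. -/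
noncomputable def zetaConst : ℝ := ∑' n : ℕ, ((n : ℝ) + 1) ^ (-(9 / 8) : ℝ)

theorem summable_zetaConst : Summable fun n : ℕ => ((n : ℝ) + 1) ^ (-(9 / 8) : ℝ) := by
  have := (summable_nat_add_iff 1).2 (Real.summable_nat_rpow.2 (by norm_num : (-(9/8) : ℝ) < -1))
  simpa using this

theorem zetaConst_nonneg : 0 ≤ zetaConst := tsum_nonneg fun n => by positivity

theorem norm_zetaTerm_add_le {X : ℕ} (hX : 0 < X) (j : ℕ) {s : ℂ} (hs : 7 / 8 ≤ s.re)
    (hs1 : s ≠ 1) :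
    ‖zetaTerm (X + j) s‖ ≤ ‖s‖ * (X : ℝ) ^ (-(3 / 4) : ℝ) * ((j : ℝ) + 1) ^ (-(9 / 8) : ℝ) := by
  refine (norm_zetaTerm_le (by omega) (by linarith) hs1).trans ?_
  rw [mul_assoc]
  refine mul_le_mul_of_nonneg_left ?_ (norm_nonneg _)
  have hX1 : (1 : ℝ) ≤ X := by exact_mod_cast hX
  have hj : (0 : ℝ) ≤ j := Nat.cast_nonneg j
  push_cast
  calc ((X : ℝ) + j) ^ (-s.re - 1) ≤ ((X : ℝ) + j) ^ (-(3 / 4) + -(9 / 8) : ℝ) :=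
        Real.rpow_le_rpow_of_exponent_le (by linarith) (by linarith)
    _ = ((X : ℝ) + j) ^ (-(3 / 4) : ℝ) * ((X : ℝ) + j) ^ (-(9 / 8) : ℝ) :=
        Real.rpow_add (by linarith) _ _
    _ ≤ _ := by
        gcongr ?_ * ?_
        · exact Real.rpow_le_rpow_of_nonpos (by linarith) (by linarith) (by norm_num)
        · exact Real.rpow_le_rpow_of_nonpos (by linarith) (by linarith) (by norm_num)

/-- The truncated Dirichlet series of `ζ` with its Euler–Maclaurin correction. It equals `ζ` for
`1 < Re s` and is analytic further to the left. -/
noncomputable def zetaTrunc (X : ℕ) (s : ℂ) : ℂ :=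
  ∑ n ∈ Finset.range X, ((n : ℂ) + 1) ^ (-s) + (X : ℂ) ^ (1 - s) / (s - 1) +
    ∑' j, zetaTerm (X + j) s

theorem summable_zetaTerm {X : ℕ} (hX : 0 < X) {s : ℂ} (hs : 7 / 8 ≤ s.re) (hs1 : s ≠ 1) :
    Summable fun j => zetaTerm (X + j) s :=
  Summable.of_norm_bounded (summable_zetaConst.mul_left _) fun j => norm_zetaTerm_add_le hX j hs hs1

open Filter Topology in
theorem riemannZeta_eq_zetaTrunc {X : ℕ} (hX : 0 < X) {s : ℂ} (hs : 1 < s.re) :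
    riemannZeta s = zetaTrunc X s := by
  have hs1 : s ≠ 1 := by rintro rfl; simp at hs
  have hsum : Summable fun n : ℕ => ((n : ℂ) + 1) ^ (-s) := by
    have := (summable_nat_add_iff 1).2 (Complex.summable_one_div_nat_cpow.2 hs)
    refine this.congr fun n => ?_
    rw [Complex.cpow_neg]; simp
  have hz : riemannZeta s = ∑' n : ℕ, ((n : ℂ) + 1) ^ (-s) := by
    rw [zeta_eq_tsum_one_div_nat_add_one_cpow hs]
    refine tsum_congr fun n => ?_
    rw [Complex.cpow_neg]; simp
  have hpart : ∀ J : ℕ, ∑ j ∈ Finset.range J, zetaTerm (X + j) s =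
      ∑ j ∈ Finset.range J, (((j + X : ℕ) : ℂ) + 1) ^ (-s) -
        ((X : ℂ) ^ (1 - s) - ((X + J : ℕ) : ℂ) ^ (1 - s)) / (s - 1) := by
    intro J
    induction J with
    | zero => simp
    | succ J ih =>
      rw [Finset.sum_range_succ, ih, Finset.sum_range_succ, zetaTerm]
      push_cast
      rw [add_comm (J : ℂ) X, ← add_assoc]
      ring
  have hlim0 : Tendsto (fun J : ℕ => ((X + J : ℕ) : ℂ) ^ (1 - s)) atTop (𝓝 0) := by
    rw [tendsto_zero_iff_norm_tendsto_zero]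
    have h1 : Tendsto (fun J : ℕ => ((X + J : ℕ) : ℝ) ^ (-(s.re - 1))) atTop (𝓝 0) :=
      (tendsto_rpow_neg_atTop (by linarith)).comp
        (tendsto_natCast_atTop_atTop.comp
          (tendsto_atTop_mono (fun J => Nat.le_add_left J X) tendsto_id))
    refine h1.congr fun J => ?_
    rw [Complex.norm_natCast_cpow_of_pos (by omega)]
    simp
  have h1 := (summable_zetaTerm hX (by linarith) hs1).hasSum.tendsto_sum_nat
  have h2 := ((summable_nat_add_iff X).2 hsum).hasSum.tendsto_sum_nat
  have h3 := h2.sub (((hlim0.const_sub ((X : ℂ) ^ (1 - s)))).div_const (s - 1))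
  have h4 := tendsto_nhds_unique h1 (h3.congr fun J => (hpart J).symm)
  rw [zetaTrunc, h4, hz, ← hsum.sum_add_tsum_nat_add X]
  ring

theorem differentiableOn_zetaTrunc {X : ℕ} (hX : 0 < X) {U : Set ℂ} (hU : IsOpen U) {B : ℝ}
    (h : ∀ s ∈ U, 7 / 8 ≤ s.re ∧ s ≠ 1 ∧ ‖s‖ ≤ B) : DifferentiableOn ℂ (zetaTrunc X) U := by
  have hd : ∀ (c : ℂ), c ≠ 0 → ∀ g : ℂ → ℂ, Differentiable ℂ g →
      Differentiable ℂ fun s => c ^ g s := fun c hc g hg => by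
    intro s; exact (hg s).const_cpow (Or.inl hc)
  have hX0 : (X : ℂ) ≠ 0 := by exact_mod_cast hX.ne'
  have hn1 : ∀ n : ℕ, (n : ℂ) + 1 ≠ 0 := fun n => by exact_mod_cast Nat.succ_ne_zero n
  refine ((DifferentiableOn.fun_sum fun n _ => ?_).add ?_).add ?_
  · exact (hd _ (hn1 n) _ (by fun_prop)).differentiableOn
  · exact (hd _ hX0 _ (by fun_prop)).differentiableOn.div (by fun_prop)
      fun s hs => sub_ne_zero.2 (h s hs).2.1
  · refine Complex.differentiableOn_tsum_of_summable_norm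
      (u := fun j : ℕ => B * (X : ℝ) ^ (-(3 / 4) : ℝ) * ((j : ℝ) + 1) ^ (-(9 / 8) : ℝ))
      (summable_zetaConst.mul_left _) (fun j => ?_) hU fun j s hs => ?_
    · have hXj : ((X + j : ℕ) : ℂ) ≠ 0 := by exact_mod_cast (by omega : X + j ≠ 0)
      unfold zetaTerm
      refine ((hd _ (hn1 _) _ (by fun_prop)).differentiableOn).sub
        (((hd _ hXj _ (by fun_prop)).differentiableOn.sub
          (hd _ (hn1 _) _ (by fun_prop)).differentiableOn).div (by fun_prop)
            fun s hs => sub_ne_zero.2 (h s hs).2.1)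
    · refine (norm_zetaTerm_add_le hX j (h s hs).1 (h s hs).2.1).trans ?_
      gcongr
      exact (h s hs).2.2

/-- With the truncation point `X` of the order of `|s|`, the truncated series gives
`ζ(s) = O(|s| ^ (1/4))` for `7/8 ≤ Re s`, away from the pole. -/
theorem norm_zetaTrunc_le {X : ℕ} (hX : 0 < X) {s : ℂ} (hs : 7 / 8 ≤ s.re) (hs' : 1 ≤ ‖s - 1‖)
    (hsX : ‖s‖ ≤ 5 * X) : ‖zetaTrunc X s‖ ≤ (6 * zetaConst + 1) * (X : ℝ) ^ (1 / 4 : ℝ) := by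
  have hs1 : s ≠ 1 := by rintro rfl; norm_num at hs'
  have hX1 : (1 : ℝ) ≤ X := by exact_mod_cast hX
  have h1 : ‖∑ n ∈ Finset.range X, ((n : ℂ) + 1) ^ (-s)‖ ≤ (X : ℝ) ^ (1 / 4 : ℝ) * zetaConst := by
    refine (norm_sum_le _ _).trans ?_
    rw [zetaConst, ← tsum_mul_left]
    refine le_trans (Finset.sum_le_sum fun n hn => ?_)
      ((summable_zetaConst.mul_left _).sum_le_tsum (Finset.range X) fun n _ => by positivity)
    have hn' : (n : ℝ) + 1 ≤ X := by exact_mod_cast Finset.mem_range.1 hn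
    have e : ((n : ℂ) + 1) = (((n : ℝ) + 1 : ℝ) : ℂ) := by push_cast; ring
    rw [e, Complex.norm_cpow_eq_rpow_re_of_pos (by positivity)]
    have hn0 : (1 : ℝ) ≤ (n : ℝ) + 1 := by linarith [(Nat.cast_nonneg n : (0 : ℝ) ≤ n)]
    calc ((n : ℝ) + 1) ^ (-s).re ≤ ((n : ℝ) + 1) ^ (1 / 4 + -(9 / 8) : ℝ) :=
          Real.rpow_le_rpow_of_exponent_le hn0 (by simp; linarith)
      _ = ((n : ℝ) + 1) ^ (1 / 4 : ℝ) * ((n : ℝ) + 1) ^ (-(9 / 8) : ℝ) :=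
          Real.rpow_add (by linarith) _ _
      _ ≤ _ := by gcongr
  have h2 : ‖(X : ℂ) ^ (1 - s) / (s - 1)‖ ≤ (X : ℝ) ^ (1 / 4 : ℝ) := by
    rw [norm_div, Complex.norm_natCast_cpow_of_pos hX]
    refine (div_le_self (by positivity) hs').trans ?_
    exact Real.rpow_le_rpow_of_exponent_le hX1 (by simp; linarith)
  have h3 : ‖∑' j, zetaTerm (X + j) s‖ ≤ 5 * (X : ℝ) ^ (1 / 4 : ℝ) * zetaConst := by
    refine tsum_of_norm_bounded
      (summable_zetaConst.hasSum.mul_left (5 * (X : ℝ) ^ (1 / 4 : ℝ))) fun j => ?_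
    refine (norm_zetaTerm_add_le hX j hs hs1).trans ?_
    refine mul_le_mul_of_nonneg_right ?_ (by positivity)
    calc ‖s‖ * (X : ℝ) ^ (-(3 / 4) : ℝ) ≤ 5 * X * (X : ℝ) ^ (-(3 / 4) : ℝ) := by gcongr
      _ = 5 * ((X : ℝ) ^ (1 : ℝ) * (X : ℝ) ^ (-(3 / 4) : ℝ)) := by rw [Real.rpow_one]; ring
      _ = 5 * (X : ℝ) ^ (1 / 4 : ℝ) := by rw [← Real.rpow_add (by linarith)]; norm_num
  unfold zetaTrunc
  calc _ ≤ _ := norm_add₃_le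
    _ ≤ _ := by linarith

/-- Polynomial bounds for `ζ` and `ζ'` to the right of the line `Re s = 1`. -/
theorem exists_norm_zeta_le : ∃ C : ℝ, 0 < C ∧ ∀ δ t : ℝ, 0 < δ → δ ≤ 1 → 2 ≤ |t| →
    ‖riemannZeta (1 + δ + t * Complex.I)‖ ≤ C * |t| ^ (1 / 4 : ℝ) ∧
    ‖deriv riemannZeta (1 + δ + t * Complex.I)‖ ≤ C * |t| ^ (1 / 4 : ℝ) := by
  have hZ := zetaConst_nonneg
  refine ⟨16 * ((6 * zetaConst + 1) * 2), by positivity, fun δ t hδ hδ1 ht => ?_⟩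
  set s₀ : ℂ := 1 + δ + t * Complex.I with hs₀
  have hre : s₀.re = 1 + δ := by simp [hs₀]
  have him : s₀.im = t := by simp [hs₀]
  set X : ℕ := ⌈|t|⌉₊ with hX
  have hXt : |t| ≤ X := Nat.le_ceil _
  have hXt2 : (X : ℝ) ≤ 2 * |t| := by
    have := Nat.ceil_lt_add_one (abs_nonneg t); rw [← hX] at this; linarith
  have hX0 : 0 < X := by
    have : (0 : ℝ) < X := by linarith
    exact_mod_cast this
  -- everything is controlled on the disc of radius `1/8`, which stays away from the pole
  have hdisc : ∀ s : ℂ, ‖s - s₀‖ ≤ 1 / 8 → 7 / 8 ≤ s.re ∧ 1 ≤ ‖s - 1‖ ∧ ‖s‖ ≤ 5 * X := by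
    intro s hs
    have h1 := (abs_le.1 ((Complex.abs_re_le_norm _).trans hs))
    have h2 := (abs_le.1 ((Complex.abs_im_le_norm _).trans hs))
    rw [Complex.sub_re, hre] at h1
    rw [Complex.sub_im, him] at h2
    refine ⟨by linarith [h1.1], ?_, ?_⟩
    · refine le_trans ?_ (Complex.abs_im_le_norm _)
      rw [Complex.sub_im, Complex.one_im, sub_zero]
      rcases abs_cases t with h | h <;> rcases abs_cases s.im with h' | h' <;> linarith [h2.1, h2.2]
    · refine (Complex.norm_le_abs_re_add_abs_im s).trans ?_
      have : |s.re| ≤ 3 := abs_le.2 ⟨by linarith [h1.1], by linarith [h1.2]⟩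
      have : |s.im| ≤ |t| + 1 / 8 := by
        rcases abs_cases t with h | h <;> rcases abs_cases s.im with h' | h' <;>
          linarith [h2.1, h2.2]
      linarith
  have hne : ∀ s : ℂ, 1 ≤ ‖s - 1‖ → s ≠ 1 := by rintro s h rfl; norm_num at h
  have hXr : (X : ℝ) ^ (1 / 4 : ℝ) ≤ 2 * |t| ^ (1 / 4 : ℝ) := by
    calc (X : ℝ) ^ (1 / 4 : ℝ) ≤ (2 * |t|) ^ (1 / 4 : ℝ) := by gcongr
      _ = 2 ^ (1 / 4 : ℝ) * |t| ^ (1 / 4 : ℝ) := Real.mul_rpow (by norm_num) (abs_nonneg t)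
      _ ≤ 2 ^ (1 : ℝ) * |t| ^ (1 / 4 : ℝ) := by
        gcongr
        · norm_num
        · norm_num
      _ = _ := by rw [Real.rpow_one]
  have hbd : ∀ s : ℂ, ‖s - s₀‖ ≤ 1 / 8 →
      ‖zetaTrunc X s‖ ≤ (6 * zetaConst + 1) * 2 * |t| ^ (1 / 4 : ℝ) := by
    intro s hs
    obtain ⟨h1, h2, h3⟩ := hdisc s hs
    refine (norm_zetaTrunc_le hX0 h1 h2 h3).trans ?_
    rw [mul_assoc]
    gcongr
  have hpos : 0 ≤ (6 * zetaConst + 1) * 2 * |t| ^ (1 / 4 : ℝ) := by positivity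
  have hs₀1 : 1 < s₀.re := by rw [hre]; linarith
  constructor
  · rw [riemannZeta_eq_zetaTrunc hX0 hs₀1]
    have := hbd s₀ (by simp)
    nlinarith
  · have heq : riemannZeta =ᶠ[nhds s₀] zetaTrunc X := by
      have : {s : ℂ | 1 < s.re} ∈ nhds s₀ :=
        (isOpen_lt continuous_const Complex.continuous_re).mem_nhds hs₀1
      filter_upwards [this] with s hs using riemannZeta_eq_zetaTrunc hX0 hs
    rw [heq.deriv_eq]
    have hd : DifferentiableOn ℂ (zetaTrunc X) (Metric.ball s₀ (1 / 8)) :=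
      differentiableOn_zetaTrunc hX0 Metric.isOpen_ball (B := 5 * X) fun s hs => by
        have := hdisc s (by simpa [dist_eq_norm] using (Metric.mem_ball.1 hs).le)
        exact ⟨this.1, hne s this.2.1, this.2.2⟩
    have := Complex.norm_deriv_le_of_forall_mem_sphere_norm_le (c := s₀) (R := 1 / 16)
      (C := (6 * zetaConst + 1) * 2 * |t| ^ (1 / 4 : ℝ)) (f := zetaTrunc X) (by norm_num)
      ((hd.mono (Metric.closedBall_subset_ball (by norm_num))).diffContOnCl_ball subset_rfl)
      (fun z hz => hbd z (by
        rw [← dist_eq_norm, Metric.mem_sphere.1 hz]; norm_num))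
    refine this.trans (le_of_eq ?_)
    ring

end SmallGaps

/-! ### A lower bound for the zeta function near the line `Re s = 1` -/

namespace SmallGaps

theorem one_le_norm_zeta_product {x : ℝ} (hx : 0 < x) (y : ℝ) :
    1 ≤ ‖riemannZeta (1 + x)‖ ^ 3 * ‖riemannZeta (1 + x + y * Complex.I)‖ ^ 4 *
      ‖riemannZeta (1 + x + (2 * y : ℝ) * Complex.I)‖ := by
  have h := DirichletCharacter.norm_LFunction_product_ge_one (1 : DirichletCharacter ℂ 1) hx y
  simp only [DirichletCharacter.LFunctionTrivChar, DirichletCharacter.LFunction_modOne_eq,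
    norm_mul, norm_pow] at h
  have e1 : (1 : ℂ) + x + Complex.I * y = 1 + x + y * Complex.I := by ring
  have e2 : (1 : ℂ) + x + 2 * Complex.I * y = 1 + x + (2 * y : ℝ) * Complex.I := by
    push_cast; ring
  rw [e1, e2] at h
  exact h

/-- Near the pole, `ζ(1 + s)` is replaced by the entire function `s ζ(1 + s)`, which is `1` at `0`
and has no zeros with `0 ≤ Re s`. -/
theorem exists_norm_riemannZeta₁_le (B : ℝ) :
    ∃ C : ℝ, 0 < C ∧ ∀ s : ℂ, ‖s‖ ≤ B → ‖riemannZeta₁ (1 + s)‖ ≤ C ∧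
      (‖riemannZeta₁ (1 + s) - 1‖ ≤ C * ‖s‖) ∧ (0 ≤ s.re → ‖(riemannZeta₁ (1 + s))⁻¹‖ ≤ C) := by
  have hK := isCompact_closedBall (0 : ℂ) B
  have hd : Differentiable ℂ fun s : ℂ => riemannZeta₁ (1 + s) := by fun_prop
  obtain ⟨C1, h1⟩ := hK.exists_bound_of_continuousOn (f := fun s : ℂ => riemannZeta₁ (1 + s))
    hd.continuous.continuousOn
  obtain ⟨C2, h2⟩ := hK.exists_bound_of_continuousOn
    (f := deriv fun s : ℂ => riemannZeta₁ (1 + s)) (by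
      exact ((hd.contDiff (n := 1)).continuous_deriv le_rfl).continuousOn)
  have hne : ∀ s : ℂ, 0 ≤ s.re → riemannZeta₁ (1 + s) ≠ 0 := by
    intro s hs h0
    rcases eq_or_ne s 0 with rfl | hs0
    · simp at h0
    · have := riemannZeta_ne_zero_of_one_le_re (s := 1 + s) (by simp [hs])
      rw [riemannZeta_eq_inv_sub_mul (by simpa using hs0), h0] at this
      simp at this
  have hK' : IsCompact (Metric.closedBall (0 : ℂ) B ∩ {s : ℂ | 0 ≤ s.re}) :=
    hK.inter_right (isClosed_le continuous_const Complex.continuous_re)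
  obtain ⟨C3, h3⟩ := hK'.exists_bound_of_continuousOn
    (f := fun s : ℂ => (riemannZeta₁ (1 + s))⁻¹)
    (hd.continuous.continuousOn.inv₀ fun s hs => hne s hs.2)
  refine ⟨|C1| + |C2| + |C3| + 1, by positivity, fun s hs => ⟨?_, ?_, fun hre => ?_⟩⟩
  · have := h1 s (by simpa using hs)
    linarith [le_abs_self C1, abs_nonneg C2, abs_nonneg C3]
  · have := (convex_closedBall (0 : ℂ) B).norm_image_sub_le_of_norm_deriv_le
      (f := fun s : ℂ => riemannZeta₁ (1 + s)) (C := C2) (fun x _ => hd x) h2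
      (x := 0) (y := s) (by simpa using (norm_nonneg s).trans hs) (by simpa using hs)
    simp only [add_zero, riemannZeta₁_one, sub_zero] at this
    refine this.trans ?_
    gcongr
    linarith [le_abs_self C2, abs_nonneg C1, abs_nonneg C3]
  · have := h3 s ⟨by simpa using hs, hre⟩
    linarith [le_abs_self C3, abs_nonneg C2, abs_nonneg C1]

/-- A lower bound for `ζ` next to the line `Re s = 1`, from the `3-4-1` inequality and the growth
of `ζ'`. -/
theorem exists_le_norm_zeta : ∃ c : ℝ, 0 < c ∧ ∀ σ t : ℝ, 0 < σ → σ ≤ 1 → 2 ≤ |t| →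
    c / |t| ≤ ‖riemannZeta (1 + σ + t * Complex.I)‖ := by
  obtain ⟨C, hC, hζ⟩ := exists_norm_zeta_le
  obtain ⟨D, hD, hD'⟩ := exists_norm_riemannZeta₁_le 1
  -- the `3-4-1` inequality at distance `δ` from the line, with `ζ(1 + δ + 2it)` bounded above
  have h341 : ∀ δ t : ℝ, 0 < δ → δ ≤ 1 → 2 ≤ |t| →
      δ ^ 3 ≤ D ^ 3 * (2 * C) *
        (‖riemannZeta (1 + δ + t * Complex.I)‖ ^ 4 * |t| ^ (1 / 4 : ℝ)) := by
    intro δ t hδ hδ1 ht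
    have h1 := one_le_norm_zeta_product hδ t
    have h2 : ‖riemannZeta (1 + δ)‖ ≤ D / δ := by
      have hδ0 : (δ : ℂ) ≠ 0 := by exact_mod_cast hδ.ne'
      rw [riemannZeta_eq_inv_sub_mul (by simpa using hδ0), norm_mul, div_eq_inv_mul]
      have := (hD' δ (by simpa [abs_of_pos hδ] using hδ1)).1
      simp only [add_sub_cancel_left, norm_inv, Complex.norm_real, Real.norm_eq_abs, abs_of_pos hδ]
      gcongr
    have h3 := (hζ δ (2 * t) hδ hδ1 (by rw [abs_mul]; norm_num; linarith)).1
    have h4 : |2 * t| ^ (1 / 4 : ℝ) ≤ 2 * |t| ^ (1 / 4 : ℝ) := by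
      rw [abs_mul, Real.mul_rpow (by norm_num) (abs_nonneg t), abs_two]
      gcongr
      calc (2 : ℝ) ^ (1 / 4 : ℝ) ≤ 2 ^ (1 : ℝ) :=
            Real.rpow_le_rpow_of_exponent_le (by norm_num) (by norm_num)
        _ = 2 := Real.rpow_one 2
    have h5 : 1 ≤ (D / δ) ^ 3 * ‖riemannZeta (1 + δ + t * Complex.I)‖ ^ 4 *
        (C * (2 * |t| ^ (1 / 4 : ℝ))) := by
      refine h1.trans ?_
      gcongr
      exact h3.trans (by gcongr)
    have h6 := mul_le_mul_of_nonneg_left h5 (pow_pos hδ 3).le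
    rw [mul_one] at h6
    refine h6.trans (le_of_eq ?_)
    field_simp
  -- lower bound at distance `δ = η ^ 4 |t| ^ (-5/4)`, then go left with the bound for `ζ'`
  obtain ⟨b, hb, hb4⟩ : ∃ b : ℝ, 0 < b ∧ b ^ 4 * (D ^ 3 * (2 * C)) = 1 := by
    refine ⟨((D ^ 3 * (2 * C))⁻¹) ^ (1 / 4 : ℝ), by positivity, ?_⟩
    rw [← Real.rpow_natCast, ← Real.rpow_mul (by positivity)]
    norm_num
    field_simp
  set η : ℝ := min 1 (b / (2 * C)) with hη
  have hη0 : 0 < η := lt_min one_pos (by positivity)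
  have hη1 : η ≤ 1 := min_le_left _ _
  have hηC : C * η ≤ b / 2 := by
    have := min_le_right 1 (b / (2 * C))
    rw [← hη, le_div_iff₀ (by positivity)] at this
    linarith
  have hfar : ∀ δ t : ℝ, 0 < δ → δ ≤ 1 → 2 ≤ |t| → η ^ 4 * |t| ^ (-(5 / 4) : ℝ) ≤ δ →
      b * η ^ 3 / |t| ≤ ‖riemannZeta (1 + δ + t * Complex.I)‖ := by
    intro δ t hδ hδ1 ht hle
    have ht0 : 0 < |t| := by linarith
    refine le_of_pow_le_pow_left₀ (n := 4) (by norm_num) (norm_nonneg _) ?_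
    have h := h341 δ t hδ hδ1 ht
    have h1 : (η ^ 4 * |t| ^ (-(5 / 4) : ℝ)) ^ 3 ≤ δ ^ 3 := by gcongr
    have h2 : (η ^ 4 * |t| ^ (-(5 / 4) : ℝ)) ^ 3 =
        η ^ 12 * (|t| ^ (-(4 : ℝ)) * |t| ^ (1 / 4 : ℝ)) := by
      rw [mul_pow, ← Real.rpow_natCast (|t| ^ _), ← Real.rpow_mul ht0.le, ← Real.rpow_add ht0,
        ← pow_mul]
      norm_num
    have h3 : |t| ^ (-(4 : ℝ)) = (|t| ^ 4)⁻¹ := by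
      rw [Real.rpow_neg ht0.le]; norm_cast
    have h4 : 0 < |t| ^ (1 / 4 : ℝ) := by positivity
    rw [h2, h3] at h1
    have h5 : η ^ 12 * (|t| ^ 4)⁻¹ ≤
        D ^ 3 * (2 * C) * ‖riemannZeta (1 + δ + t * Complex.I)‖ ^ 4 := by
      refine le_of_mul_le_mul_right ?_ h4
      linarith
    calc (b * η ^ 3 / |t|) ^ 4 = b ^ 4 * (η ^ 12 * (|t| ^ 4)⁻¹) := by field_simp
      _ ≤ b ^ 4 * (D ^ 3 * (2 * C) * ‖riemannZeta (1 + δ + t * Complex.I)‖ ^ 4) := by gcongr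
      _ = (b ^ 4 * (D ^ 3 * (2 * C))) * ‖riemannZeta (1 + δ + t * Complex.I)‖ ^ 4 := by ring
      _ = _ := by rw [hb4, one_mul]
  refine ⟨b * η ^ 3 / 2, by positivity, fun σ t hσ hσ1 ht => ?_⟩
  have ht0 : 0 < |t| := by linarith
  set δ := η ^ 4 * |t| ^ (-(5 / 4) : ℝ) with hδ
  have hδ0 : 0 < δ := by positivity
  rcases le_or_gt δ σ with h | h
  · refine le_trans ?_ (hfar σ t hσ hσ1 ht h)
    gcongr
    have : 0 < b * η ^ 3 := by positivity
    linarith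
  · have hδ1 : δ ≤ 1 := by
      have h1 : |t| ^ (-(5 / 4) : ℝ) ≤ 1 :=
        Real.rpow_le_one_of_one_le_of_nonpos (by linarith) (by norm_num)
      have h2 : η ^ 4 ≤ 1 := pow_le_one₀ hη0.le hη1
      exact mul_le_one₀ h2 (by positivity) h1
    have h1 := hfar δ t hδ0 hδ1 ht le_rfl
    have h2 : ‖riemannZeta (1 + δ + t * Complex.I) - riemannZeta (1 + σ + t * Complex.I)‖ ≤
        C * |t| ^ (1 / 4 : ℝ) * (δ - σ) := by
      refine norm_image_sub_le_of_norm_deriv_le_segment'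
        (f := fun x : ℝ => riemannZeta (1 + x + t * Complex.I))
        (f' := fun x : ℝ => deriv riemannZeta (1 + x + t * Complex.I)) (a := σ) (b := δ)
        (fun x hx => ?_) (fun x hx => ?_) δ ⟨h.le, le_rfl⟩
      · have hne : (1 : ℂ) + x + t * Complex.I ≠ 1 := by
          intro h
          have := congrArg Complex.im h
          simp at this
          rw [this] at ht0
          simp at ht0
        have hd := (differentiableAt_riemannZeta hne).hasDerivAt
        have hin : HasDerivAt (fun x : ℝ => (1 : ℂ) + x + t * Complex.I) 1 x := by
          simpa using ((Complex.ofRealCLM.hasDerivAt (x := x)).const_add 1).add_const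
            (t * Complex.I)
        have := (hd.comp x hin).hasDerivWithinAt (s := Set.Icc σ δ)
        rw [mul_one] at this
        exact this
      · exact (hζ x t (by linarith [hx.1]) (by linarith [hx.2]) ht).2
    have h3 : C * |t| ^ (1 / 4 : ℝ) * (δ - σ) ≤ b * η ^ 3 / 2 / |t| := by
      calc C * |t| ^ (1 / 4 : ℝ) * (δ - σ) ≤ C * |t| ^ (1 / 4 : ℝ) * δ := by gcongr; linarith
        _ = C * η * η ^ 3 * (|t| ^ (1 / 4 : ℝ) * |t| ^ (-(5 / 4) : ℝ)) := by rw [hδ]; ring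
        _ = C * η * η ^ 3 * |t|⁻¹ := by
          rw [← Real.rpow_add ht0, ← Real.rpow_neg_one]; norm_num
        _ ≤ b / 2 * η ^ 3 * |t|⁻¹ := by gcongr
        _ = _ := by ring
    have h4 := norm_sub_norm_le (riemannZeta (1 + δ + t * Complex.I))
      (riemannZeta (1 + σ + t * Complex.I))
    have h5 : b * η ^ 3 / |t| = 2 * (b * η ^ 3 / 2 / |t|) := by ring
    linarith

/-- The function `1 / (s ζ(1 + s))`, which measures how far `1 / ζ(1 + s)` is from `s`. -/
noncomputable def zetaQuot (s : ℂ) : ℂ := (s * riemannZeta (1 + s))⁻¹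

/-- The quotient `1 / (s ζ(1 + s))` is bounded in the strip `0 < Re s ≤ 1` and tends to `1` at
`s = 0`. For large `|s|` the lower bound `|ζ(1 + s)| ≫ 1 / |s|` is exactly what is needed. -/
theorem exists_norm_zetaQuot_le : ∃ C : ℝ, 1 ≤ C ∧ ∀ s : ℂ, 0 < s.re → s.re ≤ 1 →
    ‖zetaQuot s‖ ≤ C ∧ ‖zetaQuot s - 1‖ ≤ C * ‖s‖ := by
  obtain ⟨c, hc, hlow⟩ := exists_le_norm_zeta
  obtain ⟨D, hD, hD'⟩ := exists_norm_riemannZeta₁_le 3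
  have hs0 : ∀ s : ℂ, 0 < s.re → s ≠ 0 := by rintro s h rfl; simp at h
  have heq : ∀ s : ℂ, 0 < s.re → zetaQuot s = (riemannZeta₁ (1 + s))⁻¹ := by
    intro s hs
    rw [zetaQuot, riemannZeta_eq_inv_sub_mul (by simpa using hs0 s hs), add_sub_cancel_left,
      mul_inv_cancel_left₀ (hs0 s hs)]
  have hne : ∀ s : ℂ, 0 < s.re → riemannZeta₁ (1 + s) ≠ 0 := by
    intro s hs h0
    have := riemannZeta_ne_zero_of_one_le_re (s := 1 + s) (by simp [hs.le])
    rw [riemannZeta_eq_inv_sub_mul (by simpa using hs0 s hs), h0] at this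
    simp at this
  refine ⟨c⁻¹ + D + D * D + 1, by have : 0 < c⁻¹ := by positivity
                                  nlinarith, fun s hs hs1 => ?_⟩
  have hci : 0 < c⁻¹ := by positivity
  by_cases h3 : ‖s‖ ≤ 3
  · have hb := (hD' s h3).2.2 hs.le
    have hb2 := (hD' s h3).2.1
    rw [heq s hs]
    refine ⟨by nlinarith, ?_⟩
    have : (riemannZeta₁ (1 + s))⁻¹ - 1 =
        -((riemannZeta₁ (1 + s) - 1) * (riemannZeta₁ (1 + s))⁻¹) := by
      have := hne s hs
      field_simp
      ring
    rw [this, norm_neg, norm_mul]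
    calc _ ≤ (D * ‖s‖) * D := by gcongr
      _ = (D * D) * ‖s‖ := by ring
      _ ≤ _ := by
        gcongr
        nlinarith
  · have hns := not_le.1 h3
    have him : 2 ≤ |s.im| := by
      have := Complex.norm_le_abs_re_add_abs_im s
      rw [abs_of_pos hs] at this
      linarith
    have hl := hlow s.re s.im hs hs1 him
    have e : (1 : ℂ) + s.re + s.im * Complex.I = 1 + s := by
      rw [add_assoc, Complex.re_add_im]
    rw [e] at hl
    have hims := Complex.abs_im_le_norm s
    have him0 : 0 < |s.im| := by linarith
    have h1 : ‖zetaQuot s‖ ≤ c⁻¹ := by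
      rw [zetaQuot, norm_inv, norm_mul]
      apply inv_anti₀ hc
      calc c = |s.im| * (c / |s.im|) := by field_simp
        _ ≤ _ := by gcongr
    refine ⟨by nlinarith, ?_⟩
    have := norm_sub_le (zetaQuot s) 1
    rw [norm_one] at this
    nlinarith [mul_pos hD hD]

end SmallGaps

/-! ### Perron's formula for truncated powers -/

namespace SmallGaps

/-- The truncated power `u ^ a / a!` for `0 ≤ u`, extended by `0` to negative `u`. -/
noncomputable def truncPow (a : ℕ) (u : ℝ) : ℝ :=
  if 0 ≤ u then u ^ a / (a.factorial : ℝ) else 0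

theorem truncPow_of_nonneg (a : ℕ) {u : ℝ} (hu : 0 ≤ u) :
    truncPow a u = u ^ a / (a.factorial : ℝ) := if_pos hu

theorem truncPow_of_neg (a : ℕ) {u : ℝ} (hu : u < 0) : truncPow a u = 0 := if_neg (not_le.2 hu)

theorem truncPow_eq_max {a : ℕ} (ha : 0 < a) (u : ℝ) :
    truncPow a u = max u 0 ^ a / (a.factorial : ℝ) := by
  rcases le_or_gt 0 u with h | h
  · rw [truncPow_of_nonneg a h, max_eq_left h]
  · rw [truncPow_of_neg a h, max_eq_right h.le, zero_pow ha.ne', zero_div]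

theorem continuous_truncPow {a : ℕ} (ha : 0 < a) : Continuous (truncPow a) := by
  have : truncPow a = fun u => max u 0 ^ a / (a.factorial : ℝ) := funext (truncPow_eq_max ha)
  rw [this]
  fun_prop

/-- The point `σ + 2πiw` of the vertical line `Re s = σ`. -/
noncomputable def vline (σ w : ℝ) : ℂ := σ + (2 * Real.pi * w : ℝ) * Complex.I

@[simp] theorem vline_re (σ w : ℝ) : (vline σ w).re = σ := by simp [vline]

@[simp] theorem vline_im (σ w : ℝ) : (vline σ w).im = 2 * Real.pi * w := by simp [vline]

theorem vline_ne_zero {σ : ℝ} (hσ : 0 < σ) (w : ℝ) : vline σ w ≠ 0 := by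
  intro h
  have := congrArg Complex.re h
  simp at this
  linarith

theorem continuous_vline (σ : ℝ) : Continuous (vline σ) := by unfold vline; fun_prop

open MeasureTheory Set Filter Topology

theorem integrableOn_pow_mul_exp_neg (a : ℕ) {σ : ℝ} (hσ : 0 < σ) :
    IntegrableOn (fun u : ℝ => u ^ a * Real.exp (-σ * u)) (Ioi 0) := by
  have := integrableOn_rpow_mul_exp_neg_mul_rpow (p := 1) (s := a) (b := σ)
    (by linarith [(Nat.cast_nonneg a : (0 : ℝ) ≤ a)]) one_pos hσ
  simpa using this

theorem integrableOn_pow_mul_cexp_neg (a : ℕ) {s : ℂ} (hs : 0 < s.re) :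
    IntegrableOn (fun u : ℝ => (u : ℂ) ^ a * Complex.exp (-s * u)) (Ioi 0) := by
  refine (integrableOn_pow_mul_exp_neg a hs).mono' ?_ ?_
  · exact (by fun_prop : Continuous fun u : ℝ => (u : ℂ) ^ a * Complex.exp (-s * u))
      |>.aestronglyMeasurable
  · filter_upwards [ae_restrict_mem measurableSet_Ioi] with u hu
    rw [norm_mul, norm_pow, Complex.norm_exp, Complex.norm_real, Real.norm_eq_abs,
      abs_of_pos (mem_Ioi.1 hu)]
    simp

/-- The Laplace transform of `u ^ a / a!`. -/
theorem integral_pow_mul_cexp_neg (a : ℕ) {s : ℂ} (hs : 0 < s.re) :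
    ∫ u in Ioi (0 : ℝ), (u : ℂ) ^ a * Complex.exp (-s * u) = a.factorial / s ^ (a + 1) := by
  have hs0 : s ≠ 0 := by rintro rfl; simp at hs
  have hlim : ∀ b : ℕ, Tendsto (fun u : ℝ => (u : ℂ) ^ b * Complex.exp (-s * u)) atTop (𝓝 0) := by
    intro b
    rw [tendsto_zero_iff_norm_tendsto_zero]
    have h := Real.tendsto_pow_mul_exp_neg_atTop_nhds_zero b
    have h2 := (h.comp (tendsto_id.const_mul_atTop hs)).div_const (s.re ^ b)
    rw [zero_div] at h2
    refine h2.congr' ?_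
    filter_upwards [eventually_gt_atTop 0] with u hu
    rw [norm_mul, norm_pow, Complex.norm_exp, Complex.norm_real, Real.norm_eq_abs, abs_of_pos hu]
    simp only [Function.comp, id, mul_pow]
    have : s.re ^ b ≠ 0 := (pow_pos hs b).ne'
    field_simp
    simp
  have hexp : ∀ u : ℝ, HasDerivAt (fun u : ℝ => Complex.exp (-s * u))
      (-s * Complex.exp (-s * u)) u := by
    intro u
    have h1 : HasDerivAt (fun u : ℝ => -s * (u : ℂ)) (-s) u := by
      simpa using (Complex.ofRealCLM.hasDerivAt (x := u)).const_mul (-s)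
    simpa [mul_comm] using h1.cexp
  induction a with
  | zero =>
    have h := integral_Ioi_of_hasDerivAt_of_tendsto' (a := (0 : ℝ)) (m := 0)
      (f := fun u : ℝ => Complex.exp (-s * u)) (f' := fun u : ℝ => -s * Complex.exp (-s * u))
      (fun u _ => hexp u) ?_ ?_
    · rw [integral_const_mul] at h
      simp only [Complex.ofReal_zero, mul_zero, Complex.exp_zero, zero_sub] at h
      simp only [pow_zero, one_mul, Nat.factorial_zero, Nat.cast_one, zero_add, pow_one]
      rw [eq_div_iff hs0]
      linear_combination -h
    · have := (integrableOn_pow_mul_cexp_neg 0 hs).const_mul (-s)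
      simp only [pow_zero, one_mul] at this
      exact this
    · simpa using hlim 0
  | succ a ih =>
    have hd : ∀ u : ℝ, HasDerivAt (fun u : ℝ => (u : ℂ) ^ (a + 1) * Complex.exp (-s * u))
        (((a : ℂ) + 1) * ((u : ℂ) ^ a * Complex.exp (-s * u)) +
          -s * ((u : ℂ) ^ (a + 1) * Complex.exp (-s * u))) u := by
      intro u
      have h1 : HasDerivAt (fun u : ℝ => (u : ℂ) ^ (a + 1)) (((a : ℂ) + 1) * (u : ℂ) ^ a) u := by
        have := (hasDerivAt_pow (a + 1) (u : ℂ)).comp_ofReal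
        simpa using this
      refine (h1.mul (hexp u)).congr_deriv ?_
      ring
    have h := integral_Ioi_of_hasDerivAt_of_tendsto' (a := (0 : ℝ)) (m := 0)
      (fun u _ => hd u) (((integrableOn_pow_mul_cexp_neg a hs).const_mul _).add
        ((integrableOn_pow_mul_cexp_neg (a + 1) hs).const_mul _)) (hlim (a + 1))
    rw [integral_add ((integrableOn_pow_mul_cexp_neg a hs).const_mul _)
        ((integrableOn_pow_mul_cexp_neg (a + 1) hs).const_mul _),
      integral_const_mul, integral_const_mul, ih] at h
    simp only [Complex.ofReal_zero, ne_eq, Nat.succ_ne_zero, not_false_eq_true, zero_pow, zero_mul,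
      sub_zero] at h
    rw [eq_div_iff (pow_ne_zero _ hs0), Nat.factorial_succ, pow_succ s (a + 1)]
    push_cast
    set T := ∫ u in Ioi (0 : ℝ), (u : ℂ) ^ (a + 1) * Complex.exp (-s * u) with hT
    have e : ((a : ℂ) + 1) * (a.factorial / s ^ (a + 1)) * s ^ (a + 1) =
        ((a : ℂ) + 1) * a.factorial := by
      field_simp
    linear_combination (-s ^ (a + 1)) * h + e

theorem norm_vline_ge (σ w : ℝ) : |w| ≤ ‖vline σ w‖ := by
  refine le_trans ?_ (Complex.abs_im_le_norm _)
  rw [vline_im, abs_mul]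
  have : (1 : ℝ) ≤ |2 * Real.pi| := by
    rw [abs_of_pos (by positivity)]; linarith [Real.pi_gt_three]
  nlinarith [abs_nonneg w]

theorem norm_vline_ge' {σ : ℝ} (hσ : 0 < σ) (w : ℝ) : σ ≤ ‖vline σ w‖ := by
  have := Complex.abs_re_le_norm (vline σ w)
  rwa [vline_re, abs_of_pos hσ] at this

theorem integrable_norm_vline_pow {σ : ℝ} (hσ : 0 < σ) {b : ℕ} (hb : 2 ≤ b) :
    Integrable fun w : ℝ => (‖vline σ w‖ ^ b)⁻¹ := by
  have hm : 0 < min σ 1 := lt_min hσ one_pos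
  refine (integrable_inv_one_add_sq.const_mul (2 * ((min σ 1) ^ b)⁻¹)).mono' ?_ ?_
  · refine Continuous.aestronglyMeasurable ?_
    have := continuous_vline σ
    exact (this.norm.pow b).inv₀ fun w => pow_ne_zero _ (norm_ne_zero_iff.2 (vline_ne_zero hσ w))
  · filter_upwards with w
    have hv : 0 < ‖vline σ w‖ := norm_pos_iff.2 (vline_ne_zero hσ w)
    rw [Real.norm_eq_abs, abs_of_pos (by positivity), mul_assoc, ← mul_inv, ← div_eq_mul_inv,
      inv_eq_one_div, div_le_div_iff₀ (by positivity) (by positivity)]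
    have h1 := norm_vline_ge σ w
    have h2 := norm_vline_ge' hσ w
    set v := ‖vline σ w‖
    have h3 : min σ 1 ≤ v := (min_le_left _ _).trans h2
    have h4 : min σ 1 ^ 2 * (1 + w ^ 2) ≤ 2 * v ^ 2 := by
      have e1 : min σ 1 ^ 2 ≤ v ^ 2 := by gcongr
      have e2 : min σ 1 ^ 2 ≤ 1 := pow_le_one₀ hm.le (min_le_right _ _)
      have e3 : w ^ 2 ≤ v ^ 2 := by rw [← sq_abs w]; gcongr
      nlinarith [sq_nonneg w, sq_nonneg (min σ 1)]
    obtain ⟨c, rfl⟩ := Nat.exists_eq_add_of_le hb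
    rw [pow_add, pow_add]
    have h5 : min σ 1 ^ c ≤ v ^ c := by gcongr
    calc 1 * (min σ 1 ^ 2 * min σ 1 ^ c * (1 + w ^ 2))
        = (min σ 1 ^ 2 * (1 + w ^ 2)) * min σ 1 ^ c := by ring
      _ ≤ (2 * v ^ 2) * v ^ c := by gcongr
      _ = _ := by ring

theorem integrable_cexp_div_vline_pow {σ : ℝ} (hσ : 0 < σ) {b : ℕ} (hb : 2 ≤ b) (u : ℝ) :
    Integrable fun w : ℝ => Complex.exp (vline σ w * u) / vline σ w ^ b := by
  refine ((integrable_norm_vline_pow hσ hb).const_mul (Real.exp (σ * u))).mono' ?_ ?_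
  · refine Continuous.aestronglyMeasurable ?_
    have := continuous_vline σ
    exact (by fun_prop : Continuous fun w => Complex.exp (vline σ w * u)).div (this.pow b)
      fun w => pow_ne_zero _ (vline_ne_zero hσ w)
  · filter_upwards with w
    rw [norm_div, norm_pow, Complex.norm_exp, div_eq_mul_inv]
    simp

/-- Perron's formula for the truncated power, by Fourier inversion. -/
theorem truncPow_eq_integral {a : ℕ} (ha : 0 < a) {σ : ℝ} (hσ : 0 < σ) (u : ℝ) :
    (truncPow a u : ℂ) = ∫ w : ℝ, Complex.exp (vline σ w * u) / vline σ w ^ (a + 1) := by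
  set f : ℝ → ℂ := fun v => (truncPow a v : ℂ) * Complex.exp (-σ * v) with hf
  have hfc : Continuous f := by
    have := continuous_truncPow ha
    fun_prop
  have hf0 : ∀ v ∉ Ioi (0 : ℝ), f v = 0 := by
    intro v hv
    have hv' : v ≤ 0 := not_lt.1 hv
    rw [hf]; simp only
    rw [truncPow_eq_max ha, max_eq_right hv', zero_pow ha.ne']
    simp
  have hfi : Integrable f := by
    rw [← integrableOn_iff_integrable_of_support_subset (s := Ioi (0 : ℝ))]
    · refine IntegrableOn.congr_fun (f := fun v : ℝ => (a.factorial : ℂ)⁻¹ *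
        ((v : ℂ) ^ a * Complex.exp (-σ * v)))
        ((integrableOn_pow_mul_cexp_neg a (s := σ) (by simpa)).const_mul _) (fun v hv => ?_)
        measurableSet_Ioi
      simp only [hf]
      rw [truncPow_of_nonneg a (le_of_lt hv)]
      push_cast
      ring
    · intro v hv
      by_contra h
      exact hv (hf0 v h)
  have hF : FourierTransform.fourier f = fun w : ℝ => 1 / vline σ w ^ (a + 1) := by
    funext w
    rw [Real.fourier_real_eq_integral_exp_smul]
    have hre : 0 < (vline σ w).re := by simpa
    have key := integral_pow_mul_cexp_neg a hre
    rw [← setIntegral_eq_integral_of_forall_compl_eq_zero (s := Ioi (0 : ℝ))]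
    · have hfac : (a.factorial : ℂ) ≠ 0 := by exact_mod_cast a.factorial_ne_zero
      rw [show (1 : ℂ) / vline σ w ^ (a + 1) =
        (a.factorial : ℂ)⁻¹ * (a.factorial / vline σ w ^ (a + 1)) by field_simp, ← key,
        ← integral_const_mul]
      refine setIntegral_congr_fun measurableSet_Ioi fun v hv => ?_
      simp only [hf, smul_eq_mul]
      rw [truncPow_of_nonneg a (le_of_lt hv), mul_comm, mul_assoc, ← Complex.exp_add]
      have : -(σ : ℂ) * v + ((-2 * Real.pi * v * w : ℝ) : ℂ) * Complex.I = -vline σ w * v := by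
        simp only [vline]; push_cast; ring
      rw [this]
      push_cast
      ring
    · intro v hv
      rw [hf0 v hv, smul_zero]
  have hFi : Integrable (FourierTransform.fourier f) := by
    rw [hF]
    have := integrable_cexp_div_vline_pow hσ (b := a + 1) (by omega) 0
    simpa using this
  have hinv := congrFun (hfc.fourierInv_fourier_eq hfi hFi) u
  rw [Real.fourierInv_eq', hF] at hinv
  have : (truncPow a u : ℂ) = f u * Complex.exp (σ * u) := by
    simp only [hf]
    rw [mul_assoc, ← Complex.exp_add]
    simp
  rw [this, ← hinv, ← integral_mul_const]
  refine integral_congr_ae (Eventually.of_forall fun w => ?_)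
  simp only [smul_eq_mul]
  have : vline σ w * u = ((2 * Real.pi * (inner ℝ w u) : ℝ) : ℂ) * Complex.I + σ * u := by
    simp only [vline, RCLike.inner_apply, conj_trivial]; push_cast; ring
  rw [this, Complex.exp_add]
  ring

end SmallGaps

/-! ### Weighted sums of the convolution powers of the Möbius function -/

namespace SmallGaps

open MeasureTheory Set Filter Topology

open ArithmeticFunction in
theorem LSeriesHasSum_moebius_pow (k : ℕ) {s : ℂ} (hs : 1 < s.re) :
    LSeriesHasSum (fun n => (((moebius ^ k : ArithmeticFunction ℤ) n : ℤ) : ℂ)) s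
      (riemannZeta s ^ k)⁻¹ := by
  have hμ : LSeriesHasSum (fun n => (((moebius : ArithmeticFunction ℤ) : ArithmeticFunction ℂ) n))
      s (riemannZeta s)⁻¹ := by
    have h1 := (LSeriesSummable_moebius_iff.2 hs).LSeriesHasSum
    have h2 := LSeries_zeta_mul_Lseries_moebius hs
    rw [LSeries_zeta_eq_riemannZeta hs] at h2
    rw [← eq_inv_of_mul_eq_one_right h2]
    exact h1
  have key : ∀ k : ℕ, LSeriesHasSum
      (fun n => ((((moebius : ArithmeticFunction ℤ) : ArithmeticFunction ℂ) ^ k) n)) s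
      (riemannZeta s ^ k)⁻¹ := by
    intro k
    induction k with
    | zero =>
      rw [pow_zero, pow_zero, inv_one, one_eq_delta]
      unfold LSeriesHasSum
      have h : LSeries.term LSeries.delta s = fun n => if n = 1 then 1 else 0 :=
        funext fun n => LSeries.term_delta s n
      rw [h]
      exact hasSum_ite_eq 1 1
    | succ k ih =>
      have := LSeriesHasSum_mul ih hμ
      rw [pow_succ, pow_succ, mul_inv]
      exact this
  convert key k using 2 with n
  have : (((moebius ^ k : ArithmeticFunction ℤ)) : ArithmeticFunction ℂ) =
      ((moebius : ArithmeticFunction ℤ) : ArithmeticFunction ℂ) ^ k := by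
    induction k with
    | zero => ext n; by_cases h : n = 1 <;> simp [h]
    | succ k ih => rw [pow_succ, pow_succ, ← ih, intCoe_mul]
  rw [← this]
  simp

/-- The integral of `|s|⁻¹ * min 1 |s|⁻¹` over the line `Re s = σ` is `O(log (1 / σ))`, stated with
an explicit majorant. -/
theorem exists_integral_norm_vline_le {σ : ℝ} (hσ : 0 < σ) :
    ∃ g : ℝ → ℝ, Integrable g ∧ (∀ w, (‖vline σ w‖)⁻¹ * min 1 (‖vline σ w‖)⁻¹ ≤ g w) ∧
      ∫ w, g w ≤ 4 * Real.log ((1 + σ) / σ) + 2 * Real.pi := by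
  have hF : IntervalIntegrable (fun x : ℝ => 2 * (σ + x)⁻¹) volume 0 1 := by
    refine ContinuousOn.intervalIntegrable ?_
    rw [Set.uIcc_of_le zero_le_one]
    refine continuousOn_const.mul (ContinuousOn.inv₀ (by fun_prop) fun x hx => ?_)
    have := hx.1; linarith
  have hint : ∫ x in (0 : ℝ)..1, 2 * (σ + x)⁻¹ = 2 * Real.log ((1 + σ) / σ) := by
    rw [intervalIntegral.integral_const_mul]
    have := intervalIntegral.integral_comp_add_left (a := 0) (b := 1) (fun x : ℝ => x⁻¹) σ
    rw [this, add_zero, integral_inv_of_pos hσ (by linarith), add_comm σ 1]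
  have hF' : IntegrableOn (fun x : ℝ => 2 * (σ + x)⁻¹) (Icc 0 1) :=
    (intervalIntegrable_iff_integrableOn_Icc_of_le zero_le_one).1 hF
  set φ : ℝ → ℝ := (Icc 0 1).indicator fun x : ℝ => 2 * (σ + x)⁻¹ with hφ
  have hφi : Integrable φ := hF'.integrable_indicator measurableSet_Icc
  have hφint : ∫ x, φ x = 2 * Real.log ((1 + σ) / σ) := by
    rw [hφ, integral_indicator measurableSet_Icc, integral_Icc_eq_integral_Ioc,
      ← intervalIntegral.integral_of_le zero_le_one, hint]
  have hφ0 : ∀ x, 0 ≤ φ x := fun x => Set.indicator_nonneg (fun x hx => by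
    have := hx.1
    positivity) x
  have hi2 : Integrable fun w : ℝ => 2 * (1 + w ^ 2)⁻¹ := integrable_inv_one_add_sq.const_mul 2
  refine ⟨fun w => (φ w + φ (-w)) + 2 * (1 + w ^ 2)⁻¹, (hφi.add hφi.comp_neg).add hi2, ?_, ?_⟩
  · intro w
    have hv : 0 < ‖vline σ w‖ := norm_pos_iff.2 (vline_ne_zero hσ w)
    have h1 := norm_vline_ge σ w
    have h2 := norm_vline_ge' hσ w
    set v := ‖vline σ w‖
    rcases le_or_gt |w| 1 with hw | hw
    · have hb : v⁻¹ * min 1 v⁻¹ ≤ 2 * (σ + |w|)⁻¹ := by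
        calc v⁻¹ * min 1 v⁻¹ ≤ v⁻¹ * 1 := by gcongr; exact min_le_left _ _
          _ ≤ 2 * (σ + |w|)⁻¹ := by
            rw [mul_one, ← div_eq_mul_inv, inv_eq_one_div, div_le_div_iff₀ hv (by positivity)]
            linarith
      have hφw : φ |w| = 2 * (σ + |w|)⁻¹ := by
        rw [hφ, Set.indicator_of_mem (show |w| ∈ Icc (0 : ℝ) 1 from ⟨abs_nonneg w, hw⟩)]
      have : φ |w| ≤ φ w + φ (-w) := by
        rcases abs_cases w with ⟨h, _⟩ | ⟨h, _⟩ <;> rw [h] <;> linarith [hφ0 w, hφ0 (-w)]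
      have : (0 : ℝ) ≤ 2 * (1 + w ^ 2)⁻¹ := by positivity
      linarith
    · have hw2 : 1 ≤ w ^ 2 := by rw [← sq_abs]; nlinarith
      have hvw : w ^ 2 ≤ v ^ 2 := by rw [← sq_abs w]; gcongr
      have hb : v⁻¹ * min 1 v⁻¹ ≤ 2 * (1 + w ^ 2)⁻¹ := by
        calc v⁻¹ * min 1 v⁻¹ ≤ v⁻¹ * v⁻¹ := by gcongr; exact min_le_right _ _
          _ = 1 / v ^ 2 := by field_simp
          _ ≤ 2 * (1 + w ^ 2)⁻¹ := by
            rw [← div_eq_mul_inv, div_le_div_iff₀ (by positivity) (by positivity)]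
            linarith
      linarith [hφ0 w, hφ0 (-w)]
  · have hadd : ∫ w, φ w + φ (-w) + 2 * (1 + w ^ 2)⁻¹ =
        (∫ w, φ w + φ (-w)) + ∫ w : ℝ, 2 * (1 + w ^ 2)⁻¹ :=
      integral_add (hφi.add hφi.comp_neg) hi2
    beta_reduce
    rw [hadd, integral_add hφi hφi.comp_neg,
      integral_neg_eq_self φ volume, hφint, integral_const_mul, integral_univ_inv_one_add_sq]
    linarith

open ArithmeticFunction in
/-- Perron's formula for the sums `∑ μ_k(m) / m * (u - log m)_+ ^ a / a!`, where `μ_k` is the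
`k`-fold Dirichlet convolution of `μ`, whose Dirichlet series is `ζ ^ (-k)`. -/
theorem sum_moebius_pow_eq_integral (k : ℕ) {a : ℕ} (ha : 0 < a) {σ : ℝ} (hσ : 0 < σ) (u : ℝ)
    {M : ℕ} (hM : u < Real.log (M + 1)) :
    ((∑ m ∈ Finset.Icc 1 M, ((moebius ^ k : ArithmeticFunction ℤ) m : ℝ) / m *
      truncPow a (u - Real.log m) : ℝ) : ℂ) =
    ∫ w : ℝ, (riemannZeta (1 + vline σ w) ^ k)⁻¹ *
      (Complex.exp (vline σ w * u) / vline σ w ^ (a + 1)) := by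
  set f : ℕ → ℂ := fun n => (((moebius ^ k : ArithmeticFunction ℤ) n : ℤ) : ℂ) with hf
  have hre : ∀ w, 1 < (1 + vline σ w).re := fun w => by simp [hσ]
  set F : ℕ → ℝ → ℂ := fun m w => LSeries.term f (1 + vline σ w) m *
    (Complex.exp (vline σ w * u) / vline σ w ^ (a + 1)) with hF
  have hterm : ∀ m : ℕ, m ≠ 0 → ∀ w : ℝ, F m w = f m / m *
      (Complex.exp (vline σ w * (u - Real.log m : ℝ)) / vline σ w ^ (a + 1)) := by
    intro m hm w
    have hm0 : (m : ℂ) ≠ 0 := by exact_mod_cast hm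
    simp only [hF]
    rw [LSeries.term_of_ne_zero hm, Complex.cpow_add _ _ hm0, Complex.cpow_one,
      Complex.cpow_def_of_ne_zero hm0, Complex.ofReal_sub, mul_sub, Complex.exp_sub,
      Complex.ofReal_log (Nat.cast_nonneg m), Complex.ofReal_natCast, mul_comm (Complex.log m)]
    field_simp
  have hint : ∀ m, Integrable (F m) := by
    intro m
    rcases eq_or_ne m 0 with rfl | hm
    · simp [hF]
    · rw [show F m = _ from funext (hterm m hm)]
      exact (integrable_cexp_div_vline_pow hσ (by omega) _).const_mul _
  have hnorm : ∀ m w, ‖F m w‖ = ‖LSeries.term f (1 + σ : ℝ) m‖ *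
      (Real.exp (σ * u) * (‖vline σ w‖ ^ (a + 1))⁻¹) := by
    intro m w
    simp only [hF]
    rw [norm_mul, LSeries.norm_term_eq, LSeries.norm_term_eq, norm_div, norm_pow, Complex.norm_exp]
    simp [div_eq_mul_inv]
  have hsum : Summable fun m => ∫ w, ‖F m w‖ := by
    simp_rw [hnorm, integral_const_mul]
    refine Summable.mul_right _ (Summable.norm ?_)
    have := (LSeriesHasSum_moebius_pow k (s := (1 + σ : ℝ)) (by simp [hσ])).LSeriesSummable
    exact this
  have h := hasSum_integral_of_summable_integral_norm hint hsum
  have hI : ∀ m : ℕ, ∫ w, F m w = if m = 0 then 0 else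
      ((((moebius ^ k : ArithmeticFunction ℤ) m : ℝ) / m *
        truncPow a (u - Real.log m) : ℝ) : ℂ) := by
    intro m
    split_ifs with hm
    · subst hm; simp [hF]
    · rw [integral_congr_ae (Eventually.of_forall (hterm m hm)), integral_const_mul,
        ← truncPow_eq_integral ha hσ]
      push_cast
      rfl
  have hR : ∫ w, ∑' m, F m w = ∫ w : ℝ, (riemannZeta (1 + vline σ w) ^ k)⁻¹ *
      (Complex.exp (vline σ w * u) / vline σ w ^ (a + 1)) := by
    refine integral_congr_ae (Eventually.of_forall fun w => ?_)
    simp only [hF]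
    rw [tsum_mul_right, (LSeriesHasSum_moebius_pow k (hre w)).tsum_eq]
  rw [← hR, ← h.tsum_eq, tsum_eq_sum (s := Finset.Icc 1 M), Complex.ofReal_sum]
  · refine Finset.sum_congr rfl fun m hm => ?_
    rw [hI, if_neg (by have := (Finset.mem_Icc.1 hm).1; omega)]
  · intro m hm
    rw [hI]
    split_ifs with h0
    · rfl
    · have hmM : M + 1 ≤ m := by
        by_contra hcon
        exact hm (Finset.mem_Icc.2 ⟨by omega, by omega⟩)
      have : Real.log (M + 1) ≤ Real.log m := by
        apply Real.log_le_log (by positivity)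
        exact_mod_cast hmM
      rw [truncPow_of_neg a (by linarith)]
      simp

theorem norm_pow_sub_one_le {z : ℂ} {C : ℝ} (hC : 1 ≤ C) (hz : ‖z‖ ≤ C) (k : ℕ) :
    ‖z ^ k - 1‖ ≤ k * C ^ k * ‖z - 1‖ := by
  induction k with
  | zero => simp
  | succ k ih =>
    have h1 : ‖z ^ k‖ ≤ C ^ k := by rw [norm_pow]; gcongr
    have h2 : (1 : ℝ) ≤ C ^ k := one_le_pow₀ hC
    have h3 : C ^ k ≤ C ^ (k + 1) := pow_le_pow_right₀ hC (by omega)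
    calc ‖z ^ (k + 1) - 1‖ = ‖z ^ k * (z - 1) + (z ^ k - 1)‖ := by ring_nf
      _ ≤ ‖z ^ k‖ * ‖z - 1‖ + ‖z ^ k - 1‖ := (norm_add_le _ _).trans_eq (by rw [norm_mul])
      _ ≤ C ^ k * ‖z - 1‖ + k * C ^ k * ‖z - 1‖ := by gcongr
      _ = (k + 1) * C ^ k * ‖z - 1‖ := by ring
      _ ≤ (k + 1) * C ^ (k + 1) * ‖z - 1‖ := by gcongr
      _ = _ := by push_cast; ring

open ArithmeticFunction in
/-- The sums `∑ μ_k(m) / m * (u - log m)_+ ^ (k + ℓ) / (k + ℓ)!` are `u ^ ℓ / ℓ!`, up to an error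
that is smaller by almost one factor `u`. The contour is the line `Re s = 1 / (1 + u)`. -/
theorem exists_sum_moebius_pow_sub_le (k : ℕ) {ℓ : ℕ} (hℓ : 0 < ℓ) :
    ∃ C : ℝ, 0 < C ∧ ∀ u : ℝ, 0 ≤ u → ∀ M : ℕ, u < Real.log (M + 1) →
      |∑ m ∈ Finset.Icc 1 M, ((moebius ^ k : ArithmeticFunction ℤ) m : ℝ) / m *
          truncPow (k + ℓ) (u - Real.log m) - truncPow ℓ u| ≤
        C * (1 + u) ^ (ℓ - 1) * (1 + Real.log (1 + u)) := by
  obtain ⟨C, hC, hq⟩ := exists_norm_zetaQuot_le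
  obtain ⟨b, rfl⟩ : ∃ b, ℓ = b + 1 := ⟨ℓ - 1, by omega⟩
  set D : ℝ := k * C ^ k * C + (C ^ k + 1) with hD
  have hD0 : 0 < D := by positivity
  refine ⟨Real.exp 1 * D * 12, by positivity, fun u hu M hM => ?_⟩
  set σ : ℝ := (1 + u)⁻¹ with hσdef
  have hσ : 0 < σ := by positivity
  have hσ1 : σ ≤ 1 := inv_le_one_of_one_le₀ (by linarith)
  obtain ⟨g, hgi, hgle, hgint⟩ := exists_integral_norm_vline_le hσ
  have hζ0 : ∀ w, riemannZeta (1 + vline σ w) ≠ 0 := fun w =>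
    riemannZeta_ne_zero_of_one_le_re (by simp [hσ.le])
  have hintegrand : ∀ w, (riemannZeta (1 + vline σ w) ^ k)⁻¹ *
      (Complex.exp (vline σ w * u) / vline σ w ^ (k + (b + 1) + 1)) =
      zetaQuot (vline σ w) ^ k * (Complex.exp (vline σ w * u) / vline σ w ^ (b + 1 + 1)) := by
    intro w
    have h1 := vline_ne_zero hσ w
    have h2 := hζ0 w
    rw [zetaQuot, inv_pow, mul_pow, add_assoc, pow_add _ k]
    field_simp
  have hqw := fun w => hq (vline σ w) (by simpa) (by simpa)
  have hi2 := integrable_cexp_div_vline_pow hσ (b := b + 1 + 1) (by omega) u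
  have hi1 : Integrable fun w => zetaQuot (vline σ w) ^ k *
      (Complex.exp (vline σ w * u) / vline σ w ^ (b + 1 + 1)) := by
    refine hi2.bdd_mul (c := C ^ k) ?_ (Eventually.of_forall fun w => ?_)
    · refine Continuous.aestronglyMeasurable (Continuous.pow ?_ k)
      have hv := continuous_vline σ
      unfold zetaQuot
      refine Continuous.inv₀ (hv.mul ?_) fun w => mul_ne_zero (vline_ne_zero hσ w) (hζ0 w)
      rw [continuous_iff_continuousAt]
      intro w
      have : (1 : ℂ) + vline σ w ≠ 1 := by simpa using vline_ne_zero hσ w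
      exact ContinuousAt.comp (f := fun w => 1 + vline σ w)
        (differentiableAt_riemannZeta this).continuousAt
        (continuous_const.add hv).continuousAt
    · rw [norm_pow]
      exact pow_le_pow_left₀ (norm_nonneg _) (hqw w).1 k
  have hmain : ((∑ m ∈ Finset.Icc 1 M, ((moebius ^ k : ArithmeticFunction ℤ) m : ℝ) / m *
          truncPow (k + (b + 1)) (u - Real.log m) - truncPow (b + 1) u : ℝ) : ℂ) =
      ∫ w, (zetaQuot (vline σ w) ^ k - 1) *
        (Complex.exp (vline σ w * u) / vline σ w ^ (b + 1 + 1)) := by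
    rw [Complex.ofReal_sub, sum_moebius_pow_eq_integral k (by omega) hσ u hM,
      truncPow_eq_integral (by omega) hσ, integral_congr_ae (Eventually.of_forall hintegrand),
      ← integral_sub hi1 hi2]
    refine integral_congr_ae (Eventually.of_forall fun w => ?_)
    simp only
    ring
  rw [← Real.norm_eq_abs, ← Complex.norm_real, hmain]
  have hpt : ∀ w, ‖(zetaQuot (vline σ w) ^ k - 1) *
        (Complex.exp (vline σ w * u) / vline σ w ^ (b + 1 + 1))‖ ≤
      Real.exp 1 * D * (1 + u) ^ b * g w := by
    intro w
    have hv : 0 < ‖vline σ w‖ := norm_pos_iff.2 (vline_ne_zero hσ w)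
    have h2 := norm_vline_ge' hσ w
    have hg := hgle w
    have hq1 := (hqw w).1
    have hq2 := (hqw w).2
    set v := ‖vline σ w‖ with hvdef
    have ha : ‖zetaQuot (vline σ w) ^ k - 1‖ ≤ D * min 1 v⁻¹ * v := by
      have h3 : ‖zetaQuot (vline σ w) ^ k - 1‖ ≤ D * v := by
        refine (norm_pow_sub_one_le hC hq1 k).trans ?_
        calc _ ≤ k * C ^ k * (C * v) := by gcongr
          _ = (k * C ^ k * C) * v := by ring
          _ ≤ D * v := by
            have : 0 < C ^ k := by positivity
            gcongr
            linarith
      have h4 : ‖zetaQuot (vline σ w) ^ k - 1‖ ≤ D := by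
        refine (norm_sub_le _ _).trans ?_
        rw [norm_pow, norm_one]
        have : ‖zetaQuot (vline σ w)‖ ^ k ≤ C ^ k := by gcongr
        have : 0 ≤ k * C ^ k * C := by positivity
        linarith
      rcases min_cases 1 v⁻¹ with ⟨h, _⟩ | ⟨h, _⟩ <;> rw [h]
      · simpa using h3
      · rw [mul_assoc, inv_mul_cancel₀ hv.ne', mul_one]; exact h4
    have he : ‖Complex.exp (vline σ w * u)‖ ≤ Real.exp 1 := by
      rw [Complex.norm_exp]
      apply Real.exp_le_exp.2
      have : (vline σ w * u).re = σ * u := by simp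
      rw [this, hσdef, inv_mul_le_iff₀ (by linarith)]
      linarith
    have hvb : (v ^ b)⁻¹ ≤ (1 + u) ^ b := by
      rw [← inv_pow]
      refine pow_le_pow_left₀ (by positivity) ?_ b
      have := inv_anti₀ hσ h2
      rwa [hσdef, inv_inv] at this
    rw [norm_mul, norm_div, norm_pow, ← hvdef]
    calc _ ≤ (D * min 1 v⁻¹ * v) * (Real.exp 1 / v ^ (b + 1 + 1)) := by gcongr
      _ = Real.exp 1 * D * (v ^ b)⁻¹ * (v⁻¹ * min 1 v⁻¹) := by
        rw [pow_succ, pow_succ]; field_simp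
      _ ≤ Real.exp 1 * D * (1 + u) ^ b * g w := by
        have : 0 ≤ min 1 v⁻¹ := le_min zero_le_one (by positivity)
        gcongr
  refine (norm_integral_le_of_norm_le (hgi.const_mul _) (Eventually.of_forall hpt)).trans ?_
  rw [integral_const_mul, Nat.add_sub_cancel]
  have hlog : Real.log ((1 + σ) / σ) ≤ 1 + Real.log (1 + u) := by
    have e : (1 + σ) / σ = 1 + (1 + u) := by rw [hσdef]; field_simp; ring
    rw [e]
    calc Real.log (1 + (1 + u)) ≤ Real.log (2 * (1 + u)) :=
          Real.log_le_log (by linarith) (by linarith)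
      _ = Real.log 2 + Real.log (1 + u) := Real.log_mul (by norm_num) (by linarith)
      _ ≤ _ := by linarith [Real.log_two_lt_d9]
  have hl0 : 0 ≤ Real.log (1 + u) := Real.log_nonneg (by linarith)
  have hg12 : ∫ w, g w ≤ 12 * (1 + Real.log (1 + u)) := by
    linarith [Real.pi_lt_four]
  calc _ ≤ Real.exp 1 * D * (1 + u) ^ b * (12 * (1 + Real.log (1 + u))) := by gcongr
    _ = _ := by ring

end SmallGaps

/-! ### The algebra of Dirichlet polynomials acting on a box -/

namespace SmallGaps

open scoped NNReal

/-- The box `[0, L] × [0, L]`. -/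
abbrev Box (L : ℝ≥0) : Type := Set.Iic ((L, L) : ℝ≥0 × ℝ≥0)

/-- The upper right corner of the box. -/
def corner (L : ℝ≥0) : Box L := ⟨(L, L), Set.mem_Iic.2 le_rfl⟩

/-- Translation by `g` of functions on the box, with value `0` where the translate leaves the box.
Translations by vectors outside the box are zero, so relations between Dirichlet polynomials that
hold up to terms beyond the box become identities between operators. -/
noncomputable def shift (L : ℝ≥0) :
    Multiplicative (ℝ≥0 × ℝ≥0) →* Module.End ℝ (Box L → ℝ) where
  toFun g :=
    { toFun := fun φ z =>
        if g.toAdd ≤ z.1 then φ ⟨z.1 - g.toAdd, Set.mem_Iic.2 (tsub_le_self.trans z.2)⟩ else 0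
      map_add' := fun φ ψ => by
        funext z; by_cases h : g.toAdd ≤ z.1 <;> simp [h]
      map_smul' := fun c φ => by
        funext z; by_cases h : g.toAdd ≤ z.1 <;> simp [h] }
  map_one' := by
    ext φ z
    simp
  map_mul' g h := by
    ext φ z
    simp only [toAdd_mul, LinearMap.coe_mk, AddHom.coe_mk, Module.End.mul_apply]
    by_cases h1 : g.toAdd ≤ z.1
    · have : g.toAdd + h.toAdd ≤ z.1 ↔ h.toAdd ≤ z.1 - g.toAdd := by
        rw [Prod.le_def, Prod.le_def]
        simp only [Prod.fst_add, Prod.snd_add, Prod.fst_sub, Prod.snd_sub]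
        rw [le_tsub_iff_left h1.1, le_tsub_iff_left h1.2]
      simp only [this, h1, if_true, tsub_tsub]
    · have : ¬ g.toAdd + h.toAdd ≤ z.1 := fun h2 => h1 (le_self_add.trans h2)
      simp only [this, h1, if_false]

theorem shift_apply (L : ℝ≥0) (g : ℝ≥0 × ℝ≥0) (φ : Box L → ℝ) (z : Box L) :
    shift L (Multiplicative.ofAdd g) φ z =
      if g ≤ z.1 then φ ⟨z.1 - g, Set.mem_Iic.2 (tsub_le_self.trans z.2)⟩ else 0 := rfl

theorem shift_eq_zero {L : ℝ≥0} {g : ℝ≥0 × ℝ≥0} (hg : ¬ g ≤ (L, L)) :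
    shift L (Multiplicative.ofAdd g) = 0 := by
  ext φ z
  rw [shift_apply, if_neg fun h => hg (h.trans z.2)]
  rfl

/-- Formal finite linear combinations of translations in the two logarithmic variables:
the commutative algebra of Dirichlet polynomials in two variables. -/
abbrev DirAlg : Type := AddMonoidAlgebra ℝ (ℝ≥0 × ℝ≥0)

/-- The action of Dirichlet polynomials on functions on the box, a generator acting as the
corresponding translation. -/
noncomputable def act (L : ℝ≥0) : DirAlg →ₐ[ℝ] Module.End ℝ (Box L → ℝ) :=
  AddMonoidAlgebra.lift ℝ _ _ (shift L)

/-- The sum of the coefficients, that is the value of the Dirichlet polynomial at `s = t = 0`. -/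
noncomputable def aug : DirAlg →ₐ[ℝ] ℝ := AddMonoidAlgebra.lift ℝ _ _ 1

/-- The weighted `ℓ¹`-norm in which the translation by `g` has norm `exp (δ * (g.1 + g.2))`. -/
noncomputable def wnorm (δ : ℝ) (a : DirAlg) : ℝ :=
  a.coeff.sum fun g c => |c| * Real.exp (δ * (g.1 + g.2))

theorem act_single (L : ℝ≥0) (g : ℝ≥0 × ℝ≥0) (c : ℝ) :
    act L (AddMonoidAlgebra.single g c) = c • shift L (Multiplicative.ofAdd g) :=
  AddMonoidAlgebra.lift_single _ _ _

theorem aug_single (g : ℝ≥0 × ℝ≥0) (c : ℝ) : aug (AddMonoidAlgebra.single g c) = c := by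
  rw [aug, AddMonoidAlgebra.lift_single]; simp

theorem act_apply (L : ℝ≥0) (a : DirAlg) (φ : Box L → ℝ) (z : Box L) :
    act L a φ z = a.coeff.sum fun g c => c * shift L (Multiplicative.ofAdd g) φ z := by
  rw [act, AddMonoidAlgebra.lift_apply, Finsupp.sum, Finsupp.sum, LinearMap.sum_apply,
    Finset.sum_apply]
  rfl

theorem aug_apply (a : DirAlg) : aug a = a.coeff.sum fun _ c => c := by
  rw [aug, AddMonoidAlgebra.lift_apply]
  simp

theorem wnorm_single (δ : ℝ) (g : ℝ≥0 × ℝ≥0) (c : ℝ) :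
    wnorm δ (AddMonoidAlgebra.single g c) = |c| * Real.exp (δ * (g.1 + g.2)) := by
  rw [wnorm, AddMonoidAlgebra.coeff_single, Finsupp.sum_single_index (by simp)]

theorem wnorm_nonneg (δ : ℝ) (a : DirAlg) : 0 ≤ wnorm δ a :=
  Finset.sum_nonneg fun _ _ => by positivity

theorem wnorm_zero (δ : ℝ) : wnorm δ 0 = 0 := by simp [wnorm]

theorem wnorm_one (δ : ℝ) : wnorm δ 1 = 1 := by
  rw [AddMonoidAlgebra.one_def, wnorm_single]; simp

theorem wnorm_eq_sum (δ : ℝ) (a : DirAlg) {s : Finset (ℝ≥0 × ℝ≥0)} (hs : a.coeff.support ⊆ s) :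
    wnorm δ a = ∑ g ∈ s, |a.coeff g| * Real.exp (δ * (g.1 + g.2)) :=
  Finsupp.sum_of_support_subset _ hs _ (by simp)

theorem wnorm_add_le (δ : ℝ) (a b : DirAlg) : wnorm δ (a + b) ≤ wnorm δ a + wnorm δ b := by
  classical
  have h1 : a.coeff.support ⊆ a.coeff.support ∪ b.coeff.support := Finset.subset_union_left
  have h2 : b.coeff.support ⊆ a.coeff.support ∪ b.coeff.support := Finset.subset_union_right
  have h3 : (a + b).coeff.support ⊆ a.coeff.support ∪ b.coeff.support := by
    rw [AddMonoidAlgebra.coeff_add]; exact Finsupp.support_add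
  rw [wnorm_eq_sum δ a h1, wnorm_eq_sum δ b h2, wnorm_eq_sum δ _ h3, ← Finset.sum_add_distrib]
  refine Finset.sum_le_sum fun g _ => ?_
  rw [← add_mul, AddMonoidAlgebra.coeff_add, Finsupp.add_apply]
  gcongr
  exact abs_add_le _ _

theorem wnorm_smul (δ c : ℝ) (a : DirAlg) : wnorm δ (c • a) = |c| * wnorm δ a := by
  have h : (c • a).coeff.support ⊆ a.coeff.support := by
    rw [AddMonoidAlgebra.coeff_smul]; exact Finsupp.support_smul
  rw [wnorm_eq_sum δ _ h, wnorm_eq_sum δ a subset_rfl, Finset.mul_sum]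
  refine Finset.sum_congr rfl fun g _ => ?_
  rw [AddMonoidAlgebra.coeff_smul, Finsupp.smul_apply, smul_eq_mul, abs_mul]
  ring

theorem wnorm_neg (δ : ℝ) (a : DirAlg) : wnorm δ (-a) = wnorm δ a := by
  rw [← neg_one_smul ℝ a, wnorm_smul]; simp

theorem wnorm_sub_le (δ : ℝ) (a b : DirAlg) : wnorm δ (a - b) ≤ wnorm δ a + wnorm δ b := by
  rw [sub_eq_add_neg]
  exact (wnorm_add_le _ _ _).trans_eq (by rw [wnorm_neg])

theorem wnorm_sum_le {ι : Type*} (δ : ℝ) (s : Finset ι) (a : ι → DirAlg) :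
    wnorm δ (∑ i ∈ s, a i) ≤ ∑ i ∈ s, wnorm δ (a i) :=
  Finset.le_sum_of_subadditive _ (wnorm_zero δ).le (wnorm_add_le δ) s a

theorem wnorm_mul_le (δ : ℝ) (a b : DirAlg) : wnorm δ (a * b) ≤ wnorm δ a * wnorm δ b := by
  rw [AddMonoidAlgebra.mul_def, Finsupp.sum]
  refine (wnorm_sum_le δ _ _).trans ?_
  rw [wnorm, Finsupp.sum, Finset.sum_mul]
  refine Finset.sum_le_sum fun g _ => ?_
  rw [Finsupp.sum]
  refine (wnorm_sum_le δ _ _).trans ?_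
  rw [wnorm, Finsupp.sum, Finset.mul_sum]
  refine Finset.sum_le_sum fun h _ => ?_
  rw [wnorm_single, abs_mul]
  refine le_of_eq ?_
  have : δ * (((g + h).1 : ℝ≥0) + ((g + h).2 : ℝ≥0) : ℝ) =
      δ * (g.1 + g.2) + δ * (h.1 + h.2) := by
    simp only [Prod.fst_add, Prod.snd_add, NNReal.coe_add]; ring
  rw [this, Real.exp_add]
  ring

theorem wnorm_pow_le (δ : ℝ) (a : DirAlg) (n : ℕ) : wnorm δ (a ^ n) ≤ wnorm δ a ^ n := by
  induction n with
  | zero => simp [wnorm_one]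
  | succ n ih =>
    rw [pow_succ, pow_succ]
    exact (wnorm_mul_le _ _ _).trans (mul_le_mul_of_nonneg_right ih (wnorm_nonneg _ _))

theorem wnorm_prod_le {ι : Type*} (δ : ℝ) (s : Finset ι) (a : ι → DirAlg) :
    wnorm δ (∏ i ∈ s, a i) ≤ ∏ i ∈ s, wnorm δ (a i) := by
  classical
  induction s using Finset.induction_on with
  | empty => simp [wnorm_one]
  | insert i s hi ih =>
    rw [Finset.prod_insert hi, Finset.prod_insert hi]
    exact (wnorm_mul_le _ _ _).trans (mul_le_mul_of_nonneg_left ih (wnorm_nonneg _ _))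

theorem abs_aug_le {δ : ℝ} (hδ : 0 ≤ δ) (a : DirAlg) : |aug a| ≤ wnorm δ a := by
  rw [aug_apply, wnorm, Finsupp.sum, Finsupp.sum]
  refine (Finset.abs_sum_le_sum_abs _ _).trans (Finset.sum_le_sum fun g _ => ?_)
  refine le_mul_of_one_le_right (abs_nonneg _) (Real.one_le_exp ?_)
  positivity

/-- If `φ` is close to the constant `κ` near the corner of the box, then applying a Dirichlet
polynomial to `φ` amounts to multiplication by the sum of the coefficients. -/
theorem abs_act_sub_le {L : ℝ≥0} {δ κ E : ℝ} (hδ : 0 ≤ δ) (hE : 0 ≤ E) {φ : Box L → ℝ}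
    (hφ : ∀ z : Box L, |φ z - κ| ≤ E * Real.exp (δ * ((L - z.1.1) + (L - z.1.2))))
    (hκ : |κ| ≤ E * Real.exp (δ * L)) (a : DirAlg) :
    |act L a φ (corner L) - κ * aug a| ≤ E * wnorm δ a := by
  rw [act_apply, aug_apply, wnorm, Finsupp.sum, Finsupp.sum, Finsupp.sum, Finset.mul_sum,
    ← Finset.sum_sub_distrib, Finset.mul_sum]
  refine (Finset.abs_sum_le_sum_abs _ _).trans (Finset.sum_le_sum fun g _ => ?_)
  rw [mul_comm κ, ← mul_sub, abs_mul, mul_left_comm]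
  refine mul_le_mul_of_nonneg_left ?_ (abs_nonneg _)
  rw [shift_apply]
  split_ifs with hg
  · refine (hφ _).trans (le_of_eq ?_)
    have h1 : ((((L, L) : ℝ≥0 × ℝ≥0) - g).1 : ℝ) = L - g.1 := by
      exact NNReal.coe_sub (show g.1 ≤ L from hg.1)
    have h2 : ((((L, L) : ℝ≥0 × ℝ≥0) - g).2 : ℝ) = L - g.2 := by
      exact NNReal.coe_sub (show g.2 ≤ L from hg.2)
    simp only [corner]
    rw [h1, h2]
    congr 3
    ring
  · rw [zero_sub, abs_neg]
    refine hκ.trans ?_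
    gcongr
    simp only [corner, Prod.le_def, not_and_or, not_le] at hg
    have h1 := g.1.2
    have h2 := g.2.2
    rcases hg with h | h
    · have : (L : ℝ) < g.1 := h
      linarith [NNReal.coe_nonneg g.2]
    · have : (L : ℝ) < g.2 := h
      linarith [NNReal.coe_nonneg g.1]

end SmallGaps

/-! ### Dirichlet convolution and Euler products as operators -/

namespace SmallGaps

open scoped NNReal
open ArithmeticFunction (moebius zeta)

/-- The logarithm of a positive integer, as a nonnegative real. -/
noncomputable def ln (m : ℕ) : ℝ≥0 := ⟨Real.log m, Real.log_natCast_nonneg m⟩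

@[simp] theorem coe_ln (m : ℕ) : (ln m : ℝ) = Real.log m := rfl

theorem ln_mul {m n : ℕ} (hm : m ≠ 0) (hn : n ≠ 0) : ln (m * n) = ln m + ln n := by
  apply NNReal.eq
  push_cast [coe_ln]
  rw [Real.log_mul (by exact_mod_cast hm) (by exact_mod_cast hn)]

@[simp] theorem ln_one : ln 1 = 0 := by apply NNReal.eq; simp

theorem ln_prod {S : Finset ℕ} (hS : ∀ p ∈ S, p.Prime) : ln (∏ p ∈ S, p) = ∑ p ∈ S, ln p := by
  induction S using Finset.induction_on with
  | empty => simp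
  | insert p S hp ih =>
    have hS' : ∀ q ∈ S, q.Prime := fun q hq => hS q (Finset.mem_insert_of_mem hq)
    rw [Finset.prod_insert hp, Finset.sum_insert hp, ← ih hS',
      ln_mul (hS p (Finset.mem_insert_self _ _)).ne_zero
        (Finset.prod_ne_zero_iff.2 fun q hq => (hS' q hq).ne_zero)]

/-- The primes up to `M`. -/
def primesUpTo (M : ℕ) : Finset ℕ := (Finset.Icc 1 M).filter Nat.Prime

theorem mem_primesUpTo {M p : ℕ} : p ∈ primesUpTo M ↔ p.Prime ∧ p ≤ M := by
  unfold primesUpTo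
  rw [Finset.mem_filter, Finset.mem_Icc]
  exact ⟨fun h => ⟨h.2, h.1.2⟩, fun h => ⟨⟨h.1.one_le, h.2⟩, h.1⟩⟩

theorem primeFactors_prod_primes {S : Finset ℕ} (hS : ∀ p ∈ S, p.Prime) :
    (∏ p ∈ S, p).primeFactors = S := Nat.primeFactors_prod hS

theorem squarefree_prod_primes {S : Finset ℕ} (hS : ∀ p ∈ S, p.Prime) :
    Squarefree (∏ p ∈ S, p) := by
  refine Finset.squarefree_prod_of_pairwise_isCoprime (fun p hp q hq hpq => ?_) fun p hp =>
    (hS p hp).prime.squarefree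
  exact Nat.coprime_iff_isRelPrime.1 ((Nat.coprime_primes (hS p hp) (hS q hq)).2 hpq)

theorem moebius_prod_primes {S : Finset ℕ} (hS : ∀ p ∈ S, p.Prime) :
    moebius (∏ p ∈ S, p) = ∏ _p ∈ S, (-1 : ℤ) := by
  rw [ArithmeticFunction.isMultiplicative_moebius.map_prod_of_prime S hS]
  exact Finset.prod_congr rfl fun p hp => ArithmeticFunction.moebius_apply_prime (hS p hp)

/-- Products of distinct primes up to `M` enumerate the squarefree numbers; those beyond `M` are
assumed not to contribute. -/
theorem sum_powerset_primesUpTo {V : Type*} [AddCommMonoid V] (M : ℕ) (F : ℕ → V)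
    (hF : ∀ d, M < d → F d = 0) :
    ∑ S ∈ (primesUpTo M).powerset, F (∏ p ∈ S, p) =
      ∑ d ∈ (Finset.Icc 1 M).filter Squarefree, F d := by
  rw [← Finset.sum_filter_of_ne (p := fun S => ∏ p ∈ S, p ≤ M)
    (fun S _ h => by by_contra h'; exact h (hF _ (not_le.1 h')))]
  have hpr : ∀ S ∈ (primesUpTo M).powerset, ∀ p ∈ S, p.Prime := fun S hS p hp =>
    (mem_primesUpTo.1 (Finset.mem_powerset.1 hS hp)).1
  refine Finset.sum_bij' (fun S _ => ∏ p ∈ S, p) (fun d _ => d.primeFactors) ?_ ?_ ?_ ?_ ?_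
  · intro S hS
    rw [Finset.mem_filter] at hS
    have h := hpr S hS.1
    rw [Finset.mem_filter, Finset.mem_Icc]
    exact ⟨⟨Nat.one_le_iff_ne_zero.2 (Finset.prod_ne_zero_iff.2 fun q hq => (h q hq).ne_zero),
      hS.2⟩, squarefree_prod_primes h⟩
  · intro d hd
    rw [Finset.mem_filter, Finset.mem_Icc] at hd
    rw [Finset.mem_filter, Finset.mem_powerset, Nat.prod_primeFactors_of_squarefree hd.2]
    refine ⟨fun p hp => mem_primesUpTo.2 ⟨Nat.prime_of_mem_primeFactors hp, ?_⟩, hd.1.2⟩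
    exact (Nat.le_of_dvd (by omega) (Nat.dvd_of_mem_primeFactors hp)).trans hd.1.2
  · intro S hS
    exact primeFactors_prod_primes (hpr S (Finset.mem_filter.1 hS).1)
  · intro d hd
    exact Nat.prod_primeFactors_of_squarefree (Finset.mem_filter.1 hd).2
  · intro S hS
    rfl

/-- The Dirichlet polynomial `∑_{m ≤ M} f(m) / m` in the direction `θ`: the term `m` carries the
translation by `log m * θ`, which stands for `m ^ (-(θ.1 s + θ.2 t))`. -/
noncomputable def dirPoly (θ : ℝ≥0 × ℝ≥0) (M : ℕ) (f : ArithmeticFunction ℤ) : DirAlg :=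
  ∑ m ∈ Finset.Icc 1 M, AddMonoidAlgebra.single (ln m • θ) ((f m : ℝ) / m)

/-- The directions in which the Dirichlet polynomials are used leave the box `[0, L] ^ 2` as soon as
the logarithm exceeds `L`. -/
def IsDir (θ : ℝ≥0 × ℝ≥0) : Prop := 1 ≤ θ.1 ∨ 1 ≤ θ.2

theorem not_smul_le {L : ℝ≥0} {θ : ℝ≥0 × ℝ≥0} (hθ : IsDir θ) {M : ℕ}
    (hM : (L : ℝ) < Real.log (M + 1)) {m : ℕ} (hm : M < m) : ¬ ln m • θ ≤ (L, L) := by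
  have h : L < ln m := by
    have h1 : Real.log (M + 1) ≤ Real.log m :=
      Real.log_le_log (by positivity) (by exact_mod_cast hm)
    have : (L : ℝ) < ln m := by rw [coe_ln]; linarith
    exact_mod_cast this
  intro hle
  rcases hθ with h1 | h1
  · have h2 : ln m * θ.1 ≤ L := hle.1
    exact absurd ((le_mul_of_one_le_right' h1).trans h2) (not_le.2 h)
  · have h2 : ln m * θ.2 ≤ L := hle.2
    exact absurd ((le_mul_of_one_le_right' h1).trans h2) (not_le.2 h)

/-- On the box Dirichlet convolution becomes composition, without truncation error: all products
beyond `M` translate out of the box. -/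
theorem act_dirPoly_mul {L : ℝ≥0} {θ : ℝ≥0 × ℝ≥0} (hθ : IsDir θ) {M : ℕ}
    (hM : (L : ℝ) < Real.log (M + 1)) (f g : ArithmeticFunction ℤ) :
    act L (dirPoly θ M (f * g)) = act L (dirPoly θ M f) * act L (dirPoly θ M g) := by
  have hz : ∀ m, M < m → shift L (Multiplicative.ofAdd (ln m • θ)) = 0 := fun m hm =>
    shift_eq_zero (not_smul_le hθ hM hm)
  set h : ℕ × ℕ → Module.End ℝ (Box L → ℝ) := fun x =>
    ((f x.1 : ℝ) / x.1 * ((g x.2 : ℝ) / x.2)) • shift L (Multiplicative.ofAdd (ln (x.1 * x.2) • θ))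
    with hh
  have hr : act L (dirPoly θ M f) * act L (dirPoly θ M g) =
      ∑ x ∈ Finset.Icc 1 M ×ˢ Finset.Icc 1 M, h x := by
    rw [dirPoly, dirPoly, map_sum, map_sum, Finset.sum_mul_sum, Finset.sum_product]
    refine Finset.sum_congr rfl fun m hm => Finset.sum_congr rfl fun n hn => ?_
    have hm0 : m ≠ 0 := by have := (Finset.mem_Icc.1 hm).1; omega
    have hn0 : n ≠ 0 := by have := (Finset.mem_Icc.1 hn).1; omega
    rw [← map_mul, AddMonoidAlgebra.single_mul_single, act_single, ← add_smul, ← ln_mul hm0 hn0]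
  have hl : act L (dirPoly θ M (f * g)) =
      ∑ N ∈ Finset.Icc 1 M, ∑ x ∈ N.divisorsAntidiagonal, h x := by
    rw [dirPoly, map_sum]
    refine Finset.sum_congr rfl fun N hN => ?_
    rw [act_single, ArithmeticFunction.mul_apply, Int.cast_sum, Finset.sum_div, Finset.sum_smul]
    refine Finset.sum_congr rfl fun x hx => ?_
    have hx' := (Nat.mem_divisorsAntidiagonal.1 hx).1
    simp only [hh]
    rw [hx', ← hx']
    congr 1
    push_cast
    rw [div_mul_div_comm]
  rw [hl, hr, ← Finset.sum_filter_of_ne (p := fun x : ℕ × ℕ => x.1 * x.2 ≤ M), Finset.sum_sigma']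
  · refine Finset.sum_bij' (fun x _ => x.2) (fun x _ => ⟨x.1 * x.2, x⟩) ?_ ?_ ?_ ?_ ?_
    · rintro ⟨N, x⟩ hx
      simp only [Finset.mem_sigma, Finset.mem_Icc, Nat.mem_divisorsAntidiagonal] at hx
      simp only [Finset.mem_filter, Finset.mem_product, Finset.mem_Icc]
      obtain ⟨⟨h1, h2⟩, h3, h4⟩ := hx
      have hx1 : x.1 ≠ 0 := by rintro h; rw [h, zero_mul] at h3; omega
      have hx2 : x.2 ≠ 0 := by rintro h; rw [h, mul_zero] at h3; omega
      have h5 : x.1 ≤ x.1 * x.2 := Nat.le_mul_of_pos_right _ (by omega)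
      have h6 : x.2 ≤ x.1 * x.2 := Nat.le_mul_of_pos_left _ (by omega)
      omega
    · intro x hx
      simp only [Finset.mem_filter, Finset.mem_product, Finset.mem_Icc] at hx
      simp only [Finset.mem_sigma, Finset.mem_Icc, Nat.mem_divisorsAntidiagonal]
      have : 1 ≤ x.1 * x.2 := Nat.mul_pos (by omega) (by omega)
      refine ⟨⟨this, hx.2⟩, ?_⟩
      simp; omega
    · rintro ⟨N, x⟩ hx
      simp only [Finset.mem_sigma, Finset.mem_Icc, Nat.mem_divisorsAntidiagonal] at hx
      rw [hx.2.1]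
    · intro x hx
      rfl
    · intro x hx
      rfl
  · intro x _ hx
    by_contra hlt
    apply hx
    simp only [hh]
    rw [hz _ (not_le.1 hlt), smul_zero]

theorem one_le_of_lt_log {L : ℝ≥0} {M : ℕ} (hM : (L : ℝ) < Real.log (M + 1)) : 1 ≤ M := by
  by_contra h
  have : M = 0 := by omega
  subst this
  simp at hM

theorem act_dirPoly_one (L : ℝ≥0) (θ : ℝ≥0 × ℝ≥0) {M : ℕ} (hM : 1 ≤ M) :
    act L (dirPoly θ M 1) = 1 := by
  rw [dirPoly, Finset.sum_eq_single 1]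
  · rw [ln_one, zero_smul]
    simp only [ArithmeticFunction.one_one, Int.cast_one, Nat.cast_one, div_one]
    rw [← AddMonoidAlgebra.one_def, map_one]
  · intro m _ hm
    rw [ArithmeticFunction.one_apply_ne hm]
    simp
  · intro h
    exact absurd (Finset.mem_Icc.2 ⟨le_rfl, hM⟩) h

theorem act_dirPoly_pow {L : ℝ≥0} {θ : ℝ≥0 × ℝ≥0} (hθ : IsDir θ) {M : ℕ}
    (hM : (L : ℝ) < Real.log (M + 1)) (f : ArithmeticFunction ℤ) (k : ℕ) :
    act L (dirPoly θ M (f ^ k)) = act L (dirPoly θ M f) ^ k := by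
  induction k with
  | zero => rw [pow_zero, pow_zero, act_dirPoly_one L θ (one_le_of_lt_log hM)]
  | succ k ih => rw [pow_succ, pow_succ, act_dirPoly_mul hθ hM, ih]

theorem act_dirPoly_moebius_mul_zeta {L : ℝ≥0} {θ : ℝ≥0 × ℝ≥0} (hθ : IsDir θ) {M : ℕ}
    (hM : (L : ℝ) < Real.log (M + 1)) :
    act L (dirPoly θ M moebius) * act L (dirPoly θ M zeta) = 1 := by
  rw [← act_dirPoly_mul hθ hM, ArithmeticFunction.moebius_mul_coe_zeta,
    act_dirPoly_one L θ (one_le_of_lt_log hM)]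

theorem prod_single {ι : Type*} (S : Finset ι) (g : ι → ℝ≥0 × ℝ≥0) (c : ι → ℝ) :
    ∏ i ∈ S, (AddMonoidAlgebra.single (g i) (c i) : DirAlg) =
      AddMonoidAlgebra.single (∑ i ∈ S, g i) (∏ i ∈ S, c i) := by
  classical
  induction S using Finset.induction_on with
  | empty => simp [AddMonoidAlgebra.one_def]
  | insert i S hi ih =>
    rw [Finset.prod_insert hi, ih, AddMonoidAlgebra.single_mul_single, Finset.sum_insert hi,
      Finset.prod_insert hi]

/-- The Euler product of `∑ μ(m) / m`, truncated at the edge of the box. -/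
theorem act_prod_one_sub {L : ℝ≥0} {θ : ℝ≥0 × ℝ≥0} (hθ : IsDir θ) {M : ℕ}
    (hM : (L : ℝ) < Real.log (M + 1)) :
    act L (∏ p ∈ primesUpTo M, (1 - AddMonoidAlgebra.single (ln p • θ) (1 / (p : ℝ)))) =
      act L (dirPoly θ M moebius) := by
  have h1 : ∀ p : ℕ, (1 - AddMonoidAlgebra.single (ln p • θ) (1 / (p : ℝ)) : DirAlg) =
      1 + AddMonoidAlgebra.single (ln p • θ) (-(1 / (p : ℝ))) := by
    intro p
    rw [AddMonoidAlgebra.single_neg, sub_eq_add_neg]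
  simp_rw [h1]
  rw [Finset.prod_one_add, map_sum, dirPoly, map_sum]
  have h2 : ∀ S ∈ (primesUpTo M).powerset,
      act L (∏ p ∈ S, AddMonoidAlgebra.single (ln p • θ) (-(1 / (p : ℝ)))) =
      (fun d : ℕ => act L (AddMonoidAlgebra.single (ln d • θ) ((moebius d : ℝ) / d)))
        (∏ p ∈ S, p) := by
    intro S hS
    have hpr : ∀ p ∈ S, p.Prime := fun p hp =>
      (mem_primesUpTo.1 (Finset.mem_powerset.1 hS hp)).1
    rw [prod_single]
    beta_reduce
    congr 2
    · rw [ln_prod hpr, Finset.sum_smul]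
    · rw [moebius_prod_primes hpr]
      push_cast
      rw [← Finset.prod_div_distrib]
      refine Finset.prod_congr rfl fun p _ => by ring
  rw [Finset.sum_congr rfl h2, sum_powerset_primesUpTo M
    (fun d : ℕ => act L (AddMonoidAlgebra.single (ln d • θ) ((moebius d : ℝ) / d)))]
  · rw [Finset.sum_filter_of_ne]
    intro d _ hd
    by_contra hsq
    apply hd
    rw [ArithmeticFunction.moebius_eq_zero_of_not_squarefree hsq]
    simp
  · intro d hd
    rw [act_single, shift_eq_zero (not_smul_le hθ hM hd), smul_zero]

/-- Expansion of `∏ (1 - f (X + Y - X Y))`. -/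
theorem prod_one_sub_union {ι R : Type*} [DecidableEq ι] [CommRing R] (P : Finset ι)
    (f X Y : ι → R) :
    ∏ p ∈ P, (1 - f p * (X p + Y p - X p * Y p)) =
      ∑ S ∈ P.powerset, ∑ T ∈ P.powerset,
        (∏ p ∈ S ∪ T, f p) * ((∏ p ∈ S, -X p) * ∏ p ∈ T, -Y p) := by
  induction P using Finset.induction_on with
  | empty => simp
  | insert q P hq ih =>
    rw [Finset.prod_insert hq, ih, Finset.sum_powerset_insert hq, Finset.mul_sum,
      ← Finset.sum_add_distrib]
    refine Finset.sum_congr rfl fun S hS => ?_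
    rw [Finset.sum_powerset_insert hq, Finset.sum_powerset_insert hq, Finset.mul_sum,
      ← Finset.sum_add_distrib, ← Finset.sum_add_distrib, ← Finset.sum_add_distrib]
    refine Finset.sum_congr rfl fun T hT => ?_
    have hqS : q ∉ S := fun h => hq (Finset.mem_powerset.1 hS h)
    have hqT : q ∉ T := fun h => hq (Finset.mem_powerset.1 hT h)
    have hqST : q ∉ S ∪ T := by simp [hqS, hqT]
    simp only [Finset.insert_union, Finset.union_insert, Finset.prod_insert hqS,
      Finset.prod_insert hqT, Finset.prod_insert hqST, Finset.insert_idem]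
    ring

/-- The operator form of the bilinear sum over `d, e` weighted by a multiplicative function of
`lcm d e`. -/
theorem act_prod_eq_sum {L : ℝ≥0} {M : ℕ} (hM : (L : ℝ) < Real.log (M + 1)) (f : ℕ → ℝ) :
    act L (∏ p ∈ primesUpTo M, (1 - f p • (AddMonoidAlgebra.single (ln p • (1, 0)) 1 +
        AddMonoidAlgebra.single (ln p • (0, 1)) 1 -
        AddMonoidAlgebra.single (ln p • (1, 1)) (1 : ℝ) : DirAlg))) =
      ∑ d ∈ (Finset.Icc 1 M).filter Squarefree, ∑ e ∈ (Finset.Icc 1 M).filter Squarefree,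
        ((moebius d : ℝ) * moebius e * ∏ p ∈ d.primeFactors ∪ e.primeFactors, f p) •
          shift L (Multiplicative.ofAdd (ln d, ln e)) := by
  have hprod : ∀ p : ℕ, (1 - f p • (AddMonoidAlgebra.single (ln p • (1, 0)) 1 +
        AddMonoidAlgebra.single (ln p • (0, 1)) 1 -
        AddMonoidAlgebra.single (ln p • (1, 1)) (1 : ℝ)) : DirAlg) =
      1 - algebraMap ℝ DirAlg (f p) * (AddMonoidAlgebra.single (ln p • (1, 0)) 1 +
        AddMonoidAlgebra.single (ln p • (0, 1)) 1 - AddMonoidAlgebra.single (ln p • (1, 0)) 1 *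
        AddMonoidAlgebra.single (ln p • (0, 1)) 1) := by
    intro p
    rw [AddMonoidAlgebra.single_mul_single, ← smul_add, Algebra.smul_def]
    simp
  simp_rw [hprod]
  rw [prod_one_sub_union, map_sum]
  have hpr : ∀ S ∈ (primesUpTo M).powerset, ∀ p ∈ S, p.Prime := fun S hS p hp =>
    (mem_primesUpTo.1 (Finset.mem_powerset.1 hS hp)).1
  have hnot : ∀ d e : ℕ, M < d ∨ M < e → shift L (Multiplicative.ofAdd (ln d, ln e)) = 0 := by
    intro d e h
    refine shift_eq_zero fun hle => ?_
    rcases h with h | h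
    · exact not_smul_le (θ := (1, 0)) (Or.inl le_rfl) hM h ⟨by simpa using hle.1, by simp⟩
    · exact not_smul_le (θ := (0, 1)) (Or.inr le_rfl) hM h ⟨by simp, by simpa using hle.2⟩
  set G : ℕ → ℕ → Module.End ℝ (Box L → ℝ) := fun d e =>
    ((moebius d : ℝ) * moebius e * ∏ p ∈ d.primeFactors ∪ e.primeFactors, f p) •
          shift L (Multiplicative.ofAdd (ln d, ln e)) with hG
  have h2 : ∀ S ∈ (primesUpTo M).powerset, ∀ T ∈ (primesUpTo M).powerset,
      act L ((∏ p ∈ S ∪ T, algebraMap ℝ DirAlg (f p)) *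
        ((∏ p ∈ S, -AddMonoidAlgebra.single (ln p • (1, 0)) (1 : ℝ)) *
          ∏ p ∈ T, -AddMonoidAlgebra.single (ln p • (0, 1)) (1 : ℝ))) =
      G (∏ p ∈ S, p) (∏ p ∈ T, p) := by
    intro S hS T hT
    have hS' := hpr S hS
    have hT' := hpr T hT
    rw [← map_prod]
    simp_rw [← AddMonoidAlgebra.single_neg]
    rw [prod_single, prod_single, AddMonoidAlgebra.single_mul_single, ← Algebra.smul_def, map_smul,
      act_single, smul_smul]
    simp only [hG]
    rw [primeFactors_prod_primes hS', primeFactors_prod_primes hT', moebius_prod_primes hS',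
      moebius_prod_primes hT', ln_prod hS', ln_prod hT']
    congr 1
    · push_cast; ring
    · congr 2
      simp only [← Finset.sum_smul]
      ext <;> simp
  rw [Finset.sum_congr rfl fun S hS => (map_sum (act L) _ _).trans
    (Finset.sum_congr rfl fun T hT => h2 S hS T hT)]
  rw [Finset.sum_congr rfl fun S hS => sum_powerset_primesUpTo M (G (∏ p ∈ S, p)) fun e he => by
    simp only [hG]; rw [hnot _ _ (Or.inr he), smul_zero]]
  exact sum_powerset_primesUpTo M
    (fun d => ∑ e ∈ (Finset.Icc 1 M).filter Squarefree, G d e) fun d hd => by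
      refine Finset.sum_eq_zero fun e _ => ?_
      simp only [hG]; rw [hnot _ _ (Or.inl hd), smul_zero]

end SmallGaps

/-! ### Sums of truncated powers against divisor functions -/

namespace SmallGaps

open scoped NNReal
open ArithmeticFunction (moebius zeta)

/-- The one-variable operator `φ ↦ ∑_{m ≤ M} f(m) / m * φ(· - log m)`. -/
noncomputable def polyOp (M : ℕ) (f : ArithmeticFunction ℤ) (φ : ℝ → ℝ) (u : ℝ) : ℝ :=
  ∑ m ∈ Finset.Icc 1 M, (f m : ℝ) / m * φ (u - Real.log m)

theorem polyOp_of_neg {φ : ℝ → ℝ} (hφ : ∀ u < 0, φ u = 0) (M : ℕ) (f : ArithmeticFunction ℤ) :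
    ∀ u < 0, polyOp M f φ u = 0 := fun u hu =>
  Finset.sum_eq_zero fun m _ => by
    rw [hφ _ (by linarith [Real.log_natCast_nonneg m]), mul_zero]

/-- The product function `(u, v) ↦ φ u * ψ v` on the box. -/
def tens (L : ℝ≥0) (φ ψ : ℝ → ℝ) (z : Box L) : ℝ := φ z.1.1 * ψ z.1.2

theorem shift_tens {L : ℝ≥0} {φ ψ : ℝ → ℝ} (hφ : ∀ u < 0, φ u = 0) (hψ : ∀ u < 0, ψ u = 0)
    (g : ℝ≥0 × ℝ≥0) (z : Box L) :
    shift L (Multiplicative.ofAdd g) (tens L φ ψ) z = φ (z.1.1 - g.1) * ψ (z.1.2 - g.2) := by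
  rw [shift_apply]
  split_ifs with h
  · simp only [tens, Prod.fst_sub, Prod.snd_sub]
    rw [NNReal.coe_sub h.1, NNReal.coe_sub h.2]
  · rw [Prod.le_def, not_and_or, not_le, not_le] at h
    rcases h with h | h
    · rw [hφ _ (sub_neg.2 (by exact_mod_cast h)), zero_mul]
    · rw [hψ _ (sub_neg.2 (by exact_mod_cast h)), mul_zero]

theorem act_dirPoly_tens {L : ℝ≥0} {φ ψ : ℝ → ℝ} (hφ : ∀ u < 0, φ u = 0) (hψ : ∀ u < 0, ψ u = 0)
    (θ : ℝ≥0 × ℝ≥0) (M : ℕ) (f : ArithmeticFunction ℤ) (z : Box L) :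
    act L (dirPoly θ M f) (tens L φ ψ) z = ∑ m ∈ Finset.Icc 1 M, (f m : ℝ) / m *
      (φ (z.1.1 - Real.log m * θ.1) * ψ (z.1.2 - Real.log m * θ.2)) := by
  rw [dirPoly, map_sum, LinearMap.sum_apply, Finset.sum_apply]
  refine Finset.sum_congr rfl fun m _ => ?_
  rw [act_single, LinearMap.smul_apply, Pi.smul_apply, smul_eq_mul, shift_tens hφ hψ]
  simp

theorem act_dirPoly_fst {L : ℝ≥0} {φ ψ : ℝ → ℝ} (hφ : ∀ u < 0, φ u = 0) (hψ : ∀ u < 0, ψ u = 0)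
    (M : ℕ) (f : ArithmeticFunction ℤ) :
    act L (dirPoly (1, 0) M f) (tens L φ ψ) = tens L (polyOp M f φ) ψ := by
  funext z
  rw [act_dirPoly_tens hφ hψ, tens, polyOp, Finset.sum_mul]
  refine Finset.sum_congr rfl fun m _ => ?_
  simp
  ring

theorem act_dirPoly_snd {L : ℝ≥0} {φ ψ : ℝ → ℝ} (hφ : ∀ u < 0, φ u = 0) (hψ : ∀ u < 0, ψ u = 0)
    (M : ℕ) (f : ArithmeticFunction ℤ) :
    act L (dirPoly (0, 1) M f) (tens L φ ψ) = tens L φ (polyOp M f ψ) := by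
  funext z
  rw [act_dirPoly_tens hφ hψ, tens, polyOp, Finset.mul_sum]
  refine Finset.sum_congr rfl fun m _ => ?_
  simp
  ring

theorem truncPow_zero_of_neg : ∀ u < 0, truncPow 0 u = 0 := fun _ => truncPow_of_neg 0

theorem truncPow_zero_le (u : ℝ) : truncPow 0 u ≤ 1 := by
  unfold truncPow; split_ifs <;> simp

theorem truncPow_nonneg (a : ℕ) (u : ℝ) : 0 ≤ truncPow a u := by
  unfold truncPow; split_ifs <;> positivity

theorem polyOp_mul {L : ℝ≥0} {M : ℕ} (hM : (L : ℝ) < Real.log (M + 1)) {φ : ℝ → ℝ}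
    (hφ : ∀ u < 0, φ u = 0) (f g : ArithmeticFunction ℤ) {u : ℝ} (hu : u ≤ L) :
    polyOp M (f * g) φ u = polyOp M f (polyOp M g φ) u := by
  rcases lt_or_ge u 0 with h | h
  · rw [polyOp_of_neg hφ _ _ u h, polyOp_of_neg (polyOp_of_neg hφ _ _) _ _ u h]
  · have h1 := act_dirPoly_mul (θ := (1, 0)) (Or.inl le_rfl) hM f g
    have h2 := congrFun (LinearMap.congr_fun h1 (tens L φ (truncPow 0)))
      ⟨(⟨u, h⟩, 0), ⟨by exact_mod_cast hu, by simp⟩⟩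
    rw [Module.End.mul_apply, act_dirPoly_fst hφ truncPow_zero_of_neg,
      act_dirPoly_fst hφ truncPow_zero_of_neg,
      act_dirPoly_fst (polyOp_of_neg hφ _ _) truncPow_zero_of_neg] at h2
    simp only [tens, NNReal.coe_zero] at h2
    rw [truncPow_of_nonneg 0 le_rfl] at h2
    simp only [pow_zero, Nat.factorial_zero, Nat.cast_one, div_one, mul_one] at h2
    exact h2

theorem zeta_pow_nonneg (k m : ℕ) : 0 ≤ ((zeta : ArithmeticFunction ℤ) ^ k) m := by
  induction k generalizing m with
  | zero =>
    rw [pow_zero, ArithmeticFunction.one_apply]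
    split_ifs <;> simp
  | succ k ih =>
    rw [pow_succ, ArithmeticFunction.mul_apply]
    refine Finset.sum_nonneg fun x _ => mul_nonneg (ih _) ?_
    rw [ArithmeticFunction.natCoe_apply]
    positivity

theorem sum_inv_le {L : ℝ} {M : ℕ} (hM : Real.log M ≤ L) :
    ∑ m ∈ Finset.Icc 1 M, (1 : ℝ) / m ≤ 1 + L := by
  have h := harmonic_le_one_add_log M
  rw [harmonic_eq_sum_Icc] at h
  push_cast at h
  simp only [one_div]
  linarith

theorem zeta_cast_div {m M : ℕ} (hm : m ∈ Finset.Icc 1 M) :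
    ((((zeta : ArithmeticFunction ℤ) m : ℤ) : ℝ)) / m = 1 / m := by
  have : m ≠ 0 := by have := (Finset.mem_Icc.1 hm).1; omega
  rw [ArithmeticFunction.natCoe_apply, ArithmeticFunction.zeta_apply_ne this]
  simp

theorem polyOp_zeta_const_le {L : ℝ} {M : ℕ} (hM : Real.log M ≤ L) {φ : ℝ → ℝ} {B u : ℝ}
    (hB : 0 ≤ B) (h : ∀ v ≤ u, |φ v| ≤ B) : |polyOp M zeta φ u| ≤ (1 + L) * B := by
  have h1 : ∀ m ∈ Finset.Icc 1 M, |((((zeta : ArithmeticFunction ℤ) m : ℤ) : ℝ)) / m *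
      φ (u - Real.log m)| ≤ 1 / m * B := fun m hm => by
    rw [zeta_cast_div hm, abs_mul, abs_of_nonneg (by positivity : (0 : ℝ) ≤ 1 / m)]
    gcongr
    exact h _ (by linarith [Real.log_natCast_nonneg m])
  refine (Finset.abs_sum_le_sum_abs _ _).trans ((Finset.sum_le_sum h1).trans ?_)
  rw [← Finset.sum_mul]
  exact mul_le_mul_of_nonneg_right (sum_inv_le hM) hB

/-- The `k`-fold divisor function has `∑ d_k(m) / m ≤ (1 + L) ^ k`, by iterating the harmonic
sum. -/
theorem sum_zeta_pow_le {L : ℝ≥0} {M : ℕ} (hM : (L : ℝ) < Real.log (M + 1))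
    (hM' : Real.log M ≤ L) (k : ℕ) :
    ∑ m ∈ Finset.Icc 1 M, ((((zeta : ArithmeticFunction ℤ) ^ k) m : ℤ) : ℝ) / m ≤ (1 + L) ^ k := by
  have hL := L.2
  have key : ∀ k : ℕ, ∀ u ≤ (L : ℝ), |polyOp M (zeta ^ k) (truncPow 0) u| ≤ (1 + L) ^ k := by
    intro k
    induction k with
    | zero =>
      intro u hu
      rw [pow_zero, pow_zero, polyOp, Finset.sum_eq_single 1]
      · simp only [ArithmeticFunction.one_one, Int.cast_one, Nat.cast_one, div_one, one_mul]
        rw [abs_of_nonneg (truncPow_nonneg _ _)]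
        exact truncPow_zero_le _
      · intro m _ hm
        rw [ArithmeticFunction.one_apply_ne hm]; simp
      · intro h
        exact absurd (Finset.mem_Icc.2 ⟨le_rfl, one_le_of_lt_log hM⟩) h
    | succ k ih =>
      intro u hu
      rw [pow_succ', pow_succ', polyOp_mul hM truncPow_zero_of_neg _ _ hu]
      exact polyOp_zeta_const_le hM' (by positivity) fun v hv => ih v (hv.trans hu)
  have h := key k L le_rfl
  refine le_trans (le_of_eq ?_) ((le_abs_self _).trans h)
  refine Finset.sum_congr rfl fun m hm => ?_
  have hm1 : Real.log m ≤ L := by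
    refine le_trans (Real.log_le_log ?_ ?_) hM'
    · exact_mod_cast (Finset.mem_Icc.1 hm).1
    · exact_mod_cast (Finset.mem_Icc.1 hm).2
  rw [truncPow_of_nonneg 0 (sub_nonneg.2 hm1)]
  simp

theorem truncPow_succ_sub_le (b : ℕ) {x y : ℝ} (hyx : y ≤ x) :
    truncPow (b + 1) x - truncPow (b + 1) y ≤ (x - y) * truncPow b x := by
  rcases lt_or_ge x 0 with hx | hx
  · rw [truncPow_of_neg _ hx, truncPow_of_neg _ hx, truncPow_of_neg _ (hyx.trans_lt hx)]; simp
  · rw [truncPow_eq_max b.succ_pos, truncPow_eq_max b.succ_pos, max_eq_left hx,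
      truncPow_of_nonneg b hx]
    set Y := max y 0 with hY
    have hY0 : 0 ≤ Y := le_max_right _ _
    have hYx : Y ≤ x := max_le hyx hx
    have hyY : y ≤ Y := le_max_left _ _
    have h1 : x ^ (b + 1) - Y ^ (b + 1) ≤ (b + 1) * (x - Y) * x ^ b := by
      have h := (Commute.all x Y).geom_sum₂_mul (b + 1)
      rw [← h]
      have h2 : ∑ i ∈ Finset.range (b + 1), x ^ i * Y ^ (b + 1 - 1 - i) ≤
          ∑ i ∈ Finset.range (b + 1), x ^ b := by
        refine Finset.sum_le_sum fun i hi => ?_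
        have hi' : i ≤ b := Nat.lt_succ_iff.1 (Finset.mem_range.1 hi)
        calc x ^ i * Y ^ (b + 1 - 1 - i) ≤ x ^ i * x ^ (b - i) := by
              rw [Nat.add_sub_cancel]; gcongr
          _ = x ^ b := by rw [← pow_add, Nat.add_sub_cancel' hi']
      rw [Finset.sum_const, Finset.card_range, nsmul_eq_mul] at h2
      rw [Nat.cast_succ] at h2
      refine (mul_le_mul_of_nonneg_right h2 (sub_nonneg.2 hYx)).trans (le_of_eq ?_)
      ring
    have hf : (0 : ℝ) < b.factorial := by positivity
    rw [← sub_div, Nat.factorial_succ, div_le_iff₀ (by positivity)]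
    push_cast
    calc _ ≤ _ := h1
      _ ≤ (b + 1) * (x - y) * x ^ b := by gcongr
      _ = _ := by field_simp

theorem le_truncPow_succ_sub (b : ℕ) {x y : ℝ} (hyx : y ≤ x) :
    (x - y) * truncPow b y ≤ truncPow (b + 1) x - truncPow (b + 1) y := by
  rcases lt_or_ge y 0 with hy | hy
  · rw [truncPow_of_neg _ hy, truncPow_of_neg _ hy]
    simpa using truncPow_nonneg _ _
  · have hx : 0 ≤ x := hy.trans hyx
    rw [truncPow_of_nonneg _ hx, truncPow_of_nonneg _ hy, truncPow_of_nonneg _ hy]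
    have h1 : (b + 1) * (x - y) * y ^ b ≤ x ^ (b + 1) - y ^ (b + 1) := by
      have h := (Commute.all x y).geom_sum₂_mul (b + 1)
      rw [← h]
      have h2 : ∑ i ∈ Finset.range (b + 1), y ^ b ≤
          ∑ i ∈ Finset.range (b + 1), x ^ i * y ^ (b + 1 - 1 - i) := by
        refine Finset.sum_le_sum fun i hi => ?_
        have hi' : i ≤ b := Nat.lt_succ_iff.1 (Finset.mem_range.1 hi)
        calc y ^ b = y ^ i * y ^ (b - i) := by rw [← pow_add, Nat.add_sub_cancel' hi']
          _ ≤ x ^ i * y ^ (b + 1 - 1 - i) := by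
            rw [Nat.add_sub_cancel]; gcongr
      rw [Finset.sum_const, Finset.card_range, nsmul_eq_mul] at h2
      rw [Nat.cast_succ] at h2
      refine le_trans (le_of_eq ?_) (mul_le_mul_of_nonneg_right h2 (sub_nonneg.2 hyx))
      ring
    have hf : (0 : ℝ) < b.factorial := by positivity
    rw [← sub_div, Nat.factorial_succ, le_div_iff₀ (by positivity)]
    push_cast
    refine le_trans (le_of_eq ?_) h1
    field_simp

/-- Summation of truncated powers raises the degree by one. -/
theorem abs_polyOp_zeta_truncPow_sub_le {b : ℕ} {M : ℕ} {u : ℝ}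
    (hM : u < Real.log (M + 1)) :
    |polyOp M zeta (truncPow b) u - truncPow (b + 1) u| ≤ truncPow b u := by
  have hstep : ∀ m : ℕ, 1 ≤ m → 0 ≤ Real.log ((m : ℝ) + 1) - Real.log m ∧
      Real.log ((m : ℝ) + 1) - Real.log m ≤ 1 / m ∧
      1 / ((m : ℝ) + 1) ≤ Real.log ((m : ℝ) + 1) - Real.log m := by
    intro m hm
    have hm0 : (0 : ℝ) < m := by exact_mod_cast hm
    rw [← Real.log_div (by positivity) (by positivity)]
    have e : ((m : ℝ) + 1) / m = 1 + 1 / m := by field_simp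
    refine ⟨Real.log_nonneg (by rw [e]; have : 0 < 1 / (m : ℝ) := by positivity
                                linarith), ?_, ?_⟩
    · have := Real.log_le_sub_one_of_pos (x := ((m : ℝ) + 1) / m) (by positivity)
      rw [e] at this ⊢
      linarith
    · have := Real.one_sub_inv_le_log_of_pos (x := ((m : ℝ) + 1) / m) (by positivity)
      refine le_trans (le_of_eq ?_) this
      field_simp
      ring
  have hsum : polyOp M zeta (truncPow b) u =
      ∑ m ∈ Finset.Icc 1 M, 1 / (m : ℝ) * truncPow b (u - Real.log m) :=
    Finset.sum_congr rfl fun m hm => by rw [zeta_cast_div hm]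
  have htel : ∑ m ∈ Finset.Icc 1 M, (truncPow (b + 1) (u - Real.log m) -
      truncPow (b + 1) (u - Real.log ((m : ℝ) + 1))) = truncPow (b + 1) u := by
    have h : ∀ K : ℕ, ∑ m ∈ Finset.Icc 1 K, (truncPow (b + 1) (u - Real.log m) -
      truncPow (b + 1) (u - Real.log ((m : ℝ) + 1))) =
      truncPow (b + 1) u - truncPow (b + 1) (u - Real.log ((K : ℝ) + 1)) := by
      intro K
      induction K with
      | zero => simp
      | succ K ih =>
        rw [Finset.sum_Icc_succ_top (by omega), ih]
        push_cast
        ring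
    rw [h M, truncPow_of_neg _ (sub_neg.2 hM), sub_zero]
  rw [hsum, abs_le]
  constructor
  · have h1 : truncPow (b + 1) u ≤
        ∑ m ∈ Finset.Icc 1 M, 1 / (m : ℝ) * truncPow b (u - Real.log m) := by
      rw [← htel]
      refine Finset.sum_le_sum fun m hm => ?_
      have hs := hstep m (Finset.mem_Icc.1 hm).1
      refine (truncPow_succ_sub_le b (by linarith)).trans ?_
      refine mul_le_mul_of_nonneg_right (by linarith) (truncPow_nonneg _ _)
    linarith [truncPow_nonneg b u]
  · -- shift the summation by one to compare with the lower mean value bound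
    have h1 : ∑ m ∈ Finset.Icc 1 M, 1 / ((m : ℝ) + 1) * truncPow b (u - Real.log ((m : ℝ) + 1)) ≤
        truncPow (b + 1) u := by
      rw [← htel]
      refine Finset.sum_le_sum fun m hm => ?_
      have hs := hstep m (Finset.mem_Icc.1 hm).1
      refine le_trans ?_ (le_truncPow_succ_sub b (by linarith))
      refine mul_le_mul_of_nonneg_right (by linarith) (truncPow_nonneg _ _)
    have h2 : ∀ K : ℕ, ∑ m ∈ Finset.Icc 1 K, 1 / (m : ℝ) * truncPow b (u - Real.log m) ≤
        truncPow b u + ∑ m ∈ Finset.Icc 1 K,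
          1 / ((m : ℝ) + 1) * truncPow b (u - Real.log ((m : ℝ) + 1)) := by
      intro K
      have h3 : ∑ m ∈ Finset.Icc 1 K, 1 / (m : ℝ) * truncPow b (u - Real.log m) +
          1 / ((K : ℝ) + 1) * truncPow b (u - Real.log ((K : ℝ) + 1)) =
          truncPow b u + ∑ m ∈ Finset.Icc 1 K,
          1 / ((m : ℝ) + 1) * truncPow b (u - Real.log ((m : ℝ) + 1)) := by
        induction K with
        | zero => simp
        | succ K ih =>
          rw [Finset.sum_Icc_succ_top (by omega), Finset.sum_Icc_succ_top (by omega), ← add_assoc,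
            ← ih]
          push_cast
          ring
      have : 0 ≤ 1 / ((K : ℝ) + 1) * truncPow b (u - Real.log ((K : ℝ) + 1)) :=
        mul_nonneg (by positivity) (truncPow_nonneg _ _)
      linarith
    linarith [h2 M]

theorem truncPow_le (a : ℕ) {u L : ℝ} (hL : 0 ≤ L) (hu : u ≤ L) : truncPow a u ≤ (1 + L) ^ a := by
  rcases lt_or_ge u 0 with h | h
  · rw [truncPow_of_neg a h]; positivity
  · rw [truncPow_of_nonneg a h]
    refine (div_le_self (by positivity)
      (by exact_mod_cast (Nat.factorial_pos a : 1 ≤ a.factorial))).trans ?_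
    gcongr
    linarith

theorem polyOp_sub (M : ℕ) (f : ArithmeticFunction ℤ) (φ ψ : ℝ → ℝ) (u : ℝ) :
    polyOp M f (fun v => φ v - ψ v) u = polyOp M f φ u - polyOp M f ψ u := by
  simp only [polyOp, mul_sub, Finset.sum_sub_distrib]

theorem polyOp_one {M : ℕ} (hM : 1 ≤ M) (φ : ℝ → ℝ) (u : ℝ) : polyOp M 1 φ u = φ u := by
  rw [polyOp, Finset.sum_eq_single 1]
  · simp
  · intro m _ hm
    rw [ArithmeticFunction.one_apply_ne hm]; simp
  · intro h
    exact absurd (Finset.mem_Icc.2 ⟨le_rfl, hM⟩) h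

theorem abs_polyOp_zeta_pow_truncPow_sub_le {b : ℕ} (k : ℕ) {L : ℝ≥0} {M : ℕ}
    (hM : (L : ℝ) < Real.log (M + 1)) (hM' : Real.log M ≤ L) {u : ℝ} (hu : u ≤ L) :
    |polyOp M (zeta ^ k) (truncPow (b + 1)) u - truncPow (b + 1 + k) u| ≤
      k * (1 + L) ^ (b + k) := by
  have hL : (0 : ℝ) ≤ L := L.2
  induction k generalizing u with
  | zero => rw [pow_zero, polyOp_one (one_le_of_lt_log hM)]; simp
  | succ k ih =>
    rw [pow_succ', polyOp_mul hM (fun _ => truncPow_of_neg _) _ _ hu]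
    have h1 : |polyOp M zeta (polyOp M (zeta ^ k) (truncPow (b + 1))) u -
        polyOp M zeta (truncPow (b + 1 + k)) u| ≤ (1 + L) * (k * (1 + L) ^ (b + k)) := by
      rw [← polyOp_sub]
      exact polyOp_zeta_const_le hM' (by positivity) fun v hv => ih (hv.trans hu)
    have h2 := abs_polyOp_zeta_truncPow_sub_le (b := b + 1 + k) (hu.trans_lt hM)
    have h3 := truncPow_le (b + 1 + k) hL hu
    rw [show b + 1 + (k + 1) = b + 1 + k + 1 by ring]
    calc _ ≤ _ := abs_sub_le _ (polyOp M zeta (truncPow (b + 1 + k)) u) _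
      _ ≤ (1 + L) * (k * (1 + L) ^ (b + k)) + (1 + L) ^ (b + 1 + k) :=
        add_le_add h1 (h2.trans h3)
      _ = _ := by push_cast; ring

end SmallGaps

/-! ### The comparison operator -/

namespace SmallGaps

open scoped NNReal
open ArithmeticFunction (moebius zeta)

theorem truncPow_sq (ℓ : ℕ) (u : ℝ) :
    truncPow ℓ u * truncPow ℓ u = ((2 * ℓ).choose ℓ : ℝ) * truncPow (2 * ℓ) u := by
  rcases lt_or_ge u 0 with h | h
  · simp [truncPow_of_neg _ h]
  · rw [truncPow_of_nonneg _ h, truncPow_of_nonneg _ h]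
    have h1 := Nat.choose_mul_factorial_mul_factorial (n := 2 * ℓ) (k := ℓ) (by omega)
    rw [show 2 * ℓ - ℓ = ℓ by omega] at h1
    have h2 : ((2 * ℓ).choose ℓ : ℝ) * ℓ.factorial * ℓ.factorial = ((2 * ℓ).factorial : ℝ) := by
      exact_mod_cast h1
    have h3 : (ℓ.factorial : ℝ) ≠ 0 := by positivity
    have h4 : ((2 * ℓ).factorial : ℝ) ≠ 0 := by positivity
    field_simp
    rw [← h2]
    ring

/-- The comparison operator `ζ(1 + s + t) ^ k / (ζ(1 + s) ^ k ζ(1 + t) ^ k)` as a Dirichlet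
polynomial. -/
noncomputable def modelPoly (M k : ℕ) : DirAlg :=
  dirPoly (1, 1) M (zeta ^ k) * (dirPoly (1, 0) M (moebius ^ k) * dirPoly (0, 1) M (moebius ^ k))

/-- The comparison operator applied to the product of truncated powers. The factors `ζ ^ (-k)` turn
both truncated powers of degree `k + ℓ` into ones of degree `ℓ`, and `ζ(1 + s + t) ^ k` integrates
their product `k` times along the diagonal. Away from the corner the error grows linearly with the
distance to the corner. -/
theorem exists_abs_act_modelPoly_sub_le (k : ℕ) {ℓ : ℕ} (hℓ : 0 < ℓ) :
    ∃ C : ℝ, 0 < C ∧ ∀ (L : ℝ≥0) (M : ℕ), (L : ℝ) < Real.log (M + 1) → Real.log M ≤ L →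
      ∀ z : Box L,
        |act L (modelPoly M k) (tens L (truncPow (k + ℓ)) (truncPow (k + ℓ))) z -
            ((2 * ℓ).choose ℓ : ℝ) * truncPow (k + 2 * ℓ) L| ≤
          C * (1 + L) ^ (k + 2 * ℓ - 1) * (1 + Real.log (1 + L)) *
            (1 + ((L - z.1.1) + (L - z.1.2))) := by
  obtain ⟨C, hC, hY⟩ := exists_sum_moebius_pow_sub_le k hℓ
  obtain ⟨b, rfl⟩ : ∃ b, ℓ = b + 1 := ⟨ℓ - 1, by omega⟩
  set χ : ℝ := ((2 * (b + 1)).choose (b + 1) : ℝ) with hχ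
  have hχ0 : 0 ≤ χ := Nat.cast_nonneg _
  refine ⟨(C + 1) * (2 * C + 1) + χ * k, by positivity, fun L M hM hM' z => ?_⟩
  have hL : (0 : ℝ) ≤ L := L.2
  set Λ : ℝ := 1 + Real.log (1 + L) with hΛ
  have hΛ1 : 1 ≤ Λ := by
    have := Real.log_nonneg (x := 1 + (L : ℝ)) (by linarith)
    linarith
  have hΛL : Λ ≤ 1 + L := by
    have := Real.log_le_sub_one_of_pos (x := 1 + (L : ℝ)) (by linarith)
    linarith
  set e := truncPow (b + 1) with he
  set Y := polyOp M (moebius ^ k) (truncPow (k + (b + 1))) with hYdef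
  have hneg : ∀ u < 0, truncPow (k + (b + 1)) u = 0 := fun _ => truncPow_of_neg _
  have hYneg : ∀ u < 0, Y u = 0 := polyOp_of_neg hneg _ _
  have hYe : ∀ u ≤ (L : ℝ), |Y u - e u| ≤ C * (1 + L) ^ b * Λ := by
    intro u hu
    rcases lt_or_ge u 0 with h | h
    · rw [hYneg u h, he, truncPow_of_neg _ h, sub_zero, abs_zero]
      positivity
    · refine (hY u h M (hu.trans_lt hM)).trans ?_
      rw [Nat.add_sub_cancel, hΛ]
      have := Real.log_le_log (x := 1 + u) (y := 1 + L) (by linarith) (by linarith)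
      have := Real.log_nonneg (x := 1 + u) (by linarith)
      gcongr
  have hact : act L (modelPoly M k) (tens L (truncPow (k + (b + 1))) (truncPow (k + (b + 1)))) z =
      ∑ m ∈ Finset.Icc 1 M, ((((zeta : ArithmeticFunction ℤ) ^ k) m : ℤ) : ℝ) / m *
        (Y (z.1.1 - Real.log m) * Y (z.1.2 - Real.log m)) := by
    rw [modelPoly, map_mul, map_mul, Module.End.mul_apply, Module.End.mul_apply,
      act_dirPoly_snd hneg hneg, act_dirPoly_fst hneg (polyOp_of_neg hneg _ _),
      act_dirPoly_tens hYneg hYneg]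
    simp
  have hmodel : χ * polyOp M (zeta ^ k) (truncPow (2 * (b + 1))) L =
      ∑ m ∈ Finset.Icc 1 M, ((((zeta : ArithmeticFunction ℤ) ^ k) m : ℤ) : ℝ) / m *
        (e (L - Real.log m) * e (L - Real.log m)) := by
    rw [polyOp, Finset.mul_sum]
    refine Finset.sum_congr rfl fun m _ => ?_
    rw [he, truncPow_sq]
    ring
  set u : ℝ := ((z.1.1 : ℝ≥0) : ℝ) with hu
  set v : ℝ := ((z.1.2 : ℝ≥0) : ℝ) with hv
  have huL : u ≤ L := by exact_mod_cast z.2.1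
  have hvL : v ≤ L := by exact_mod_cast z.2.2
  have hdiff : ∀ t : ℝ, 0 ≤ t → ∀ u ≤ (L : ℝ), |Y (u - t) - e (L - t)| ≤
      (1 + L) ^ b * (C * Λ + (L - u)) := by
    intro t ht u hu
    have h1 := hYe (u - t) (by linarith)
    have h2 := truncPow_succ_sub_le b (x := L - t) (y := u - t) (by linarith)
    have h3 := le_truncPow_succ_sub b (x := L - t) (y := u - t) (by linarith)
    have h4 := truncPow_le b hL (u := L - t) (by linarith)
    have h5 : 0 ≤ (L - t - (u - t)) * truncPow b (u - t) :=
      mul_nonneg (by linarith) (truncPow_nonneg _ _)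
    have h6 : (L - t - (u - t)) * truncPow b (L - t) ≤ (L - u) * (1 + L) ^ b := by
      rw [sub_sub_sub_cancel_right]
      exact mul_le_mul_of_nonneg_left h4 (by linarith)
    have h7 : |e (u - t) - e (L - t)| ≤ (L - u) * (1 + L) ^ b := by
      rw [abs_sub_comm, abs_of_nonneg (by linarith)]
      linarith
    calc _ ≤ _ := abs_sub_le _ (e (u - t)) _
      _ ≤ C * (1 + L) ^ b * Λ + (L - u) * (1 + L) ^ b := add_le_add h1 h7
      _ = _ := by ring
  have hpt : ∀ t : ℝ, 0 ≤ t → |Y (u - t) * Y (v - t) - e (L - t) * e (L - t)| ≤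
      (C + 1) * (2 * C + 1) * (1 + L) ^ (2 * b + 1) * Λ * (1 + ((L - u) + (L - v))) := by
    intro t ht
    have h1 := hdiff t ht u huL
    have h2 := hdiff t ht v hvL
    have h3 : |e (L - t)| ≤ (1 + L) ^ (b + 1) := by
      rw [abs_of_nonneg (truncPow_nonneg _ _)]
      exact truncPow_le (b + 1) hL (by linarith)
    have h4 : |Y (v - t)| ≤ (C + 1) * (1 + L) ^ (b + 1) := by
      have h5 := hYe (v - t) (by linarith)
      have h6 : |e (v - t)| ≤ (1 + L) ^ (b + 1) := by
        rw [abs_of_nonneg (truncPow_nonneg _ _)]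
        exact truncPow_le (b + 1) hL (by linarith)
      have h7 : C * (1 + L) ^ b * Λ ≤ C * (1 + L) ^ (b + 1) := by
        rw [pow_succ, ← mul_assoc]
        gcongr
      have h8 : |Y (v - t)| ≤ |Y (v - t) - e (v - t)| + |e (v - t)| := by
        simpa using abs_add_le (Y (v - t) - e (v - t)) (e (v - t))
      linarith
    have e1 : Y (u - t) * Y (v - t) - e (L - t) * e (L - t) =
        (Y (u - t) - e (L - t)) * Y (v - t) + e (L - t) * (Y (v - t) - e (L - t)) := by ring
    have hp : (0 : ℝ) < (1 + L) ^ b := by positivity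
    have hu0 : 0 ≤ (L : ℝ) - u := by linarith
    have hv0 : 0 ≤ (L : ℝ) - v := by linarith
    calc _ ≤ |(Y (u - t) - e (L - t)) * Y (v - t)| + |e (L - t) * (Y (v - t) - e (L - t))| := by
          rw [e1]; exact abs_add_le _ _
      _ ≤ ((1 + L) ^ b * (C * Λ + (L - u))) * ((C + 1) * (1 + L) ^ (b + 1)) +
          (1 + L) ^ (b + 1) * ((1 + L) ^ b * (C * Λ + (L - v))) := by
          rw [abs_mul, abs_mul]
          gcongr
      _ ≤ ((1 + L) ^ b * (C * Λ + (L - u))) * ((C + 1) * (1 + L) ^ (b + 1)) +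
          ((C + 1) * (1 + L) ^ (b + 1)) * ((1 + L) ^ b * (C * Λ + (L - v))) := by
          gcongr
          exact le_mul_of_one_le_left (by positivity) (by linarith)
      _ = (C + 1) * (1 + L) ^ (2 * b + 1) * (2 * C * Λ + ((L - u) + (L - v))) := by
          ring
      _ ≤ (C + 1) * (1 + L) ^ (2 * b + 1) *
          ((2 * C + 1) * Λ * (1 + ((L - u) + (L - v)))) := by
          refine mul_le_mul_of_nonneg_left ?_ (by positivity)
          have hw : 0 ≤ (L - u) + (L - v) := by linarith
          have h9 : (L - u) + (L - v) ≤ Λ * ((L - u) + (L - v)) := le_mul_of_one_le_left hw hΛ1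
          have h10 : 0 ≤ 2 * C * Λ * ((L - u) + (L - v)) := by positivity
          nlinarith
      _ = _ := by ring
  have hz := sum_zeta_pow_le hM hM' k
  have hfirst :
      |act L (modelPoly M k) (tens L (truncPow (k + (b + 1))) (truncPow (k + (b + 1)))) z -
      χ * polyOp M (zeta ^ k) (truncPow (2 * (b + 1))) L| ≤
      (1 + L) ^ k * ((C + 1) * (2 * C + 1) * (1 + L) ^ (2 * b + 1) * Λ *
        (1 + ((L - u) + (L - v)))) := by
    rw [hact, hmodel, ← Finset.sum_sub_distrib]
    refine (Finset.abs_sum_le_sum_abs _ _).trans (le_trans (Finset.sum_le_sum fun m _ => ?_)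
      ((Finset.sum_mul _ _ _).symm.le.trans (mul_le_mul_of_nonneg_right hz ?_)))
    · rw [← mul_sub, abs_mul]
      have h0 : (0 : ℝ) ≤ ((((zeta : ArithmeticFunction ℤ) ^ k) m : ℤ) : ℝ) / m :=
        div_nonneg (by exact_mod_cast zeta_pow_nonneg k m) (Nat.cast_nonneg m)
      rw [abs_of_nonneg h0]
      exact mul_le_mul_of_nonneg_left (hpt _ (Real.log_natCast_nonneg m)) h0
    · have : 0 ≤ (L - u) + (L - v) := by linarith
      positivity
  have hsecond : |χ * polyOp M (zeta ^ k) (truncPow (2 * (b + 1))) L -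
      χ * truncPow (k + 2 * (b + 1)) L| ≤ χ * (k * (1 + L) ^ (2 * b + 1 + k)) := by
    rw [← mul_sub, abs_mul, abs_of_nonneg hχ0]
    refine mul_le_mul_of_nonneg_left ?_ hχ0
    have := abs_polyOp_zeta_pow_truncPow_sub_le (b := 2 * b + 1) k hM hM' (le_refl (L : ℝ))
    rw [show k + 2 * (b + 1) = 2 * b + 1 + 1 + k by ring]
    exact this
  rw [show k + 2 * (b + 1) - 1 = 2 * b + 1 + k by omega]
  have hw : 0 ≤ (L - u) + (L - v) := by linarith
  calc _ ≤ _ := abs_sub_le _ (χ * polyOp M (zeta ^ k) (truncPow (2 * (b + 1))) L) _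
    _ ≤ _ := add_le_add hfirst hsecond
    _ ≤ (1 + L) ^ k * ((C + 1) * (2 * C + 1) * (1 + L) ^ (2 * b + 1) * Λ *
        (1 + ((L - u) + (L - v)))) + χ * (k * (1 + L) ^ (2 * b + 1 + k)) *
          (Λ * (1 + ((L - u) + (L - v)))) := by
        refine add_le_add le_rfl (le_mul_of_one_le_right (by positivity) ?_)
        nlinarith
    _ = _ := by ring

end SmallGaps

/-! ### Factorisation of the Euler product of the sieve sum -/

namespace SmallGaps

open scoped NNReal
open ArithmeticFunction (moebius zeta)

/-- The variable `p ^ (-s)` attached to the prime `p` and the direction `θ`, divided by `p`. -/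
noncomputable def pvar (θ : ℝ≥0 × ℝ≥0) (p : ℕ) : DirAlg :=
  AddMonoidAlgebra.single (ln p • θ) (1 / (p : ℝ))

/-- The Euler factor `1 - r (X + Y - X Y)` of the sieve sum, `r` being the number of residue classes
modulo `p`. -/
noncomputable def sieveFactor (r : ℝ) (p : ℕ) : DirAlg :=
  1 - r • (pvar (1, 0) p + pvar (0, 1) p - pvar (1, 1) p)

/-- The quotient of the Euler factors of the sieve sum and of the model, the geometric series being
truncated after `J` terms to remain a polynomial. -/
noncomputable def localQuot (k J : ℕ) (r : ℝ) (p : ℕ) : DirAlg :=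
  sieveFactor r p * ((1 - pvar (1, 1) p) ^ k * ((∑ j ∈ Finset.range J, pvar (1, 0) p ^ j) ^ k *
    (∑ j ∈ Finset.range J, pvar (0, 1) p ^ j) ^ k))

theorem pvar_pow (θ : ℝ≥0 × ℝ≥0) (p J : ℕ) :
    pvar θ p ^ J = AddMonoidAlgebra.single (J • (ln p • θ)) ((1 / (p : ℝ)) ^ J) := by
  rw [pvar, AddMonoidAlgebra.single_pow]

theorem act_pvar_pow_eq_zero {L : ℝ≥0} {θ : ℝ≥0 × ℝ≥0} (hθ : IsDir θ) {p J : ℕ} (hp : p.Prime)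
    (hJ : (L : ℝ) < J * Real.log 2) : act L (pvar θ p ^ J) = 0 := by
  rw [pvar_pow, act_single, shift_eq_zero, smul_zero]
  have h2 : Real.log 2 ≤ Real.log p :=
    Real.log_le_log (by norm_num) (by exact_mod_cast hp.two_le)
  have h3 : (L : ℝ) < J * Real.log p := hJ.trans_le (by gcongr)
  have h4 : L < J * ln p := by
    have : (L : ℝ) < ((J * ln p : ℝ≥0) : ℝ) := by push_cast; exact h3
    exact_mod_cast this
  intro hle
  rcases hθ with h | h
  · have h5 : J • (ln p * θ.1) ≤ L := hle.1
    rw [nsmul_eq_mul, ← mul_assoc] at h5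
    exact absurd ((le_mul_of_one_le_right' h).trans h5) (not_le.2 h4)
  · have h5 : J • (ln p * θ.2) ≤ L := hle.2
    rw [nsmul_eq_mul, ← mul_assoc] at h5
    exact absurd ((le_mul_of_one_le_right' h).trans h5) (not_le.2 h4)

theorem act_prod_eq_one {L : ℝ≥0} {s : Finset ℕ} {a : ℕ → DirAlg}
    (h : ∀ p ∈ s, act L (a p) = 1) : act L (∏ p ∈ s, a p) = 1 := by
  induction s using Finset.induction_on with
  | empty => rw [Finset.prod_empty, map_one]
  | insert p s hp ih =>
    rw [Finset.prod_insert hp, map_mul, h p (Finset.mem_insert_self p s),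
      ih fun q hq => h q (Finset.mem_insert_of_mem hq), one_mul]

/-- The truncated geometric series inverts the Euler product of `μ`, since `J` factors `p` translate
out of the box. -/
theorem act_geom_eq_one {L : ℝ≥0} {θ : ℝ≥0 × ℝ≥0} (hθ : IsDir θ) {M : ℕ}
    (hM : (L : ℝ) < Real.log (M + 1)) {J : ℕ} (hJ : (L : ℝ) < J * Real.log 2) (k : ℕ) :
    act L ((∏ p ∈ primesUpTo M, ∑ j ∈ Finset.range J, pvar θ p ^ j) ^ k *
      dirPoly θ M (moebius ^ k)) = 1 := by
  have h1 : act L (∏ p ∈ primesUpTo M, ∑ j ∈ Finset.range J, pvar θ p ^ j) *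
      act L (dirPoly θ M moebius) = 1 := by
    rw [← act_prod_one_sub hθ hM, ← map_mul, ← Finset.prod_mul_distrib]
    refine act_prod_eq_one fun p hp => ?_
    have : (∑ j ∈ Finset.range J, pvar θ p ^ j) * (1 - pvar θ p) = 1 - pvar θ p ^ J :=
      geom_sum_mul_neg _ _
    rw [pvar] at this ⊢
    rw [this, map_sub, map_one, ← pvar, act_pvar_pow_eq_zero hθ (mem_primesUpTo.1 hp).1 hJ,
      sub_zero]
  rw [map_mul, act_dirPoly_pow hθ hM, ← map_pow, ← map_mul, ← mul_pow, map_pow, map_mul, h1,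
    one_pow]

theorem act_moebius_zeta_eq_one {L : ℝ≥0} {θ : ℝ≥0 × ℝ≥0} (hθ : IsDir θ) {M : ℕ}
    (hM : (L : ℝ) < Real.log (M + 1)) (k : ℕ) :
    act L ((∏ p ∈ primesUpTo M, (1 - pvar θ p)) ^ k * dirPoly θ M (zeta ^ k)) = 1 := by
  have h1 : act L (∏ p ∈ primesUpTo M, (1 - pvar θ p)) * act L (dirPoly θ M zeta) = 1 := by
    have h : act L (∏ p ∈ primesUpTo M, (1 - pvar θ p)) = act L (dirPoly θ M moebius) :=
      act_prod_one_sub hθ hM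
    rw [h, act_dirPoly_moebius_mul_zeta hθ hM]
  rw [map_mul, act_dirPoly_pow hθ hM, ← map_pow, ← map_mul, ← mul_pow, map_pow, map_mul, h1,
    one_pow]

/-- On the box, the Euler product of the sieve sum is the model times the local quotients. -/
theorem act_prod_sieveFactor {L : ℝ≥0} {M : ℕ} (hM : (L : ℝ) < Real.log (M + 1)) {J : ℕ}
    (hJ : (L : ℝ) < J * Real.log 2) (k : ℕ) (r : ℕ → ℝ) :
    act L (∏ p ∈ primesUpTo M, sieveFactor (r p) p) =
      act L (∏ p ∈ primesUpTo M, localQuot k J (r p) p) * act L (modelPoly M k) := by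
  have h1 := act_geom_eq_one (θ := (1, 0)) (Or.inl le_rfl) hM hJ k
  have h2 := act_geom_eq_one (θ := (0, 1)) (Or.inr le_rfl) hM hJ k
  have h3 := act_moebius_zeta_eq_one (θ := (1, 1)) (Or.inl le_rfl) hM k
  rw [← map_mul]
  simp only [localQuot, Finset.prod_mul_distrib, Finset.prod_pow, modelPoly]
  set W := ∏ p ∈ primesUpTo M, sieveFactor (r p) p
  set A := (∏ p ∈ primesUpTo M, (1 - pvar (1, 1) p)) ^ k
  set B := (∏ p ∈ primesUpTo M, ∑ j ∈ Finset.range J, pvar (1, 0) p ^ j) ^ k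
  set D := (∏ p ∈ primesUpTo M, ∑ j ∈ Finset.range J, pvar (0, 1) p ^ j) ^ k
  have e : W * (A * (B * D)) * (dirPoly (1, 1) M (zeta ^ k) *
      (dirPoly (1, 0) M (moebius ^ k) * dirPoly (0, 1) M (moebius ^ k))) =
      W * (A * dirPoly (1, 1) M (zeta ^ k)) * (B * dirPoly (1, 0) M (moebius ^ k)) *
        (D * dirPoly (0, 1) M (moebius ^ k)) := by ring
  rw [e, map_mul, map_mul, map_mul, h1, h2, h3, mul_one, mul_one, mul_one]

theorem aug_pvar (θ : ℝ≥0 × ℝ≥0) (p : ℕ) : aug (pvar θ p) = 1 / (p : ℝ) := aug_single _ _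

theorem aug_localQuot (k J : ℕ) (r : ℝ) (p : ℕ) :
    aug (localQuot k J r p) = (1 - r / p) * ((1 - 1 / (p : ℝ)) ^ k *
      ((∑ j ∈ Finset.range J, (1 / (p : ℝ)) ^ j) ^ k *
        (∑ j ∈ Finset.range J, (1 / (p : ℝ)) ^ j) ^ k)) := by
  simp only [localQuot, sieveFactor, map_mul, map_sub, map_one, map_smul, map_add, map_pow, map_sum,
    aug_pvar, smul_eq_mul]
  ring

open Filter Topology in
/-- As the truncation of the geometric series is lifted, the sum of the coefficients of the local
quotient tends to the Euler factor of the singular series. -/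
theorem tendsto_aug_localQuot (k : ℕ) (r : ℝ) {p : ℕ} (hp : p.Prime) :
    Tendsto (fun J => aug (localQuot k J r p)) atTop
      (𝓝 ((1 - r / p) * ((1 - 1 / (p : ℝ)) ^ k)⁻¹)) := by
  have hp2 : (2 : ℝ) ≤ p := by exact_mod_cast hp.two_le
  have hx1 : 1 / (p : ℝ) < 1 := by rw [div_lt_one (by linarith)]; linarith
  have h := (hasSum_geometric_of_lt_one (by positivity : 0 ≤ 1 / (p : ℝ)) hx1).tendsto_sum_nat
  have h2 := (((h.pow k).mul (h.pow k)).const_mul ((1 - 1 / (p : ℝ)) ^ k)).const_mul (1 - r / p)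
  refine (h2.congr fun J => (aug_localQuot k J r p).symm).trans (le_of_eq ?_)
  have : (1 - 1 / (p : ℝ)) ^ k ≠ 0 := pow_ne_zero _ (by linarith)
  rw [inv_pow, mul_inv_cancel_left₀ this]

/-- In the norm `wnorm δ`, `a` is `1 + A` up to an error `C * ε ^ 2`, and `A` is at most
`C * ε`. -/
def NearOne (δ ε C : ℝ) (a A : DirAlg) : Prop :=
  wnorm δ A ≤ C * ε ∧ wnorm δ (a - 1 - A) ≤ C * ε ^ 2

theorem NearOne.wnorm_le {δ ε C : ℝ} {a A : DirAlg} (h : NearOne δ ε C a A) :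
    wnorm δ a ≤ 1 + C * ε + C * ε ^ 2 := by
  have e : a = 1 + A + (a - 1 - A) := by ring
  rw [e]
  have h1 := wnorm_add_le δ (1 + A) (a - 1 - A)
  have h2 := wnorm_add_le δ 1 A
  rw [wnorm_one] at h2
  linarith [h.1, h.2]

theorem NearOne.mul {δ ε C D : ℝ} (hε : 0 ≤ ε) (hε1 : ε ≤ 1) (hC : 0 ≤ C) (hD : 0 ≤ D)
    {a A b B : DirAlg} (ha : NearOne δ ε C a A) (hb : NearOne δ ε D b B) :
    NearOne δ ε (C + D + 4 * (C * D)) (a * b) (A + B) := by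
  have hε2 : ε ^ 2 ≤ 1 := pow_le_one₀ hε hε1
  have hbn : wnorm δ b ≤ 1 + 2 * D := by
    refine hb.wnorm_le.trans ?_
    nlinarith
  have hA1 : wnorm δ (1 + A) ≤ 1 + C := by
    refine (wnorm_add_le _ _ _).trans ?_
    rw [wnorm_one]
    have := ha.1
    nlinarith
  constructor
  · refine (wnorm_add_le _ _ _).trans ((add_le_add ha.1 hb.1).trans ?_)
    have : 0 ≤ 4 * (C * D) * ε := by positivity
    linarith
  · have e : a * b - 1 - (A + B) = (a - 1 - A) * b + (1 + A) * (b - 1 - B) + A * B := by ring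
    rw [e]
    calc _ ≤ wnorm δ ((a - 1 - A) * b) + wnorm δ ((1 + A) * (b - 1 - B)) + wnorm δ (A * B) :=
          (wnorm_add_le _ _ _).trans (add_le_add (wnorm_add_le _ _ _) le_rfl)
      _ ≤ (C * ε ^ 2) * (1 + 2 * D) + (1 + C) * (D * ε ^ 2) + (C * ε) * (D * ε) := by
          refine add_le_add (add_le_add ?_ ?_) ?_
          · exact (wnorm_mul_le _ _ _).trans
              (mul_le_mul ha.2 hbn (wnorm_nonneg _ _) (by positivity))
          · exact (wnorm_mul_le _ _ _).trans
              (mul_le_mul hA1 hb.2 (wnorm_nonneg _ _) (by positivity))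
          · exact (wnorm_mul_le _ _ _).trans
              (mul_le_mul ha.1 hb.1 (wnorm_nonneg _ _) (by positivity))
      _ = _ := by ring

/-- The constant of `NearOne` for `k`-th powers. -/
noncomputable def nearPow (C : ℝ) : ℕ → ℝ
  | 0 => 0
  | k + 1 => nearPow C k + C + 4 * (nearPow C k * C)

theorem nearPow_nonneg {C : ℝ} (hC : 0 ≤ C) (k : ℕ) : 0 ≤ nearPow C k := by
  induction k with
  | zero => exact le_rfl
  | succ k ih => unfold nearPow; positivity

theorem NearOne.pow {δ ε C : ℝ} (hε : 0 ≤ ε) (hε1 : ε ≤ 1) (hC : 0 ≤ C) {a A : DirAlg}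
    (ha : NearOne δ ε C a A) (k : ℕ) : NearOne δ ε (nearPow C k) (a ^ k) ((k : ℝ) • A) := by
  induction k with
  | zero => simp [NearOne, nearPow, wnorm_zero]
  | succ k ih =>
    have := NearOne.mul hε hε1 (nearPow_nonneg hC k) hC ih ha
    rw [pow_succ, Nat.cast_succ, add_smul, one_smul]
    exact this

/-- The bound `p ^ (2 * δ - 1)` for the norms `wnorm δ` of the variables at the prime `p`. -/
noncomputable def psize (δ : ℝ) (p : ℕ) : ℝ := Real.exp (2 * δ * Real.log p) / p

theorem psize_nonneg (δ : ℝ) (p : ℕ) : 0 ≤ psize δ p := by unfold psize; positivity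

theorem psize_eq_rpow (δ : ℝ) {p : ℕ} (hp : p.Prime) : psize δ p = (p : ℝ) ^ (2 * δ - 1) := by
  have hp0 : (0 : ℝ) < p := by exact_mod_cast hp.pos
  rw [psize, Real.rpow_sub hp0, Real.rpow_one, Real.rpow_def_of_pos hp0, mul_comm (Real.log _)]

theorem psize_le {δ : ℝ} (hδ1 : δ ≤ 1 / 8) {p : ℕ} (hp : p.Prime) : psize δ p ≤ 3 / 4 := by
  have hp2 : (2 : ℝ) ≤ p := by exact_mod_cast hp.two_le
  rw [psize_eq_rpow δ hp]
  calc (p : ℝ) ^ (2 * δ - 1) ≤ (p : ℝ) ^ (-(1 / 2) : ℝ) :=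
        Real.rpow_le_rpow_of_exponent_le (by linarith) (by linarith)
    _ ≤ 2 ^ (-(1 / 2) : ℝ) := Real.rpow_le_rpow_of_nonpos (by norm_num) hp2 (by norm_num)
    _ ≤ 3 / 4 := by
      rw [Real.rpow_neg (by norm_num), ← Real.sqrt_eq_rpow,
        inv_le_comm₀ (by positivity) (by norm_num)]
      apply Real.le_sqrt_of_sq_le
      norm_num

theorem wnorm_pvar_le {δ : ℝ} (hδ : 0 ≤ δ) {θ : ℝ≥0 × ℝ≥0} (h1 : θ.1 ≤ 1) (h2 : θ.2 ≤ 1) (p : ℕ) :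
    wnorm δ (pvar θ p) ≤ psize δ p := by
  rw [pvar, wnorm_single, psize, abs_of_nonneg (by positivity), div_mul_eq_mul_div, one_mul]
  gcongr ?_ / _
  apply Real.exp_le_exp.2
  have hl : 0 ≤ Real.log p := Real.log_natCast_nonneg p
  simp only [Prod.smul_fst, Prod.smul_snd, smul_eq_mul, NNReal.coe_mul, coe_ln]
  have h1' : (θ.1 : ℝ) ≤ 1 := by exact_mod_cast h1
  have h2' : (θ.2 : ℝ) ≤ 1 := by exact_mod_cast h2
  calc δ * (Real.log p * θ.1 + Real.log p * θ.2) ≤ δ * (Real.log p * 1 + Real.log p * 1) := by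
        gcongr
    _ = _ := by ring

theorem nearOne_geom {δ ε : ℝ} (hε : 0 ≤ ε) (hε1 : ε ≤ 3 / 4) {a : DirAlg} (ha : wnorm δ a ≤ ε)
    {J : ℕ} (hJ : 2 ≤ J) : NearOne δ ε 4 (∑ j ∈ Finset.range J, a ^ j) a := by
  obtain ⟨I, rfl⟩ : ∃ I, J = I + 2 := ⟨J - 2, by omega⟩
  refine ⟨by linarith, ?_⟩
  have e : ∑ j ∈ Finset.range (I + 2), a ^ j - 1 - a = a ^ 2 * ∑ j ∈ Finset.range I, a ^ j := by
    rw [Finset.sum_range_succ', Finset.sum_range_succ', Finset.mul_sum]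
    rw [Finset.sum_congr rfl fun j _ => show a ^ (j + 1 + 1) = a ^ 2 * a ^ j by ring]
    ring
  rw [e]
  have h1 : wnorm δ (∑ j ∈ Finset.range I, a ^ j) ≤ 4 := by
    calc _ ≤ ∑ j ∈ Finset.range I, wnorm δ (a ^ j) := wnorm_sum_le _ _ _
      _ ≤ ∑ j ∈ Finset.range I, ε ^ j := Finset.sum_le_sum fun j _ =>
          (wnorm_pow_le _ _ _).trans (pow_le_pow_left₀ (wnorm_nonneg _ _) ha j)
      _ ≤ (1 - ε)⁻¹ := by
          rw [← tsum_geometric_of_lt_one hε (by linarith)]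
          exact (summable_geometric_of_lt_one hε (by linarith)).sum_le_tsum _
            fun j _ => pow_nonneg hε j
      _ ≤ 4 := by
          rw [inv_le_comm₀ (by linarith) (by norm_num)]; linarith
  have h2 : wnorm δ (a ^ 2) ≤ ε ^ 2 :=
    (wnorm_pow_le _ _ _).trans (pow_le_pow_left₀ (wnorm_nonneg _ _) ha 2)
  calc _ ≤ ε ^ 2 * 4 := (wnorm_mul_le _ _ _).trans
        (mul_le_mul h2 h1 (wnorm_nonneg _ _) (by positivity))
    _ = _ := by ring

/-- The local quotient is `1` up to quadratic terms, except for the defect `k - r` in the number of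
residue classes. -/
theorem exists_nearOne_localQuot (k : ℕ) : ∃ C : ℝ, 0 < C ∧ ∀ (δ r : ℝ) (p J : ℕ), 0 ≤ δ →
    δ ≤ 1 / 8 → 0 ≤ r → r ≤ k → p.Prime → 2 ≤ J →
    NearOne δ (psize δ p) C (localQuot k J r p)
      ((k - r) • (pvar (1, 0) p + pvar (0, 1) p - pvar (1, 1) p)) := by
  set C1 : ℝ := 3 * k with hC1
  set C2 : ℝ := nearPow 1 k with hC2
  set C3 : ℝ := nearPow 4 k with hC3
  have h1 : 0 ≤ C1 := by positivity
  have h2 : 0 ≤ C2 := nearPow_nonneg zero_le_one k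
  have h3 : 0 ≤ C3 := nearPow_nonneg (by norm_num) k
  set D1 := C3 + C3 + 4 * (C3 * C3) with hD1
  set D2 := C2 + D1 + 4 * (C2 * D1) with hD2
  set D3 := C1 + D2 + 4 * (C1 * D2) with hD3
  have hD1' : 0 ≤ D1 := by positivity
  have hD2' : 0 ≤ D2 := by positivity
  refine ⟨D3 + 1, by positivity, fun δ r p J hδ hδ1 hr hrk hp hJ => ?_⟩
  set ε := psize δ p with hε
  have hε0 : 0 ≤ ε := psize_nonneg δ p
  have hε34 : ε ≤ 3 / 4 := psize_le hδ1 hp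
  have hε1 : ε ≤ 1 := by linarith
  set X := pvar (1, 0) p with hX
  set Y := pvar (0, 1) p with hY
  set Z := pvar (1, 1) p with hZ
  have hXn : wnorm δ X ≤ ε := wnorm_pvar_le hδ le_rfl zero_le_one p
  have hYn : wnorm δ Y ≤ ε := wnorm_pvar_le hδ zero_le_one le_rfl p
  have hZn : wnorm δ Z ≤ ε := wnorm_pvar_le hδ le_rfl le_rfl p
  have hW : NearOne δ ε C1 (sieveFactor r p) (-(r • (X + Y - Z))) := by
    constructor
    · rw [wnorm_neg, wnorm_smul, abs_of_nonneg hr]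
      have h4 : wnorm δ (X + Y - Z) ≤ 3 * ε :=
        (wnorm_sub_le _ _ _).trans (by linarith [wnorm_add_le δ X Y])
      calc r * wnorm δ (X + Y - Z) ≤ k * (3 * ε) :=
            mul_le_mul hrk h4 (wnorm_nonneg _ _) (Nat.cast_nonneg k)
        _ = C1 * ε := by rw [hC1]; ring
    · have : sieveFactor r p - 1 - -(r • (X + Y - Z)) = 0 := by
        rw [sieveFactor]; ring
      rw [this, wnorm_zero]
      positivity
  have hZ1 : NearOne δ ε 1 (1 - Z) (-Z) := by
    constructor
    · rw [wnorm_neg]; linarith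
    · rw [show 1 - Z - 1 - -Z = 0 by ring, wnorm_zero]; positivity
  have key := hW.mul hε0 hε1 h1 hD2' ((hZ1.pow hε0 hε1 zero_le_one k).mul hε0 hε1 h2 hD1'
    (((nearOne_geom hε0 hε34 hXn hJ).pow hε0 hε1 (by norm_num) k).mul hε0 hε1 h3 h3
      ((nearOne_geom hε0 hε34 hYn hJ).pow hε0 hε1 (by norm_num) k)))
  have e : -(r • (X + Y - Z)) + ((k : ℝ) • -Z + ((k : ℝ) • X + (k : ℝ) • Y)) =
      (k - r) • (X + Y - Z) := by module
  rw [e] at key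
  refine ⟨key.1.trans ?_, key.2.trans ?_⟩
  · exact mul_le_mul_of_nonneg_right (by linarith) hε0
  · exact mul_le_mul_of_nonneg_right (by linarith) (sq_nonneg ε)

end SmallGaps

/-! ### Bounds for the product of the local quotients -/

namespace SmallGaps

open scoped NNReal
open Filter Topology

theorem psize_sq_le {δ : ℝ} (hδ1 : δ ≤ 1 / 8) {p : ℕ} (hp : p.Prime) :
    psize δ p ^ 2 ≤ 1 / (p : ℝ) ^ (3 / 2 : ℝ) := by
  have hp1 : (1 : ℝ) ≤ p := by exact_mod_cast hp.one_lt.le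
  rw [psize_eq_rpow δ hp, ← Real.rpow_natCast, ← Real.rpow_mul (by linarith), one_div,
    ← Real.rpow_neg (by linarith)]
  exact Real.rpow_le_rpow_of_exponent_le hp1 (by push_cast; linarith)

theorem sum_psize_sq_le {δ : ℝ} (hδ1 : δ ≤ 1 / 8) {s : Finset ℕ} (hs : ∀ p ∈ s, p.Prime) :
    ∑ p ∈ s, psize δ p ^ 2 ≤ ∑' n : ℕ, 1 / (n : ℝ) ^ (3 / 2 : ℝ) :=
  (Finset.sum_le_sum fun p hp => psize_sq_le hδ1 (hs p hp)).trans
    ((Real.summable_one_div_nat_rpow.2 (by norm_num)).sum_le_tsum _ fun n _ => by positivity)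

/-- The variables at at most `w` primes contribute only `O(log w)`: the worst case is that of the
primes up to `w`. -/
theorem sum_psize_le {w δ : ℝ} (hw : 1 ≤ w) (hδ : 0 ≤ δ) (hδ1 : δ ≤ 1 / 2) {B : Finset ℕ}
    (hB : ∀ p ∈ B, p.Prime) (hc : (B.card : ℝ) ≤ w) :
    ∑ p ∈ B, psize δ p ≤ w ^ (2 * δ) * (2 + Real.log w) := by
  have hw0 : 0 < w := by linarith
  rw [← Finset.sum_filter_add_sum_filter_not B (fun p : ℕ => (p : ℝ) ≤ w)]
  have h1 : ∑ p ∈ B with ((p : ℕ) : ℝ) ≤ w, psize δ p ≤ w ^ (2 * δ) * (1 + Real.log w) := by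
    calc _ ≤ ∑ p ∈ B with ((p : ℕ) : ℝ) ≤ w, w ^ (2 * δ) * (p : ℝ)⁻¹ := by
          refine Finset.sum_le_sum fun p hp => ?_
          rw [Finset.mem_filter] at hp
          have hp0 : (0 : ℝ) < p := by exact_mod_cast (hB p hp.1).pos
          rw [psize_eq_rpow δ (hB p hp.1), Real.rpow_sub hp0, Real.rpow_one, div_eq_mul_inv]
          exact mul_le_mul_of_nonneg_right
            (Real.rpow_le_rpow hp0.le hp.2 (by positivity)) (by positivity)
      _ ≤ ∑ p ∈ Finset.Icc 1 ⌊w⌋₊, w ^ (2 * δ) * (p : ℝ)⁻¹ := by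
          refine Finset.sum_le_sum_of_subset_of_nonneg (fun p hp => ?_) fun p _ _ => by positivity
          rw [Finset.mem_filter] at hp
          exact Finset.mem_Icc.2 ⟨(hB p hp.1).one_lt.le, Nat.le_floor hp.2⟩
      _ ≤ w ^ (2 * δ) * (1 + Real.log w) := by
          rw [← Finset.mul_sum]
          refine mul_le_mul_of_nonneg_left ?_ (by positivity)
          have := harmonic_floor_le_one_add_log w hw
          rw [harmonic_eq_sum_Icc] at this
          push_cast at this
          exact this
  have h2 : ∑ p ∈ B with ¬ ((p : ℕ) : ℝ) ≤ w, psize δ p ≤ w ^ (2 * δ) := by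
    calc _ ≤ ∑ p ∈ B with ¬ ((p : ℕ) : ℝ) ≤ w, w ^ (2 * δ - 1) := by
          refine Finset.sum_le_sum fun p hp => ?_
          rw [Finset.mem_filter, not_le] at hp
          rw [psize_eq_rpow δ (hB p hp.1)]
          exact Real.rpow_le_rpow_of_nonpos hw0 hp.2.le (by linarith)
      _ ≤ w * w ^ (2 * δ - 1) := by
          rw [Finset.sum_const, nsmul_eq_mul]
          refine mul_le_mul_of_nonneg_right (le_trans ?_ hc) (by positivity)
          exact_mod_cast Finset.card_filter_le _ _
      _ = w ^ (2 * δ) := by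
          rw [Real.rpow_sub hw0, Real.rpow_one]
          field_simp
  linarith

/-- The product of the local quotients has bounded norm, up to a power of the number `w` of primes
with a defect in the number of residue classes, at the scale `δ = 1 / log w`. -/
theorem exists_wnorm_prod_localQuot_le (k : ℕ) : ∃ C c : ℝ, 0 < C ∧ 0 < c ∧
    ∀ (w : ℝ) (s B : Finset ℕ) (r : ℕ → ℝ) (J : ℕ), Real.exp 8 ≤ w → (∀ p ∈ s, p.Prime) → B ⊆ s →
      (B.card : ℝ) ≤ w → (∀ p, 0 ≤ r p) → (∀ p, r p ≤ k) → (∀ p ∈ s, p ∉ B → r p = k) → 2 ≤ J →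
      wnorm (1 / Real.log w) (∏ p ∈ s, localQuot k J (r p) p) ≤ C * w ^ c := by
  obtain ⟨C, hC, h⟩ := exists_nearOne_localQuot k
  set S := ∑' n : ℕ, 1 / (n : ℝ) ^ (3 / 2 : ℝ) with hS
  refine ⟨Real.exp (C * S + 32 * C), 16 * C, by positivity, by positivity,
    fun w s B r J hw hs hBs hBw hr hrk hgood hJ => ?_⟩
  have hw0 : 0 < w := (Real.exp_pos 8).trans_le hw
  have hw1 : 1 ≤ w := (Real.one_le_exp (by norm_num)).trans hw
  have hlog : 8 ≤ Real.log w := (Real.le_log_iff_exp_le hw0).2 hw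
  set δ := 1 / Real.log w with hδ
  have hδ0 : 0 ≤ δ := by positivity
  have hδ1 : δ ≤ 1 / 8 := one_div_le_one_div_of_le (by norm_num) hlog
  -- the choice of `δ` makes `w ^ (2 * δ) = e ^ 2`
  have hw2 : w ^ (2 * δ) ≤ 8 := by
    have e : w ^ (2 * δ) = Real.exp 1 ^ 2 := by
      rw [Real.rpow_def_of_pos hw0, ← Real.exp_nat_mul]
      congr 1
      rw [hδ]
      field_simp
      norm_num
    rw [e]
    nlinarith [Real.exp_one_lt_d9, Real.exp_pos 1]
  have hgoodp : ∀ p ∈ s \ B, wnorm δ (localQuot k J (r p) p) ≤ Real.exp (C * psize δ p ^ 2) := by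
    intro p hp
    rw [Finset.mem_sdiff] at hp
    have h1 := (h δ (r p) p J hδ0 hδ1 (hr p) (hrk p) (hs p hp.1) hJ).2
    rw [hgood p hp.1 hp.2, sub_self, zero_smul, sub_zero] at h1
    have h2 := wnorm_add_le δ 1 (localQuot k J k p - 1)
    rw [wnorm_one, add_sub_cancel] at h2
    rw [hgood p hp.1 hp.2]
    linarith [Real.add_one_le_exp (C * psize δ p ^ 2)]
  have hbadp : ∀ p ∈ B, wnorm δ (localQuot k J (r p) p) ≤ Real.exp (2 * C * psize δ p) := by
    intro p hp
    have h1 := (h δ (r p) p J hδ0 hδ1 (hr p) (hrk p) (hs p (hBs hp)) hJ).wnorm_le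
    have h2 : psize δ p ^ 2 ≤ psize δ p := by
      nlinarith [psize_nonneg δ p, psize_le hδ1 (hs p (hBs hp))]
    nlinarith [Real.add_one_le_exp (2 * C * psize δ p)]
  have hsum1 : ∑ p ∈ s \ B, C * psize δ p ^ 2 ≤ C * S := by
    rw [← Finset.mul_sum]
    exact mul_le_mul_of_nonneg_left
      (sum_psize_sq_le hδ1 fun p hp => hs p (Finset.mem_sdiff.1 hp).1) hC.le
  have hsum2 : ∑ p ∈ B, 2 * C * psize δ p ≤ 2 * C * (8 * (2 + Real.log w)) := by
    rw [← Finset.mul_sum]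
    refine mul_le_mul_of_nonneg_left ?_ (by positivity)
    exact (sum_psize_le hw1 hδ0 (by linarith) (fun p hp => hs p (hBs hp)) hBw).trans
      (mul_le_mul_of_nonneg_right hw2 (by linarith))
  calc wnorm δ (∏ p ∈ s, localQuot k J (r p) p)
      ≤ ∏ p ∈ s, wnorm δ (localQuot k J (r p) p) := wnorm_prod_le _ _ _
    _ = (∏ p ∈ s \ B, wnorm δ (localQuot k J (r p) p)) *
        ∏ p ∈ B, wnorm δ (localQuot k J (r p) p) := (Finset.prod_sdiff hBs).symm
    _ ≤ (∏ p ∈ s \ B, Real.exp (C * psize δ p ^ 2)) * ∏ p ∈ B, Real.exp (2 * C * psize δ p) :=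
        mul_le_mul (Finset.prod_le_prod (fun p _ => wnorm_nonneg _ _) hgoodp)
          (Finset.prod_le_prod (fun p _ => wnorm_nonneg _ _) hbadp)
          (Finset.prod_nonneg fun p _ => wnorm_nonneg _ _)
          (Finset.prod_nonneg fun p _ => (Real.exp_pos _).le)
    _ = Real.exp (∑ p ∈ s \ B, C * psize δ p ^ 2 + ∑ p ∈ B, 2 * C * psize δ p) := by
        rw [Real.exp_add, Real.exp_sum, Real.exp_sum]
    _ ≤ Real.exp (C * S + 2 * C * (8 * (2 + Real.log w))) :=
        Real.exp_le_exp.2 (add_le_add hsum1 hsum2)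
    _ = _ := by
        rw [Real.rpow_def_of_pos hw0, ← Real.exp_add]
        congr 1
        ring

/-- The Euler factor of the singular series, in terms of the number `r` of residue classes. -/
noncomputable def eulerFactor (k : ℕ) (r : ℝ) (p : ℕ) : ℝ :=
  (1 - r / p) * ((1 - 1 / (p : ℝ)) ^ k)⁻¹

theorem tendsto_aug_prod_localQuot (k : ℕ) (r : ℕ → ℝ) {s : Finset ℕ} (hs : ∀ p ∈ s, p.Prime) :
    Tendsto (fun J => aug (∏ p ∈ s, localQuot k J (r p) p)) atTop
      (𝓝 (∏ p ∈ s, eulerFactor k (r p) p)) := by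
  simp only [map_prod]
  exact tendsto_finsetProd _ fun p hp => tendsto_aug_localQuot k (r p) (hs p hp)

/-- The partial products of the singular series are bounded by a power of `w`. -/
theorem exists_prod_eulerFactor_le (k : ℕ) : ∃ C c : ℝ, 0 < C ∧ 0 < c ∧
    ∀ (w : ℝ) (s B : Finset ℕ) (r : ℕ → ℝ), Real.exp 8 ≤ w → (∀ p ∈ s, p.Prime) → B ⊆ s →
      (B.card : ℝ) ≤ w → (∀ p, 0 ≤ r p) → (∀ p, r p ≤ k) → (∀ p ∈ s, p ∉ B → r p = k) →
      |∏ p ∈ s, eulerFactor k (r p) p| ≤ C * w ^ c := by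
  obtain ⟨C, c, hC, hc, h⟩ := exists_wnorm_prod_localQuot_le k
  refine ⟨C, c, hC, hc, fun w s B r hw hs hBs hBw hr hrk hgood => ?_⟩
  refine le_of_tendsto (tendsto_aug_prod_localQuot k r hs).abs ?_
  filter_upwards [eventually_ge_atTop 2] with J hJ
  have hw1 : 1 ≤ w := (Real.one_le_exp (by norm_num)).trans hw
  have := Real.log_nonneg hw1
  exact (abs_aug_le (by positivity) _).trans (h w s B r J hw hs hBs hBw hr hrk hgood hJ)

/-- The Euler product of the sieve sum, applied to the weights: the main term is the Euler product
at `s = 1` times the value for the model. -/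
theorem exists_abs_act_prod_sieveFactor_sub_le (k : ℕ) {ℓ : ℕ} (hℓ : 0 < ℓ) :
    ∃ C c : ℝ, 0 < C ∧ 0 < c ∧
    ∀ (L : ℝ≥0) (M : ℕ) (w : ℝ) (B : Finset ℕ) (r : ℕ → ℝ), (L : ℝ) < Real.log (M + 1) →
      Real.log M ≤ L → Real.exp 8 ≤ w → B ⊆ primesUpTo M → (B.card : ℝ) ≤ w → (∀ p, 0 ≤ r p) →
      (∀ p, r p ≤ k) → (∀ p ∈ primesUpTo M, p ∉ B → r p = k) →
      |act L (∏ p ∈ primesUpTo M, sieveFactor (r p) p)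
          (tens L (truncPow (k + ℓ)) (truncPow (k + ℓ))) (corner L) -
        ((2 * ℓ).choose ℓ : ℝ) * truncPow (k + 2 * ℓ) L *
          ∏ p ∈ primesUpTo M, eulerFactor k (r p) p| ≤
      C * ((1 + (L : ℝ)) ^ (k + 2 * ℓ - 1) * (1 + Real.log (1 + L))) * w ^ c := by
  obtain ⟨C, c, hC, hc, h⟩ := exists_wnorm_prod_localQuot_le k
  obtain ⟨D, hD, hmodel⟩ := exists_abs_act_modelPoly_sub_le k hℓ
  set b : ℝ := ((2 * ℓ).choose ℓ : ℝ) with hb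
  refine ⟨(D + b) * C, c + 1, by positivity, by positivity,
    fun L M w B r hM hM' hw hBs hBw hr hrk hgood => ?_⟩
  have hs : ∀ p ∈ primesUpTo M, p.Prime := fun p hp => (mem_primesUpTo.1 hp).1
  have hw0 : 0 < w := (Real.exp_pos 8).trans_le hw
  have hlog : 8 ≤ Real.log w := (Real.le_log_iff_exp_le hw0).2 hw
  have hlogw : Real.log w ≤ w := (Real.log_le_sub_one_of_pos hw0).trans (by linarith)
  set δ := 1 / Real.log w with hδ
  have hδ0 : 0 < δ := by positivity
  have hδ1 : δ ≤ 1 := (one_div_le_one_div_of_le (by norm_num) hlog).trans (by norm_num)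
  have hL0 : (0 : ℝ) ≤ L := L.2
  have hll : 0 ≤ Real.log (1 + L) := Real.log_nonneg (by linarith)
  set Q : ℝ := (1 + (L : ℝ)) ^ (k + 2 * ℓ - 1) * (1 + Real.log (1 + L)) with hQ
  have hQ0 : 0 ≤ Q := by positivity
  set E : ℝ := (D + b) * Q * Real.log w with hE
  have hE0 : 0 ≤ E := by positivity
  -- linear growth is dominated by the exponential at scale `δ`
  have hexp : ∀ x : ℝ, 0 ≤ x → 1 + x ≤ Real.log w * Real.exp (δ * x) := by
    intro x hx
    have h1 : δ * (1 + x) ≤ Real.exp (δ * x) := by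
      have := Real.add_one_le_exp (δ * x)
      linarith
    calc 1 + x = Real.log w * (δ * (1 + x)) := by rw [hδ]; field_simp
      _ ≤ _ := mul_le_mul_of_nonneg_left h1 (by linarith)
  set κ : ℝ := b * truncPow (k + 2 * ℓ) L with hκ
  have hκ0 : |κ| ≤ E * Real.exp (δ * L) := by
    have h1 : 0 ≤ κ := mul_nonneg (by positivity) (truncPow_nonneg _ _)
    rw [abs_of_nonneg h1]
    have h2 : truncPow (k + 2 * ℓ) L ≤ (1 + (L : ℝ)) ^ (k + 2 * ℓ - 1) * (1 + L) := by
      rw [truncPow_of_nonneg _ hL0, ← pow_succ, show k + 2 * ℓ - 1 + 1 = k + 2 * ℓ by omega]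
      refine (div_le_self (by positivity) ?_).trans (pow_le_pow_left₀ hL0 (by linarith) _)
      exact_mod_cast Nat.factorial_pos _
    have h3 : (1 + (L : ℝ)) ^ (k + 2 * ℓ - 1) ≤ Q :=
      le_mul_of_one_le_right (by positivity) (by linarith)
    calc κ ≤ b * (Q * (Real.log w * Real.exp (δ * L))) := by
          refine mul_le_mul_of_nonneg_left (h2.trans ?_) (by positivity)
          exact mul_le_mul h3 (hexp L hL0) (by linarith) hQ0
      _ ≤ (D + b) * (Q * (Real.log w * Real.exp (δ * L))) :=
          mul_le_mul_of_nonneg_right (by linarith) (by positivity)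
      _ = _ := by rw [hE]; ring
  have hφ : ∀ z : Box L, |act L (modelPoly M k) (tens L (truncPow (k + ℓ)) (truncPow (k + ℓ))) z -
      κ| ≤ E * Real.exp (δ * (((L : ℝ) - z.1.1) + (L - z.1.2))) := by
    intro z
    have hz1 : (z.1.1 : ℝ) ≤ L := by exact_mod_cast z.2.1
    have hz2 : (z.1.2 : ℝ) ≤ L := by exact_mod_cast z.2.2
    have hx0 : 0 ≤ ((L : ℝ) - z.1.1) + (L - z.1.2) := by linarith
    refine (hmodel L M hM hM' z).trans ?_
    calc D * (1 + (L : ℝ)) ^ (k + 2 * ℓ - 1) * (1 + Real.log (1 + L)) *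
          (1 + (((L : ℝ) - z.1.1) + (L - z.1.2)))
        ≤ D * (1 + (L : ℝ)) ^ (k + 2 * ℓ - 1) * (1 + Real.log (1 + L)) *
          (Real.log w * Real.exp (δ * (((L : ℝ) - z.1.1) + (L - z.1.2)))) :=
          mul_le_mul_of_nonneg_left (hexp _ hx0) (by positivity)
      _ = D * (Q * Real.log w * Real.exp (δ * (((L : ℝ) - z.1.1) + (L - z.1.2)))) := by
          rw [hQ]; ring
      _ ≤ (D + b) * (Q * Real.log w * Real.exp (δ * (((L : ℝ) - z.1.1) + (L - z.1.2)))) :=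
          mul_le_mul_of_nonneg_right (by linarith [show 0 ≤ b by positivity]) (by positivity)
      _ = _ := by rw [hE]; ring
  refine le_of_tendsto (((tendsto_aug_prod_localQuot k r hs).const_mul κ).const_sub _).abs ?_
  have hJL : ∀ᶠ J : ℕ in atTop, (L : ℝ) < J * Real.log 2 :=
    (tendsto_natCast_atTop_atTop.atTop_mul_const (Real.log_pos one_lt_two)).eventually_gt_atTop _
  filter_upwards [eventually_ge_atTop 2, hJL] with J hJ hJ2
  rw [act_prod_sieveFactor hM hJ2 k r, Module.End.mul_apply]
  refine (abs_act_sub_le hδ0.le hE0 hφ hκ0 _).trans ?_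
  calc E * wnorm δ (∏ p ∈ primesUpTo M, localQuot k J (r p) p) ≤ E * (C * w ^ c) :=
        mul_le_mul_of_nonneg_left
          (h w (primesUpTo M) B r J hw hs hBs hBw hr hrk hgood hJ) hE0
    _ = ((D + b) * C * Q * w ^ c) * Real.log w := by rw [hE]; ring
    _ ≤ ((D + b) * C * Q * w ^ c) * w := mul_le_mul_of_nonneg_left hlogw (by positivity)
    _ = _ := by rw [Real.rpow_add hw0, Real.rpow_one]; ring

end SmallGaps

/-! ### The singular series and the primes with few residue classes -/

namespace SmallGaps

open Filter Topology

theorem card_Omega_le (𝓗 : Finset ℕ) (p : ℕ) : (Omega 𝓗 p).card ≤ 𝓗.card :=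
  Finset.card_image_le

theorem card_primeFactors_le_log {n : ℕ} (hn : n ≠ 0) :
    (n.primeFactors.card : ℝ) ≤ Real.log n / Real.log 2 := by
  have h1 : 2 ^ n.primeFactors.card ≤ n := by
    calc 2 ^ n.primeFactors.card = ∏ p ∈ n.primeFactors, 2 := by rw [Finset.prod_const]
      _ ≤ ∏ p ∈ n.primeFactors, p :=
          Finset.prod_le_prod' fun p hp => (Nat.prime_of_mem_primeFactors hp).two_le
      _ ≤ n := Nat.le_of_dvd (Nat.pos_of_ne_zero hn) (Nat.prod_primeFactors_dvd n)
  have h2 : Real.log ((2 : ℝ) ^ n.primeFactors.card) ≤ Real.log n :=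
    Real.log_le_log (by positivity) (by exact_mod_cast h1)
  rw [Real.log_pow] at h2
  rwa [le_div_iff₀ (Real.log_pos one_lt_two)]

/-- A prime with fewer than `|𝓗|` residue classes divides a difference of two elements of `𝓗`; so
there are few of them. -/
theorem card_defect_le {𝓗 : Finset ℕ} {H : ℝ} (hH : ∀ h ∈ 𝓗, 1 ≤ h ∧ (h : ℝ) ≤ H) {B : Finset ℕ}
    (hB : ∀ p ∈ B, p.Prime ∧ (Omega 𝓗 p).card ≠ 𝓗.card) :
    (B.card : ℝ) ≤ (𝓗.card : ℝ) ^ 2 * (Real.log H / Real.log 2) := by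
  have hsub : B ⊆ 𝓗.offDiag.biUnion fun x => (Nat.dist x.1 x.2).primeFactors := by
    intro p hp
    obtain ⟨hpp, hpc⟩ := hB p hp
    have hninj : ¬ Set.InjOn (fun h : ℕ => -(h : ZMod p)) 𝓗 := fun hinj =>
      hpc (Finset.card_image_of_injOn hinj)
    simp only [Set.InjOn, not_forall] at hninj
    obtain ⟨a, ha, b, hb, hab, hne⟩ := hninj
    have h1 : (a : ZMod p) = (b : ZMod p) := neg_injective hab
    rw [ZMod.natCast_eq_natCast_iff] at h1
    refine Finset.mem_biUnion.2 ⟨(a, b), Finset.mem_offDiag.2 ⟨ha, hb, hne⟩, ?_⟩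
    refine Nat.mem_primeFactors.2 ⟨hpp, ?_, fun h0 => hne (Nat.eq_of_dist_eq_zero h0)⟩
    rcases le_total a b with h | h
    · rw [Nat.dist_eq_sub_of_le h]
      exact (Nat.modEq_iff_dvd' h).1 h1
    · rw [Nat.dist_eq_sub_of_le_right h]
      exact (Nat.modEq_iff_dvd' h).1 h1.symm
  calc (B.card : ℝ) ≤ ((𝓗.offDiag.biUnion fun x => (Nat.dist x.1 x.2).primeFactors).card : ℝ) := by
        exact_mod_cast Finset.card_le_card hsub
    _ ≤ ∑ x ∈ 𝓗.offDiag, ((Nat.dist x.1 x.2).primeFactors.card : ℝ) := by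
        exact_mod_cast Finset.card_biUnion_le
    _ ≤ ∑ x ∈ 𝓗.offDiag, Real.log H / Real.log 2 := by
        refine Finset.sum_le_sum fun x hx => ?_
        rw [Finset.mem_offDiag] at hx
        have hd : Nat.dist x.1 x.2 ≠ 0 := fun h0 => hx.2.2 (Nat.eq_of_dist_eq_zero h0)
        have hle : ((Nat.dist x.1 x.2 : ℕ) : ℝ) ≤ H := by
          rcases le_total x.1 x.2 with h | h
          · rw [Nat.dist_eq_sub_of_le h]
            exact le_trans (by exact_mod_cast Nat.sub_le _ _) (hH x.2 hx.2.1).2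
          · rw [Nat.dist_eq_sub_of_le_right h]
            exact le_trans (by exact_mod_cast Nat.sub_le _ _) (hH x.1 hx.1).2
        refine (card_primeFactors_le_log hd).trans ?_
        have hd0 : (0 : ℝ) < (Nat.dist x.1 x.2 : ℕ) := by exact_mod_cast Nat.pos_of_ne_zero hd
        exact div_le_div_of_nonneg_right (Real.log_le_log hd0 hle) (Real.log_nonneg (by norm_num))
    _ ≤ _ := by
        rw [Finset.sum_const, nsmul_eq_mul]
        rcases 𝓗.eq_empty_or_nonempty with rfl | ⟨h, hh⟩
        · simp
        · have h1 : (1 : ℝ) ≤ H := le_trans (by exact_mod_cast (hH h hh).1) (hH h hh).2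
          refine mul_le_mul_of_nonneg_right ?_
            (div_nonneg (Real.log_nonneg h1) (Real.log_nonneg (by norm_num)))
          rw [Finset.offDiag_card, sq]
          exact_mod_cast Nat.sub_le _ _

theorem abs_singularFactor_sub_one_le {𝓗 : Finset ℕ} {p : ℕ} (hp : p.Prime)
    (hc : (Omega 𝓗 p).card = 𝓗.card) :
    |singularFactor 𝓗 p - 1| ≤ 2 ^ 𝓗.card * (𝓗.card : ℝ) ^ 2 * ((p : ℝ) ^ 2)⁻¹ := by
  set k := 𝓗.card with hk
  have hp2 : (2 : ℝ) ≤ (p : ℝ) := by exact_mod_cast hp.two_le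
  have hx0 : 0 ≤ 1 / (p : ℝ) := by positivity
  have hx2 : 1 / (p : ℝ) ≤ 1 / 2 := one_div_le_one_div_of_le (by norm_num) hp2
  set x : ℝ := 1 / (p : ℝ) with hx
  have hb : 1 - k * x ≤ (1 - x) ^ k := by
    have := one_add_mul_le_pow (a := -x) (by linarith) k
    rwa [mul_neg, ← sub_eq_add_neg, ← sub_eq_add_neg] at this
  have hu := one_sub_pow_le k x hx0 (by linarith)
  have hpos : (1 / 2 : ℝ) ^ k ≤ (1 - x) ^ k := pow_le_pow_left₀ (by norm_num) (by linarith) k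
  have hpos' : 0 < (1 - x) ^ k := pow_pos (by linarith) k
  have he : singularFactor 𝓗 p - 1 = (1 - k * x - (1 - x) ^ k) * ((1 - x) ^ k)⁻¹ := by
    unfold singularFactor
    rw [hc, ← hk, ← hx, sub_mul _ ((1 - x) ^ k), mul_inv_cancel₀ hpos'.ne', hx]
    ring
  have hinv : ((1 - x) ^ k)⁻¹ ≤ 2 ^ k := by simpa using inv_anti₀ (by positivity) hpos
  have hab : |1 - k * x - (1 - x) ^ k| ≤ (k : ℝ) ^ 2 * x ^ 2 := by
    have : 0 ≤ (k : ℝ) ^ 2 * x ^ 2 := by positivity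
    rw [abs_le]
    constructor <;> linarith
  rw [he, abs_mul, abs_of_pos (inv_pos.2 hpos')]
  calc _ ≤ ((k : ℝ) ^ 2 * x ^ 2) * 2 ^ k :=
        mul_le_mul hab hinv (inv_pos.2 hpos').le (by positivity)
    _ = _ := by rw [hx, one_div, inv_pow]; ring

theorem tendsto_prod_singularFactor (𝓗 : Finset ℕ) :
    Tendsto (fun n => ∏ p ∈ primesUpTo n, singularFactor 𝓗 p) atTop (𝓝 (singularSeries 𝓗)) := by
  have h := (multipliable_singularFactor 𝓗).hasProd
  have hmono : Monotone fun n => (primesUpTo n).subtype Nat.Prime := by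
    intro m n hmn p hp
    rw [Finset.mem_subtype, mem_primesUpTo] at hp ⊢
    exact ⟨hp.1, hp.2.trans hmn⟩
  have ht : Tendsto (fun n => (primesUpTo n).subtype Nat.Prime) atTop atTop :=
    tendsto_atTop_finset_of_monotone hmono fun p =>
      ⟨p.1, by rw [Finset.mem_subtype, mem_primesUpTo]; exact ⟨p.2, le_rfl⟩⟩
  refine (Tendsto.comp h ht).congr fun n => ?_
  exact Finset.prod_subtype_of_mem (singularFactor 𝓗) fun p hp => (mem_primesUpTo.1 hp).1

/-- The tail of the singular series beyond the primes dividing differences of elements of `𝓗`. -/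
theorem exists_abs_prod_singularFactor_sub_le (k : ℕ) : ∃ C : ℝ, 0 < C ∧
    ∀ (𝓗 : Finset ℕ) (M : ℕ), 𝓗.card = k → 1 ≤ M → (∀ h ∈ 𝓗, h ≤ M) →
      |(∏ p ∈ primesUpTo M, singularFactor 𝓗 p) - singularSeries 𝓗| ≤
        |∏ p ∈ primesUpTo M, singularFactor 𝓗 p| * (C / M) := by
  set D : ℝ := 2 ^ k * (k : ℝ) ^ 2 with hD
  refine ⟨D * Real.exp D + 1, by positivity, fun 𝓗 M hk hM hH => ?_⟩
  have hM0 : (1 : ℝ) ≤ M := by exact_mod_cast hM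
  set P := ∏ p ∈ primesUpTo M, singularFactor 𝓗 p with hP
  refine le_of_tendsto ((tendsto_prod_singularFactor 𝓗).const_sub P).abs ?_
  filter_upwards [eventually_ge_atTop M] with n hn
  have hsub : primesUpTo M ⊆ primesUpTo n := by
    intro p hp
    rw [mem_primesUpTo] at hp ⊢
    exact ⟨hp.1, hp.2.trans hn⟩
  have hmem : ∀ p ∈ primesUpTo n \ primesUpTo M, p.Prime ∧ M < p ∧ p ≤ n := by
    intro p hp
    rw [Finset.mem_sdiff, mem_primesUpTo, mem_primesUpTo] at hp
    exact ⟨hp.1.1, not_le.1 fun h => hp.2 ⟨hp.1.1, h⟩, hp.1.2⟩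
  have hsum : ∑ p ∈ primesUpTo n \ primesUpTo M, ‖singularFactor 𝓗 p - 1‖ ≤ D / M := by
    calc _ ≤ ∑ p ∈ primesUpTo n \ primesUpTo M, D * ((p : ℝ) ^ 2)⁻¹ := by
          refine Finset.sum_le_sum fun p hp => ?_
          obtain ⟨h1, h2, _⟩ := hmem p hp
          have := abs_singularFactor_sub_one_le h1
            (card_Omega_of_lt fun h hh => (hH h hh).trans_lt h2)
          rwa [hk] at this
      _ ≤ ∑ p ∈ Finset.Ioc M n, D * ((p : ℝ) ^ 2)⁻¹ := by
          refine Finset.sum_le_sum_of_subset_of_nonneg (fun p hp => ?_) fun p _ _ => by positivity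
          obtain ⟨_, h2, h3⟩ := hmem p hp
          exact Finset.mem_Ioc.2 ⟨h2, h3⟩
      _ ≤ D / M := by
          rw [← Finset.mul_sum, div_eq_mul_inv]
          refine mul_le_mul_of_nonneg_left ?_ (by positivity)
          have h1 := sum_Ioc_inv_sq_le_sub (α := ℝ) (by omega : M ≠ 0) hn
          have : (0 : ℝ) ≤ (n : ℝ)⁻¹ := by positivity
          linarith
  have hbd : |(∏ p ∈ primesUpTo n \ primesUpTo M, singularFactor 𝓗 p) - 1| ≤
      (D * Real.exp D + 1) / M := by
    have h1 := Finset.norm_prod_one_add_sub_one_le (primesUpTo n \ primesUpTo M)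
      fun p => singularFactor 𝓗 p - 1
    simp only [add_sub_cancel] at h1
    rw [Real.norm_eq_abs] at h1
    refine h1.trans ?_
    have h2 : Real.exp (D / M) - 1 ≤ D / M * Real.exp (D / M) := by
      have := Real.one_sub_le_exp_neg (D / M)
      have h3 : Real.exp (D / M) * (1 - D / M) ≤ Real.exp (D / M) * Real.exp (-(D / M)) :=
        mul_le_mul_of_nonneg_left this (Real.exp_pos _).le
      rw [← Real.exp_add, add_neg_cancel, Real.exp_zero] at h3
      linarith
    have h4 : Real.exp (D / M) ≤ Real.exp D :=
      Real.exp_le_exp.2 (div_le_self (by positivity) hM0)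
    have h5 : D / M * Real.exp (D / M) ≤ D / M * Real.exp D :=
      mul_le_mul_of_nonneg_left h4 (by positivity)
    have h6 := Real.exp_le_exp.2 hsum
    have h7 : D / M * Real.exp D ≤ (D * Real.exp D + 1) / M := by
      rw [div_mul_eq_mul_div]
      exact div_le_div_of_nonneg_right (by linarith) (by linarith)
    linarith
  rw [← Finset.prod_sdiff hsub, ← hP]
  calc |P - (∏ p ∈ primesUpTo n \ primesUpTo M, singularFactor 𝓗 p) * P| =
        |P| * |(∏ p ∈ primesUpTo n \ primesUpTo M, singularFactor 𝓗 p) - 1| := by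
        rw [← abs_mul, ← abs_neg]; congr 1; ring
    _ ≤ _ := mul_le_mul_of_nonneg_left hbd (abs_nonneg _)

end SmallGaps

/-! ### Counting the zeros of the tuple polynomial modulo `q` -/

namespace SmallGaps

/-- The residue classes `x` modulo `q` with `P(x; 𝓗) ≡ 0`. -/
def rootSet (𝓗 : Finset ℕ) (q : ℕ) : Set (ZMod q) :=
  {x | ∏ h ∈ 𝓗, (x + (h : ZMod q)) = 0}

theorem natCast_mem_rootSet {𝓗 : Finset ℕ} {q n : ℕ} :
    (n : ZMod q) ∈ rootSet 𝓗 q ↔ q ∣ tuplePoly 𝓗 n := by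
  rw [rootSet, Set.mem_ofPred_eq, ← ZMod.natCast_eq_zero_iff, tuplePoly]
  push_cast
  rfl

theorem ncard_rootSet_prime (𝓗 : Finset ℕ) {p : ℕ} (hp : p.Prime) :
    (rootSet 𝓗 p).ncard = (Omega 𝓗 p).card := by
  have := Fact.mk hp
  rw [← Set.ncard_coe_finset]
  congr 1
  ext x
  simp only [rootSet, Set.mem_ofPred_eq, Finset.prod_eq_zero_iff, Omega, Finset.coe_image,
    Set.mem_image, Finset.mem_coe]
  exact exists_congr fun h => and_congr_right fun _ => by
    rw [add_eq_zero_iff_eq_neg, eq_comm]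

theorem ncard_rootSet_mul (𝓗 : Finset ℕ) {m n : ℕ} (h : m.Coprime n) :
    (rootSet 𝓗 (m * n)).ncard = (rootSet 𝓗 m).ncard * (rootSet 𝓗 n).ncard := by
  rw [← Set.ncard_prod]
  have e := ZMod.chineseRemainder h
  rw [← Set.ncard_image_of_injective _ e.injective]
  congr 1
  ext y
  constructor
  · rintro ⟨x, hx, rfl⟩
    have hx' : ∏ h ∈ 𝓗, (x + (h : ZMod (m * n))) = 0 := hx
    have h1 := congrArg e hx'
    rw [map_prod, map_zero] at h1
    simp only [map_add, map_natCast] at h1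
    refine ⟨?_, ?_⟩
    · have := congrArg Prod.fst h1
      rw [Prod.fst_prod] at this
      simpa [rootSet] using this
    · have := congrArg Prod.snd h1
      rw [Prod.snd_prod] at this
      simpa [rootSet] using this
  · rintro ⟨h1, h2⟩
    refine ⟨e.symm y, ?_, e.apply_symm_apply y⟩
    change ∏ h ∈ 𝓗, (e.symm y + (h : ZMod (m * n))) = 0
    apply e.injective
    rw [map_prod, map_zero]
    simp only [map_add, map_natCast, RingEquiv.apply_symm_apply]
    refine Prod.ext ?_ ?_
    · rw [Prod.fst_prod]
      simpa [rootSet] using h1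
    · rw [Prod.snd_prod]
      simpa [rootSet] using h2

theorem ncard_rootSet_prod (𝓗 : Finset ℕ) {S : Finset ℕ} (hS : ∀ p ∈ S, p.Prime) :
    (rootSet 𝓗 (∏ p ∈ S, p)).ncard = ∏ p ∈ S, (Omega 𝓗 p).card := by
  induction S using Finset.induction_on with
  | empty =>
    have : rootSet 𝓗 1 = Set.univ := Set.eq_univ_of_forall fun x => Subsingleton.elim _ _
    rw [Finset.prod_empty, Finset.prod_empty, this, Set.ncard_univ, Nat.card_zmod]
  | insert p S hp ih =>
    have hS' : ∀ q ∈ S, q.Prime := fun q hq => hS q (Finset.mem_insert_of_mem hq)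
    have hpp := hS p (Finset.mem_insert_self p S)
    have hco : p.Coprime (∏ q ∈ S, q) := Nat.Coprime.prod_right fun q hq =>
      (Nat.coprime_primes hpp (hS' q hq)).2 fun h => hp (h ▸ hq)
    rw [Finset.prod_insert hp, Finset.prod_insert hp, ncard_rootSet_mul 𝓗 hco,
      ncard_rootSet_prime 𝓗 hpp, ih hS']

theorem abs_card_modEq_sub_le {X Y q : ℕ} (hXY : X ≤ Y) (hq : 0 < q) (v : ℕ) :
    |(((Finset.Ioc X Y).filter (· ≡ v [MOD q])).card : ℝ) - ((Y : ℝ) - X) / q| ≤ 1 := by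
  have h := Nat.Ioc_filter_modEq_card X Y hq v
  have hq' : (0 : ℚ) < q := by exact_mod_cast hq
  have hmono : ⌊((X : ℚ) - v) / q⌋ ≤ ⌊((Y : ℚ) - v) / q⌋ := by
    apply Int.floor_le_floor
    have : (X : ℚ) ≤ Y := by exact_mod_cast hXY
    gcongr
  rw [max_eq_left (by linarith)] at h
  have h' : (((Finset.Ioc X Y).filter (· ≡ v [MOD q])).card : ℚ) =
      (⌊((Y : ℚ) - v) / q⌋ : ℚ) - ⌊((X : ℚ) - v) / q⌋ := by exact_mod_cast h
  have e : ((Y : ℚ) - X) / q = ((Y : ℚ) - v) / q - ((X : ℚ) - v) / q := by ring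
  have key : |(((Finset.Ioc X Y).filter (· ≡ v [MOD q])).card : ℚ) - ((Y : ℚ) - X) / q| ≤ 1 := by
    rw [h', e, abs_le]
    have h1 := Int.floor_le (((Y : ℚ) - v) / q)
    have h2 := Int.lt_floor_add_one (((Y : ℚ) - v) / q)
    have h3 := Int.floor_le (((X : ℚ) - v) / q)
    have h4 := Int.lt_floor_add_one (((X : ℚ) - v) / q)
    constructor <;> linarith
  have key2 := (Rat.cast_le (K := ℝ)).2 key
  push_cast at key2
  exact key2

/-- The number of `n` with `q ∣ P(n; 𝓗)` in an interval, one term for each root modulo `q`. -/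
theorem abs_card_dvd_tuplePoly_sub_le (𝓗 : Finset ℕ) {X Y q : ℕ} (hXY : X ≤ Y) (hq : 0 < q) :
    |(((Finset.Ioc X Y).filter (q ∣ tuplePoly 𝓗 ·)).card : ℝ) -
      (rootSet 𝓗 q).ncard * (((Y : ℝ) - X) / q)| ≤ (rootSet 𝓗 q).ncard := by
  classical
  have : NeZero q := ⟨hq.ne'⟩
  set T : Finset (ZMod q) := (rootSet 𝓗 q).toFinset with hT
  have hTc : (rootSet 𝓗 q).ncard = T.card := Set.ncard_eq_toFinset_card' _
  have h1 : ((Finset.Ioc X Y).filter (q ∣ tuplePoly 𝓗 ·)).card =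
      ∑ x ∈ T, ((Finset.Ioc X Y).filter (· ≡ x.val [MOD q])).card := by
    rw [Finset.card_eq_sum_card_fiberwise (f := fun n : ℕ => (n : ZMod q)) (t := T)]
    · refine Finset.sum_congr rfl fun x hx => ?_
      congr 1
      ext n
      have hn : (n : ZMod q) = x ↔ n ≡ x.val [MOD q] := by
        rw [← ZMod.natCast_eq_natCast_iff, ZMod.natCast_zmod_val]
      simp only [Finset.mem_filter, hn]
      refine ⟨fun h => ⟨h.1.1, h.2⟩, fun h => ⟨⟨h.1, ?_⟩, h.2⟩⟩
      rw [← natCast_mem_rootSet, hn.2 h.2]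
      exact Set.mem_toFinset.1 hx
    · intro n hn
      rw [Finset.mem_coe, Finset.mem_filter] at hn
      exact Finset.mem_coe.2 (Set.mem_toFinset.2 (natCast_mem_rootSet.2 hn.2))
  rw [h1, hTc]
  push_cast
  rw [← nsmul_eq_mul, ← Finset.sum_const, ← Finset.sum_sub_distrib]
  refine (Finset.abs_sum_le_sum_abs _ _).trans ?_
  calc _ ≤ ∑ x ∈ T, (1 : ℝ) := Finset.sum_le_sum fun x _ => abs_card_modEq_sub_le hXY hq _
    _ = _ := by simp

theorem abs_floor_two_mul_sub_floor_sub_le {N : ℝ} (hN : 0 ≤ N) :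
    |((⌊2 * N⌋₊ : ℝ) - ⌊N⌋₊) - N| ≤ 1 := by
  have h1 := Nat.floor_le hN
  have h2 := Nat.lt_floor_add_one N
  have h3 := Nat.floor_le (by positivity : 0 ≤ 2 * N)
  have h4 := Nat.lt_floor_add_one (2 * N)
  rw [abs_le]
  constructor <;> linarith

theorem abs_card_dvd_and_dvd_sub_le (𝓗 : Finset ℕ) {N : ℝ} (hN : 0 ≤ N) {d e : ℕ}
    (hd : Squarefree d) (he : Squarefree e) :
    |(((Finset.Ioc ⌊N⌋₊ ⌊2 * N⌋₊).filter
        fun n => d ∣ tuplePoly 𝓗 n ∧ e ∣ tuplePoly 𝓗 n).card : ℝ) -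
      N * ∏ p ∈ d.primeFactors ∪ e.primeFactors, ((Omega 𝓗 p).card : ℝ) / p| ≤
      2 * ∏ p ∈ d.primeFactors ∪ e.primeFactors, ((Omega 𝓗 p).card : ℝ) := by
  have hS : ∀ p ∈ d.primeFactors ∪ e.primeFactors, p.Prime := by
    intro p hp
    rcases Finset.mem_union.1 hp with h | h <;> exact Nat.prime_of_mem_primeFactors h
  have hlcm : Nat.lcm d e = ∏ p ∈ d.primeFactors ∪ e.primeFactors, p := by
    refine Nat.dvd_antisymm (Nat.lcm_dvd ?_ ?_) ?_
    · nth_rewrite 1 [← Nat.prod_primeFactors_of_squarefree hd]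
      exact Finset.prod_dvd_prod_of_subset _ _ _ Finset.subset_union_left
    · nth_rewrite 1 [← Nat.prod_primeFactors_of_squarefree he]
      exact Finset.prod_dvd_prod_of_subset _ _ _ Finset.subset_union_right
    · refine Finset.prod_primes_dvd _ (fun p hp => (hS p hp).prime) fun p hp => ?_
      rcases Finset.mem_union.1 hp with h | h
      · exact (Nat.dvd_of_mem_primeFactors h).trans (Nat.dvd_lcm_left d e)
      · exact (Nat.dvd_of_mem_primeFactors h).trans (Nat.dvd_lcm_right d e)
  have hρ := ncard_rootSet_prod 𝓗 hS
  rw [← hlcm] at hρ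
  have hq : 0 < Nat.lcm d e :=
    Nat.lcm_pos (Nat.pos_of_ne_zero hd.ne_zero) (Nat.pos_of_ne_zero he.ne_zero)
  have hq1 : (1 : ℝ) ≤ (Nat.lcm d e : ℕ) := by exact_mod_cast hq
  have h1 := abs_card_dvd_tuplePoly_sub_le 𝓗
    (Nat.floor_le_floor (by linarith : N ≤ 2 * N)) hq
  simp only [Nat.lcm_dvd_iff] at h1
  rw [Finset.prod_div_distrib]
  have hρ' : ((rootSet 𝓗 (Nat.lcm d e)).ncard : ℝ) =
      ∏ p ∈ d.primeFactors ∪ e.primeFactors, ((Omega 𝓗 p).card : ℝ) := by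
    rw [hρ]; push_cast; rfl
  have hlcm' : ((Nat.lcm d e : ℕ) : ℝ) = ∏ p ∈ d.primeFactors ∪ e.primeFactors, (p : ℝ) := by
    rw [hlcm]; push_cast; rfl
  rw [← hρ', ← hlcm']
  set ρ : ℝ := ((rootSet 𝓗 (Nat.lcm d e)).ncard : ℝ)
  have hρ0 : 0 ≤ ρ := Nat.cast_nonneg _
  set q : ℝ := ((Nat.lcm d e : ℕ) : ℝ)
  have h2 : |ρ * (((⌊2 * N⌋₊ : ℝ) - ⌊N⌋₊) / q) - N * (ρ / q)| ≤ ρ := by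
    have e1 : ρ * (((⌊2 * N⌋₊ : ℝ) - ⌊N⌋₊) / q) - N * (ρ / q) =
        ρ * ((((⌊2 * N⌋₊ : ℝ) - ⌊N⌋₊) - N) / q) := by ring
    rw [e1, abs_mul, abs_of_nonneg hρ0, abs_div, abs_of_pos (by linarith : 0 < q)]
    refine mul_le_of_le_one_right hρ0 ?_
    rw [div_le_one (by linarith)]
    exact (abs_floor_two_mul_sub_floor_sub_le hN).trans hq1
  calc _ ≤ _ := abs_sub_le _ (ρ * (((⌊2 * N⌋₊ : ℝ) - ⌊N⌋₊) / q)) _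
    _ ≤ 2 * ρ := by linarith

end SmallGaps

/-! ### The sieve sum as an operator -/

namespace SmallGaps

open scoped NNReal
open ArithmeticFunction (moebius zeta)

theorem lambdaR_eq {R : ℝ} {d : ℕ} (hd : 0 < d) (hdR : (d : ℝ) ≤ R) (a : ℕ) :
    lambdaR R d a = moebius d * truncPow a (Real.log R - Real.log d) := by
  have hd0 : (0 : ℝ) < d := by exact_mod_cast hd
  have hlog : 0 ≤ Real.log R - Real.log d := sub_nonneg.2 (Real.log_le_log hd0 hdR)
  rw [lambdaR, if_pos hdR, truncPow_of_nonneg a hlog,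
    Real.log_div (hd0.trans_le hdR).ne' hd0.ne']
  ring

/-- Only squarefree `d ≤ R` contribute to `Λ_R`. -/
theorem LambdaR_eq (R : ℝ) {n : ℕ} (hn : 0 < n) (𝓗 : Finset ℕ) (a : ℕ) :
    LambdaR R n 𝓗 a = ∑ d ∈ (Finset.Icc 1 ⌊R⌋₊).filter Squarefree,
      if d ∣ tuplePoly 𝓗 n then (moebius d : ℝ) * truncPow a (Real.log R - Real.log d) else 0 := by
  have hP : tuplePoly 𝓗 n ≠ 0 := Finset.prod_ne_zero_iff.2 fun h _ => by omega
  have hmem : ∀ d, 1 ≤ d → d ≤ ⌊R⌋₊ → (d : ℝ) ≤ R := fun d h1 h2 =>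
    (Nat.le_floor_iff' (by omega)).1 h2
  rw [← Finset.sum_filter, LambdaR]
  symm
  calc _ = ∑ d ∈ ((Finset.Icc 1 ⌊R⌋₊).filter Squarefree).filter (· ∣ tuplePoly 𝓗 n),
        lambdaR R d a := by
        refine Finset.sum_congr rfl fun d hd => ?_
        simp only [Finset.mem_filter, Finset.mem_Icc] at hd
        exact (lambdaR_eq hd.1.1.1 (hmem d hd.1.1.1 hd.1.1.2) a).symm
    _ = _ := by
        refine Finset.sum_subset (fun d hd => ?_) fun d hd hd' => ?_
        · exact Nat.mem_divisors.2 ⟨(Finset.mem_filter.1 hd).2, hP⟩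
        · have hd0 := Nat.pos_of_mem_divisors hd
          simp only [Finset.mem_filter, Finset.mem_Icc, (Nat.mem_divisors.1 hd).1, and_true,
            not_and] at hd'
          rw [lambdaR]
          split_ifs with h
          · rw [ArithmeticFunction.moebius_eq_zero_of_not_squarefree
              (hd' ⟨hd0, Nat.le_floor h⟩)]
            simp
          · rfl

theorem zeta_pow_prime (k : ℕ) {p : ℕ} (hp : p.Prime) :
    ((zeta : ArithmeticFunction ℤ) ^ k) p = k := by
  have h1 : ∀ k : ℕ, ((zeta : ArithmeticFunction ℤ) ^ k) 1 = 1 := by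
    intro k
    induction k with
    | zero => simp
    | succ k ih => rw [pow_succ, ArithmeticFunction.mul_apply]; simp [ih]
  induction k with
  | zero => simp [hp.ne_one]
  | succ k ih =>
    rw [pow_succ, ArithmeticFunction.mul_apply, Nat.sum_divisorsAntidiagonal
      (f := fun x y => ((zeta : ArithmeticFunction ℤ) ^ k) x * (zeta : ArithmeticFunction ℤ) y),
      hp.sum_divisors]
    simp [ih, h1, hp.ne_zero, Nat.div_self hp.pos]

theorem isMultiplicative_zeta_pow (k : ℕ) :
    ((zeta : ArithmeticFunction ℤ) ^ k).IsMultiplicative := by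
  induction k with
  | zero => rw [pow_zero]; exact ArithmeticFunction.isMultiplicative_one
  | succ k ih =>
    rw [pow_succ]
    exact ih.mul ArithmeticFunction.isMultiplicative_zeta.natCast

theorem zeta_pow_of_squarefree (k : ℕ) {d : ℕ} (hd : Squarefree d) :
    ((zeta : ArithmeticFunction ℤ) ^ k) d = (k : ℤ) ^ d.primeFactors.card := by
  have h := (isMultiplicative_zeta_pow k).map_prod_of_prime d.primeFactors
    fun p hp => Nat.prime_of_mem_primeFactors hp
  rw [Nat.prod_primeFactors_of_squarefree hd] at h
  rw [h, Finset.prod_congr rfl fun p hp => zeta_pow_prime k (Nat.prime_of_mem_primeFactors hp),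
    Finset.prod_const]

theorem log_lt_log_floor_add_one {R : ℝ} (hR : 0 < R) : Real.log R < Real.log (⌊R⌋₊ + 1) :=
  Real.log_lt_log hR (Nat.lt_floor_add_one R)

theorem log_floor_le_log {R : ℝ} (hR : 1 ≤ R) : Real.log ⌊R⌋₊ ≤ Real.log R :=
  Real.log_le_log (by exact_mod_cast Nat.floor_pos.2 hR) (Nat.floor_le (by linarith))

theorem sum_pow_card_primeFactors_le {R : ℝ} (hR : 1 ≤ R) (k : ℕ) :
    ∑ d ∈ (Finset.Icc 1 ⌊R⌋₊).filter Squarefree, (k : ℝ) ^ d.primeFactors.card ≤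
      R * (1 + Real.log R) ^ k := by
  have hL : 0 ≤ Real.log R := Real.log_nonneg hR
  calc _ ≤ ∑ d ∈ (Finset.Icc 1 ⌊R⌋₊).filter Squarefree,
        R * (((((zeta : ArithmeticFunction ℤ) ^ k) d : ℤ) : ℝ) / d) := by
        refine Finset.sum_le_sum fun d hd => ?_
        simp only [Finset.mem_filter, Finset.mem_Icc] at hd
        have hd0 : (0 : ℝ) < d := by exact_mod_cast hd.1.1
        have hdR : (d : ℝ) ≤ R := (Nat.le_floor_iff' (by omega)).1 hd.1.2
        rw [zeta_pow_of_squarefree k hd.2]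
        push_cast
        rw [mul_div_left_comm]
        exact le_mul_of_one_le_right (by positivity) ((one_le_div hd0).2 hdR)
    _ ≤ ∑ d ∈ Finset.Icc 1 ⌊R⌋₊, R * (((((zeta : ArithmeticFunction ℤ) ^ k) d : ℤ) : ℝ) / d) := by
        refine Finset.sum_le_sum_of_subset_of_nonneg (Finset.filter_subset _ _) fun d _ _ => ?_
        have : (0 : ℝ) ≤ ((((zeta : ArithmeticFunction ℤ) ^ k) d : ℤ) : ℝ) := by
          exact_mod_cast zeta_pow_nonneg k d
        positivity
    _ ≤ _ := by
        rw [← Finset.mul_sum]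
        exact mul_le_mul_of_nonneg_left (sum_zeta_pow_le (L := ⟨Real.log R, hL⟩)
          (log_lt_log_floor_add_one (by linarith)) (log_floor_le_log hR) k) (by linarith)

theorem prod_card_Omega_le {𝓗 : Finset ℕ} (h𝓗 : 𝓗.Nonempty) (S T : Finset ℕ) :
    ∏ p ∈ S ∪ T, ((Omega 𝓗 p).card : ℝ) ≤ (𝓗.card : ℝ) ^ S.card * (𝓗.card : ℝ) ^ T.card := by
  calc _ ≤ ∏ p ∈ S ∪ T, (𝓗.card : ℝ) :=
        Finset.prod_le_prod (fun p _ => Nat.cast_nonneg _)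
          fun p _ => by exact_mod_cast card_Omega_le 𝓗 p
    _ = (𝓗.card : ℝ) ^ (S ∪ T).card := Finset.prod_const _
    _ ≤ (𝓗.card : ℝ) ^ (S.card + T.card) :=
        pow_le_pow_right₀ (by exact_mod_cast h𝓗.card_pos) (Finset.card_union_le _ _)
    _ = _ := pow_add _ _ _

/-- The sieve sum with its arithmetic weights evaluated by the operator calculus. -/
theorem act_prod_sieveFactor_eq_sum (𝓗 : Finset ℕ) {L : ℝ≥0} {M : ℕ}
    (hM : (L : ℝ) < Real.log (M + 1)) (a : ℕ) :
    act L (∏ p ∈ primesUpTo M, sieveFactor (Omega 𝓗 p).card p)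
        (tens L (truncPow a) (truncPow a)) (corner L) =
      ∑ d ∈ (Finset.Icc 1 M).filter Squarefree, ∑ e ∈ (Finset.Icc 1 M).filter Squarefree,
        (moebius d * truncPow a (L - Real.log d)) * (moebius e * truncPow a (L - Real.log e)) *
          ∏ p ∈ d.primeFactors ∪ e.primeFactors, ((Omega 𝓗 p).card : ℝ) / p := by
  have hφ : ∀ u < 0, truncPow a u = 0 := fun u hu => truncPow_of_neg a hu
  have e1 : ∀ p : ℕ, sieveFactor (Omega 𝓗 p).card p = 1 - (((Omega 𝓗 p).card : ℝ) / p) •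
      (AddMonoidAlgebra.single (ln p • (1, 0)) 1 + AddMonoidAlgebra.single (ln p • (0, 1)) 1 -
        AddMonoidAlgebra.single (ln p • (1, 1)) (1 : ℝ)) := by
    intro p
    simp only [sieveFactor, pvar, smul_add, smul_sub, AddMonoidAlgebra.smul_single, smul_eq_mul,
      mul_one, mul_one_div]
  rw [Finset.prod_congr rfl fun p _ => e1 p, act_prod_eq_sum hM]
  simp only [LinearMap.sum_apply, Finset.sum_apply, LinearMap.smul_apply, Pi.smul_apply,
    smul_eq_mul]
  refine Finset.sum_congr rfl fun d _ => Finset.sum_congr rfl fun e _ => ?_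
  rw [shift_tens hφ hφ]
  simp only [corner, coe_ln]
  ring

/-- Opening the square and counting `n` for each pair `d, e` replaces the sum over `n` by `N` times
the sieve sum; the counting error is smaller than `N` once `R` is slightly below `N ^ (1/2)`. -/
theorem abs_sum_LambdaR_sq_sub_le {𝓗 : Finset ℕ} (h𝓗 : 𝓗.Nonempty) {N R : ℝ} (hN : 0 ≤ N)
    (hR : 1 ≤ R) {L : ℝ≥0} (hL : (L : ℝ) = Real.log R) (a : ℕ) :
    |(∑ n ∈ Finset.Ioc ⌊N⌋₊ ⌊2 * N⌋₊, LambdaR R n 𝓗 a ^ 2) -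
      N * act L (∏ p ∈ primesUpTo ⌊R⌋₊, sieveFactor (Omega 𝓗 p).card p)
        (tens L (truncPow a) (truncPow a)) (corner L)| ≤
      2 * (R * (1 + Real.log R) ^ (a + 𝓗.card)) ^ 2 := by
  have hM : (L : ℝ) < Real.log (⌊R⌋₊ + 1) := by
    rw [hL]; exact log_lt_log_floor_add_one (by linarith)
  have hL0 : 0 ≤ Real.log R := Real.log_nonneg hR
  rw [act_prod_sieveFactor_eq_sum 𝓗 hM a, hL]
  set D := (Finset.Icc 1 ⌊R⌋₊).filter Squarefree with hD
  set t : ℕ → ℝ := fun d => moebius d * truncPow a (Real.log R - Real.log d) with ht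
  have hsq : ∀ n ∈ Finset.Ioc ⌊N⌋₊ ⌊2 * N⌋₊, LambdaR R n 𝓗 a ^ 2 = ∑ d ∈ D, ∑ e ∈ D,
      t d * t e * (if d ∣ tuplePoly 𝓗 n ∧ e ∣ tuplePoly 𝓗 n then 1 else 0) := by
    intro n hn
    have hn0 : 0 < n := (Nat.zero_le _).trans_lt (Finset.mem_Ioc.1 hn).1
    rw [LambdaR_eq R hn0, sq, Finset.sum_mul_sum]
    refine Finset.sum_congr rfl fun d _ => Finset.sum_congr rfl fun e _ => ?_
    by_cases h1 : d ∣ tuplePoly 𝓗 n <;> by_cases h2 : e ∣ tuplePoly 𝓗 n <;> simp [h1, h2, t]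
  have hsum : ∑ n ∈ Finset.Ioc ⌊N⌋₊ ⌊2 * N⌋₊, LambdaR R n 𝓗 a ^ 2 = ∑ d ∈ D, ∑ e ∈ D,
      t d * t e * (((Finset.Ioc ⌊N⌋₊ ⌊2 * N⌋₊).filter
        fun n => d ∣ tuplePoly 𝓗 n ∧ e ∣ tuplePoly 𝓗 n).card : ℝ) := by
    rw [Finset.sum_congr rfl hsq, Finset.sum_comm]
    refine Finset.sum_congr rfl fun d _ => ?_
    rw [Finset.sum_comm]
    refine Finset.sum_congr rfl fun e _ => ?_
    rw [← Finset.mul_sum, Finset.sum_boole]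
  have htb : ∀ d ∈ D, |t d| ≤ (1 + Real.log R) ^ a := by
    intro d hd
    have h1 : |((moebius d : ℤ) : ℝ)| ≤ 1 := by
      exact_mod_cast ArithmeticFunction.abs_moebius_le_one (n := d)
    have h2 : truncPow a (Real.log R - Real.log d) ≤ (1 + Real.log R) ^ a :=
      truncPow_le a hL0 (sub_le_self _ (Real.log_natCast_nonneg d))
    rw [ht, abs_mul, abs_of_nonneg (truncPow_nonneg _ _)]
    exact (mul_le_of_le_one_left (truncPow_nonneg _ _) h1).trans h2
  rw [hsum, Finset.mul_sum, ← Finset.sum_sub_distrib]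
  set ν : ℕ → ℝ := fun d => (𝓗.card : ℝ) ^ d.primeFactors.card with hν
  calc _ ≤ ∑ d ∈ D, ∑ e ∈ D, 2 * ((1 + Real.log R) ^ a * ν d) * ((1 + Real.log R) ^ a * ν e) := by
        refine (Finset.abs_sum_le_sum_abs _ _).trans (Finset.sum_le_sum fun d hd => ?_)
        rw [Finset.mul_sum, ← Finset.sum_sub_distrib]
        refine (Finset.abs_sum_le_sum_abs _ _).trans (Finset.sum_le_sum fun e he => ?_)
        have h1 := abs_card_dvd_and_dvd_sub_le 𝓗 hN (Finset.mem_filter.1 hd).2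
          (Finset.mem_filter.1 he).2
        have h2 := h1.trans (mul_le_mul_of_nonneg_left
          (prod_card_Omega_le h𝓗 d.primeFactors e.primeFactors) zero_le_two)
        have e1 : ∀ x y z : ℝ, x * y - N * (x * z) = x * (y - N * z) := fun x y z => by ring
        rw [e1, abs_mul, abs_mul]
        calc _ ≤ ((1 + Real.log R) ^ a * (1 + Real.log R) ^ a) * (2 * (ν d * ν e)) :=
              mul_le_mul (mul_le_mul (htb d hd) (htb e he) (abs_nonneg _) (by positivity)) h2
                (abs_nonneg _) (by positivity)
          _ = _ := by ring
    _ = 2 * ((1 + Real.log R) ^ a * ∑ d ∈ D, ν d) ^ 2 := by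
        simp only [← Finset.mul_sum]
        rw [← Finset.sum_mul, ← Finset.mul_sum, ← Finset.mul_sum]
        ring
    _ ≤ 2 * ((1 + Real.log R) ^ a * (R * (1 + Real.log R) ^ 𝓗.card)) ^ 2 := by
        have h1 : 0 ≤ ∑ d ∈ D, ν d := Finset.sum_nonneg fun d _ => by positivity
        have h2 := sum_pow_card_primeFactors_le hR 𝓗.card
        gcongr
    _ = _ := by rw [pow_add]; ring

end SmallGaps

/-! ### The asymptotic formula -/

namespace SmallGaps

open scoped NNReal
open Filter Topology

/-- The asymptotic formula with an error in terms of `R` and of a bound `w` for the number of primes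
modulo which elements of `𝓗` collide. -/
theorem exists_abs_sum_LambdaR_sq_sub_le {k ℓ : ℕ} (hk : 0 < k) (hℓ : 0 < ℓ) :
    ∃ C c : ℝ, 0 < C ∧ 0 < c ∧ ∀ (𝓗 : Finset ℕ) (N H R w : ℝ), 𝓗.card = k → 0 ≤ N → 1 ≤ R →
      (∀ h ∈ 𝓗, 1 ≤ h ∧ (h : ℝ) ≤ H) → H ≤ R → Real.exp 8 ≤ w →
      (k : ℝ) ^ 2 * (Real.log H / Real.log 2) ≤ w →
      |(∑ n ∈ Finset.Ioc ⌊N⌋₊ ⌊2 * N⌋₊, LambdaR R n 𝓗 (k + ℓ) ^ 2) -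
          singularSeries 𝓗 / ((k + 2 * ℓ).factorial : ℝ) *
            ((2 * ℓ).choose ℓ : ℝ) * N * Real.log R ^ (k + 2 * ℓ)| ≤
        C * (N * ((1 + Real.log R) ^ (k + 2 * ℓ - 1) * (1 + Real.log (1 + Real.log R)) * w ^ c) +
          (R * (1 + Real.log R) ^ (2 * k + ℓ)) ^ 2) := by
  obtain ⟨C1, c1, hC1, hc1, h1⟩ := exists_abs_act_prod_sieveFactor_sub_le k hℓ
  obtain ⟨C2, c2, hC2, hc2, h2⟩ := exists_prod_eulerFactor_le k
  obtain ⟨D, hD, h3⟩ := exists_abs_prod_singularFactor_sub_le k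
  set b : ℝ := ((2 * ℓ).choose ℓ : ℝ) with hb
  have hb0 : 0 ≤ b := Nat.cast_nonneg _
  refine ⟨C1 + b * (C2 * D) + 2, c1 + c2, by positivity, by positivity,
    fun 𝓗 N H R w hcard hN hR hH hHR hw hkw => ?_⟩
  have hL0 : 0 ≤ Real.log R := Real.log_nonneg hR
  set L : ℝ≥0 := ⟨Real.log R, hL0⟩ with hL
  have hLR : (L : ℝ) = Real.log R := rfl
  have hLc : (0 : ℝ) ≤ (L : ℝ) := L.2
  have hM : (L : ℝ) < Real.log (⌊R⌋₊ + 1) := log_lt_log_floor_add_one (by linarith)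
  have hM' : Real.log ⌊R⌋₊ ≤ L := log_floor_le_log hR
  have hM1 : 1 ≤ ⌊R⌋₊ := Nat.floor_pos.2 hR
  have hMpos : (0 : ℝ) < ⌊R⌋₊ := by exact_mod_cast hM1
  set M := ⌊R⌋₊ with hMdef
  have hw1 : 1 ≤ w := (Real.one_le_exp (by norm_num)).trans hw
  set r : ℕ → ℝ := fun p => ((Omega 𝓗 p).card : ℝ) with hr
  have hr0 : ∀ p, 0 ≤ r p := fun p => Nat.cast_nonneg _
  have hrk : ∀ p, r p ≤ k := fun p => by
    rw [← hcard]; exact Nat.cast_le.2 (card_Omega_le 𝓗 p)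
  set B := (primesUpTo M).filter fun p => (Omega 𝓗 p).card ≠ 𝓗.card with hB
  have hBs : B ⊆ primesUpTo M := Finset.filter_subset _ _
  have hBw : (B.card : ℝ) ≤ w := by
    refine (card_defect_le hH fun p hp => ?_).trans (hcard ▸ hkw)
    rw [hB, Finset.mem_filter] at hp
    exact ⟨(mem_primesUpTo.1 hp.1).1, hp.2⟩
  have hgood : ∀ p ∈ primesUpTo M, p ∉ B → r p = k := by
    intro p hp hpB
    have : (Omega 𝓗 p).card = 𝓗.card := by
      by_contra hne
      exact hpB (Finset.mem_filter.2 ⟨hp, hne⟩)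
    rw [hr, ← hcard]
    exact congrArg Nat.cast this
  have hs : ∀ p ∈ primesUpTo M, p.Prime := fun p hp => (mem_primesUpTo.1 hp).1
  set P := ∏ p ∈ primesUpTo M, singularFactor 𝓗 p with hP
  have hPe : ∏ p ∈ primesUpTo M, eulerFactor k (r p) p = P :=
    Finset.prod_congr rfl fun p _ => by rw [singularFactor, eulerFactor, hcard]
  set T := act L (∏ p ∈ primesUpTo M, sieveFactor (r p) p)
    (tens L (truncPow (k + ℓ)) (truncPow (k + ℓ))) (corner L) with hT
  set F : ℝ := ((k + 2 * ℓ).factorial : ℝ) with hF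
  have hF1 : 1 ≤ F := Nat.one_le_cast.2 (Nat.factorial_pos _)
  set Q : ℝ := (1 + Real.log R) ^ (k + 2 * ℓ - 1) * (1 + Real.log (1 + Real.log R)) with hQ
  have hll : 0 ≤ Real.log (1 + Real.log R) := Real.log_nonneg (by linarith)
  have hQ0 : 0 ≤ Q := by positivity
  have g1 : |T - b * truncPow (k + 2 * ℓ) L * P| ≤ C1 * Q * w ^ (c1 + c2) := by
    have := h1 L M w B r hM hM' hw hBs hBw hr0 hrk hgood
    rw [hPe] at this
    refine this.trans (mul_le_mul_of_nonneg_left ?_ (by positivity))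
    exact Real.rpow_le_rpow_of_exponent_le hw1 (by linarith)
  have g2 : |b * truncPow (k + 2 * ℓ) L * P - b * truncPow (k + 2 * ℓ) L * singularSeries 𝓗| ≤
      b * (C2 * D) * Q * w ^ (c1 + c2) := by
    have hP2 : |P| ≤ C2 * w ^ (c1 + c2) := by
      rw [← hPe]
      refine (h2 w _ B r hw hs hBs hBw hr0 hrk hgood).trans
        (mul_le_mul_of_nonneg_left ?_ hC2.le)
      exact Real.rpow_le_rpow_of_exponent_le hw1 (by linarith)
    have h4 := h3 𝓗 M hcard hM1 fun h hh => Nat.le_floor ((hH h hh).2.trans hHR)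
    -- the tail of the singular series saves a factor `M`, which absorbs one power of `log R`
    have hLM : Real.log R ≤ M := by
      have := Real.log_le_sub_one_of_pos (by positivity : (0 : ℝ) < M + 1)
      rw [hLR] at hM
      linarith
    have ht0 := truncPow_nonneg (k + 2 * ℓ) (L : ℝ)
    have ht : truncPow (k + 2 * ℓ) L ≤ Q * M := by
      rw [truncPow_of_nonneg _ hLc, hLR]
      calc Real.log R ^ (k + 2 * ℓ) / F ≤ Real.log R ^ (k + 2 * ℓ) :=
            div_le_self (by positivity) hF1
        _ = Real.log R ^ (k + 2 * ℓ - 1) * Real.log R := by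
            rw [← pow_succ, show k + 2 * ℓ - 1 + 1 = k + 2 * ℓ by omega]
        _ ≤ Q * M := by
            refine mul_le_mul ?_ hLM hL0 hQ0
            refine (pow_le_pow_left₀ hL0 (by linarith : Real.log R ≤ 1 + Real.log R) _).trans ?_
            exact le_mul_of_one_le_right (by positivity) (by linarith)
    rw [← mul_sub, abs_mul, abs_of_nonneg (mul_nonneg hb0 ht0)]
    calc _ ≤ b * (Q * M) * ((C2 * w ^ (c1 + c2)) * (D / M)) := by
          refine mul_le_mul (mul_le_mul_of_nonneg_left ht hb0) (h4.trans ?_) (abs_nonneg _)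
            (by positivity)
          exact mul_le_mul_of_nonneg_right hP2 (by positivity)
      _ = _ := by field_simp
  have hne : 𝓗.Nonempty := Finset.card_pos.1 (hcard ▸ hk)
  have g3 := abs_sum_LambdaR_sq_sub_le hne hN hR hLR (k + ℓ)
  rw [hcard, show k + ℓ + k = 2 * k + ℓ by ring] at g3
  have e1 : singularSeries 𝓗 / F * b * N * Real.log R ^ (k + 2 * ℓ) =
      N * (b * truncPow (k + 2 * ℓ) L * singularSeries 𝓗) := by
    rw [truncPow_of_nonneg _ hLc, hLR]; ring
  rw [e1]
  set S := ∑ n ∈ Finset.Ioc ⌊N⌋₊ ⌊2 * N⌋₊, LambdaR R n 𝓗 (k + ℓ) ^ 2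
  set κ := b * truncPow (k + 2 * ℓ) L
  have g4 : |N * T - N * (κ * singularSeries 𝓗)| ≤
      N * ((C1 + b * (C2 * D)) * (Q * w ^ (c1 + c2))) := by
    rw [← mul_sub, abs_mul, abs_of_nonneg hN]
    refine mul_le_mul_of_nonneg_left ?_ hN
    refine (abs_sub_le _ (κ * P) _).trans ((add_le_add g1 g2).trans (le_of_eq ?_))
    ring
  have hE1 : 0 ≤ N * (Q * w ^ (c1 + c2)) := by positivity
  have hE2 : 0 ≤ (R * (1 + Real.log R) ^ (2 * k + ℓ)) ^ 2 := sq_nonneg _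
  have hc0 : 0 ≤ (C1 + b * (C2 * D)) * (R * (1 + Real.log R) ^ (2 * k + ℓ)) ^ 2 := by positivity
  calc _ ≤ _ := abs_sub_le _ (N * T) _
    _ ≤ 2 * (R * (1 + Real.log R) ^ (2 * k + ℓ)) ^ 2 +
        N * ((C1 + b * (C2 * D)) * (Q * w ^ (c1 + c2))) := add_le_add g3 g4
    _ ≤ _ := by linarith

end SmallGaps

theorem lemma1 (k ℓ : ℕ) (hk : 0 < k) (hℓ : 0 < ℓ) :
    ∃ C c K : ℝ, 0 < C ∧ 0 < c ∧ 0 < K ∧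
      ∀ A B : ℝ, 0 < A → 0 < B → ∃ N₀ : ℝ,
        ∀ N H R : ℝ, N₀ ≤ N → 0 < R →
          H ≤ A * Real.log N →
          Real.log N ≤ B * Real.log R →
          Real.log R ≤ Real.log N →
          R ≤ N ^ (1 / 2 : ℝ) / Real.log N ^ C →
          ∀ 𝓗 : Finset ℕ, 𝓗.card = k → (∀ h ∈ 𝓗, 1 ≤ h ∧ (h : ℝ) ≤ H) →
            SmallGaps.Admissible 𝓗 →
            |(∑ n ∈ Finset.Ioc ⌊N⌋₊ ⌊2 * N⌋₊, SmallGaps.LambdaR R n 𝓗 (k + ℓ) ^ 2) -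
                SmallGaps.singularSeries 𝓗 / ((k + 2 * ℓ).factorial : ℝ) *
                  ((2 * ℓ).choose ℓ : ℝ) * N * Real.log R ^ (k + 2 * ℓ)| ≤
              K * (N * Real.log N ^ (k + 2 * ℓ - 1) * Real.log (Real.log N) ^ c) := by
  obtain ⟨C, c, hC, hc, hmain⟩ := SmallGaps.exists_abs_sum_LambdaR_sq_sub_le hk hℓ
  have hk0 : (1 : ℝ) ≤ k := by exact_mod_cast hk
  refine ⟨((2 * k + ℓ : ℕ) : ℝ), c + 1,
    C * (2 ^ (k + 2 * ℓ - 1) * 3 * (4 * (k : ℝ) ^ 2) ^ c + 4 ^ (2 * k + ℓ)),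
    by positivity, by positivity, by positivity, fun A B hA hB => ?_⟩
  -- `N₀` makes `H ≤ (log N) ^ 2 ≤ R`, and makes `w = 4 k ^ 2 log log N` bound the number of primes
  -- modulo which elements of `𝓗` collide
  have hlog := Real.tendsto_log_atTop
  have hll := hlog.comp hlog
  have hsmall : ∀ᶠ x : ℝ in Filter.atTop, 2 * B * Real.log x ≤ x := by
    have h := Real.isLittleO_log_id_atTop.bound (by positivity : 0 < 1 / (2 * B))
    filter_upwards [h, Filter.eventually_ge_atTop 1] with x hx hx1
    rw [Real.norm_of_nonneg (Real.log_nonneg hx1), id, Real.norm_of_nonneg (by linarith)] at hx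
    calc 2 * B * Real.log x ≤ 2 * B * (1 / (2 * B) * x) :=
          mul_le_mul_of_nonneg_left hx (by positivity)
      _ = x := by field_simp
  obtain ⟨N₀, hN₀⟩ := Filter.eventually_atTop.1 ((Filter.eventually_ge_atTop (1 : ℝ)).and
    ((hlog.eventually_ge_atTop (A + 1)).and ((hll.eventually_ge_atTop (Real.exp 8)).and
      (hlog.eventually hsmall))))
  refine ⟨N₀, fun N H R hN hR hHA hNB hRN hRle 𝓗 hcard hH _ => ?_⟩
  obtain ⟨hN1, hxA, hy8, hxy⟩ := hN₀ N hN
  rw [Function.comp_apply] at hy8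
  set x := Real.log N with hx
  set y := Real.log x with hy
  have hx1 : 1 ≤ x := by linarith
  have hx0 : 0 < x := by linarith
  have hy1 : 1 ≤ y := (Real.one_le_exp (by norm_num)).trans hy8
  have hy0 : 0 < y := by linarith
  have hxR : 2 * y ≤ Real.log R := by
    have h1 : B * (2 * y) ≤ B * Real.log R := by linarith
    exact le_of_mul_le_mul_left h1 hB
  have hL0 : 0 ≤ Real.log R := by linarith
  have hR1 : 1 ≤ R := (Real.log_nonneg_iff hR).1 hL0
  have hHx : H ≤ x ^ 2 := by nlinarith
  have hx2 : Real.log (x ^ 2) = 2 * y := by rw [Real.log_pow, Nat.cast_ofNat]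
  have hHR : H ≤ R := by
    refine hHx.trans ((Real.log_le_log_iff (by positivity) hR).1 ?_)
    rw [hx2]
    exact hxR
  obtain ⟨h₀, hh₀⟩ := Finset.card_pos.1 (hcard ▸ hk : 0 < 𝓗.card)
  have hH1 : 1 ≤ H := le_trans (by exact_mod_cast (hH h₀ hh₀).1) (hH h₀ hh₀).2
  have hlogH : Real.log H ≤ 2 * y := by
    rw [← hx2]
    exact Real.log_le_log (by linarith) hHx
  have hw8 : Real.exp 8 ≤ 4 * (k : ℝ) ^ 2 * y :=
    hy8.trans (le_mul_of_one_le_left hy0.le (by nlinarith))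
  have hkw : (k : ℝ) ^ 2 * (Real.log H / Real.log 2) ≤ 4 * (k : ℝ) ^ 2 * y := by
    have h1 : Real.log H / Real.log 2 ≤ 4 * y := by
      rw [div_le_iff₀ (Real.log_pos one_lt_two)]
      nlinarith [Real.log_two_gt_d9]
    calc _ ≤ (k : ℝ) ^ 2 * (4 * y) := mul_le_mul_of_nonneg_left h1 (by positivity)
      _ = _ := by ring
  refine (hmain 𝓗 N H R _ hcard (by linarith) hR1 hH hHR hw8 hkw).trans ?_
  rw [mul_assoc C]
  refine mul_le_mul_of_nonneg_left ?_ hC.le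
  rw [add_mul]
  refine add_le_add ?_ ?_
  · have h1 : (1 + Real.log R) ^ (k + 2 * ℓ - 1) ≤ (2 * x) ^ (k + 2 * ℓ - 1) :=
      pow_le_pow_left₀ (by linarith) (by linarith) _
    have h2 : 1 + Real.log (1 + Real.log R) ≤ 3 * y := by
      have h3 : Real.log (1 + Real.log R) ≤ Real.log (2 * x) :=
        Real.log_le_log (by linarith) (by linarith)
      rw [Real.log_mul two_ne_zero hx0.ne'] at h3
      linarith [Real.log_two_lt_d9]
    calc _ ≤ N * ((2 * x) ^ (k + 2 * ℓ - 1) * (3 * y) * (4 * (k : ℝ) ^ 2 * y) ^ c) := by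
          have h4 : 0 ≤ Real.log (1 + Real.log R) := Real.log_nonneg (by linarith)
          gcongr
      _ = _ := by
          rw [Real.mul_rpow (by positivity) hy0.le, Real.rpow_add hy0, Real.rpow_one, mul_pow]
          ring
  -- the exponent `2k + ℓ` in the bound for `R` is what the counting error requires
  · have h1 : R * (1 + Real.log R) ^ (2 * k + ℓ) ≤ N ^ (1 / 2 : ℝ) * 2 ^ (2 * k + ℓ) := by
      rw [Real.rpow_natCast] at hRle
      calc _ ≤ N ^ (1 / 2 : ℝ) / x ^ (2 * k + ℓ) * (2 * x) ^ (2 * k + ℓ) :=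
            mul_le_mul hRle (pow_le_pow_left₀ (by linarith) (by linarith) _) (by positivity)
              (by positivity)
        _ = _ := by rw [mul_pow]; field_simp
    have h2 : (N ^ (1 / 2 : ℝ)) ^ 2 = N := by
      rw [← Real.sqrt_eq_rpow, Real.sq_sqrt (by linarith)]
    have h3 : 1 ≤ x ^ (k + 2 * ℓ - 1) * y ^ (c + 1) :=
      one_le_mul_of_one_le_of_one_le (one_le_pow₀ hx1) (Real.one_le_rpow hy1 (by linarith))
    calc _ ≤ (N ^ (1 / 2 : ℝ) * 2 ^ (2 * k + ℓ)) ^ 2 :=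
          pow_le_pow_left₀ (by positivity) h1 2
      _ = 4 ^ (2 * k + ℓ) * N := by
          rw [mul_pow, h2, ← pow_mul, mul_comm (2 * k + ℓ) 2, pow_mul]; norm_num; ring
      _ ≤ 4 ^ (2 * k + ℓ) * N * (x ^ (k + 2 * ℓ - 1) * y ^ (c + 1)) :=
          le_mul_of_one_le_right (by positivity) h3
      _ = _ := by ring
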